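/- **Setting.** Let $p=p(y,\eta;t_n)$ be a real $m\times m$ matrix-valued function, smooth in $(y,\eta)\in\mathbb R^2$, all of whose partial derivatives in $(y,\eta)$ are square-integrable on every quadrant $(-\infty,c]^2$. For $x\in\mathbb R$ let $P_{a,b}$ be the Hilbert–Schmidt operator on $L^2((-\infty,0];\mathbb R^m)$ with kernel $(\partial_y^a\partial_\eta^b p)(z+x,\zeta+x)$, and put $P=P_{0,0}$, $V=(\mathrm{id}-P)^{-1}$ (at the points where $\mathrm{id}-P$ is invertible), $G=PV$. Write $[\![T]\!]=[\![T]\!](z,\zeta)$ for the continuous kernel of a Hilbert–Schmidt operator $T$, and $C^n_k=\binom nk$. Assume the ansatz $$w_j(x)=(-1)^j\,\partial_\zeta^{\,j-1}[\![G]\!](z,\zeta)\big|_{z=\zeta=0},\qquad j\ge1 .$$ For $n\ge1$ the Sato coefficients $b_{n-2},b_{n-3},\dots,b_0,b_{-1}$ are the functions of $x$ given recursively by $$\mathcal L_k=C^n_k\partial_x^k+\sum_{\ell=0}^{k-2}C^{n-k+\ell}_\ell\, b_{n-k+\ell}\,\partial_x^\ell,\qquad b_{n-k}=\sum_{j=1}^{k-1}\mathcal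 L_{k-j}w_j\quad(2\le k\le n+1),$$ so that $b_{-1}=\sum_{j=1}^n\mathcal L_{n-j+1}w_j$ is the right-hand side of the $n$-th hierarchy equation for $w_1$. **The augmented pre-Pöppe algebra.** This is the real vector space with basis the formal monomials $[\![V]\!]$ and $[\![VP_{a_1,b_1}V\cdots VP_{a_r,b_r}V]\!]$ ($r\ge1$, $a_i,b_i\ge0$), with the bilinear product which, for monomials $[\![X]\!]$ and $[\![Y]\!]$, is $$[\![X]\!]\,[\![Y]\!]=[\![X^{\mathfrak r}\cdot Y]\!]+[\![X\cdot{}^{\mathfrak l}Y]\!]+[\![X\,P_{1,0}\,Y]\!]+[\![X\,P_{0,1}\,Y]\!].$$ Here $X^{\mathfrak r}$ is $X$ with the last factor $P_{a_r,b_r}$ replaced by $P_{a_r,b_r+1}$, ${}^{\mathfrak l}Y$ is $Y$ with the first factor $P_{a_1,b_1}$ replaced by $P_{a_1+1,b_1}$, the dot means concatenation with the two adjacent letters $V$ merged into one, and the first (second) term is omitted if $X=V$ ($Y=V$). The linear map $\partial_x$ acts on monomials by the Leibniz rule with $\partial_xV=V(P_{1,0}+P_{0,1})V$ and $\partial_xP_{a,b}=P_{a+1,b}+P_{a,b+1}$.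 An element with no $[\![V]\!]$-component is read as a function of $x$ by interpreting each monomial as the kernel of the corresponding operator, evaluated at $z=\zeta=0$. **Claim.** For every $n\ge1$ there are elements $b_{n-k}$, $2\le k\le n+1$, of the augmented pre-Pöppe algebra, with no $[\![V]\!]$-component and depending only on $n$ and $k$, that satisfy $$b_{n-k}=-\Bigl(C^n_{k-1}\partial_x^{k-1}+\sum_{\ell=3}^{k}C^{n-\ell+1}_{k-\ell}\,b_{n-\ell+1}\,\partial_x^{k-\ell}\Bigr)[\![V]\!],$$ where all products are augmented pre-Pöppe products (the term $\ell=k$ being $C_0^{n-k+1}b_{n-k+1}[\![V]\!]$), and whose readings as functions of $x$ are the Sato coefficients: for every $m$, every $p$ as above and every $x$ at which $\mathrm{id}-P$ is invertible. This includes $k=n+1$. If moreover $p$ is smooth in all its variables for $t_n$ in an open set, the $L^2((-\infty,c]^2)$-norms of its partial derivatives in $(y,\eta)$ are locally bounded in $t_n$, and $p$ solves the base equation $\partial_{t_n}p=\partial_y^np-(-1)^n\partial_\eta^np$, then $w_1$ is differentiable in $t_n$ and $$\partial_{t_n}w_1=b_{-1}$$ wherever $\mathrm{id}-P$ is invertible.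 -/

import Mathlib

open MeasureTheory Set Filter Topology
open scoped ContDiff NNReal ENNReal

namespace KP

noncomputable section

/-! ### The augmented pre-Pöppe algebra

The basis monomial `⟦V P_{a₁,b₁} V ⋯ P_{a_r,b_r} V⟧` is encoded by the list
`[(a₁,b₁), …, (a_r,b_r)]`; the empty list is the monomial `⟦V⟧`. -/

/-- Underlying real vector space of the augmented pre-Pöppe algebra: formal real linear
combinations of the monomials. -/
abbrev AP : Type := List (ℕ × ℕ) →₀ ℝ

/-- A monomial as an element of the algebra. -/
def mono (l : List (ℕ × ℕ)) : AP := Finsupp.single l 1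

/-- The monomial `⟦V⟧`. -/
def vKer : AP := mono []

/-- Apply `∂_l` to the first factor `P_{a₁,b₁}` of a monomial (no term for `⟦V⟧`). -/
def incFirst : List (ℕ × ℕ) → Option (List (ℕ × ℕ))
  | [] => none
  | (a, b) :: l => some ((a + 1, b) :: l)

/-- Apply `∂_r` to the last factor `P_{a_r,b_r}` of a monomial (no term for `⟦V⟧`). -/
def incLast : List (ℕ × ℕ) → Option (List (ℕ × ℕ))
  | [] => none
  | [(a, b)] => some [(a, b + 1)]
  | c :: d :: l => (incLast (d :: l)).map (List.cons c)

/-- A monomial, or zero if there is none. -/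
def optMono : Option (List (ℕ × ℕ)) → AP
  | none => 0
  | some l => mono l

/-- The augmented pre-Pöppe product of two monomials. For two nonempty lists these are the four
terms of the pre-Pöppe product
`⟦F P_{a,b} V⟧ ⟦V P_{c,d} F'⟧ = ⟦F (∂_r P_{a,b}) V P_{c,d} F'⟧ + ⟦F P_{a,b} V (∂_l P_{c,d}) F'⟧
  + ⟦F P_{a,b} V (P_{1,0} + P_{0,1}) V P_{c,d} F'⟧`;
if a factor is `⟦V⟧`, the term in which its (missing) `P` would be differentiated is absent. -/
def monoMul (u v : List (ℕ × ℕ)) : AP :=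
  optMono ((incLast u).map (fun u' => u' ++ v)) + optMono ((incFirst v).map (fun v' => u ++ v'))
    + mono (u ++ (1, 0) :: v) + mono (u ++ (0, 1) :: v)

/-- The augmented pre-Pöppe product (bilinear, nonassociative). -/
def augMul : AP →ₗ[ℝ] AP →ₗ[ℝ] AP :=
  Finsupp.linearCombination ℝ (fun u => Finsupp.linearCombination ℝ (fun v => monoMul u v))

/-- `∂_x` of a monomial, by the Leibniz rule with `∂_x V = V (P_{1,0} + P_{0,1}) V` and
`∂_x P_{a,b} = P_{a+1,b} + P_{a,b+1}`. -/
def dxMono : List (ℕ × ℕ) → AP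
  | [] => mono [(1, 0)] + mono [(0, 1)]
  | (a, b) :: l =>
      mono ((1, 0) :: (a, b) :: l) + mono ((0, 1) :: (a, b) :: l)
        + mono ((a + 1, b) :: l) + mono ((a, b + 1) :: l)
        + Finsupp.lmapDomain ℝ ℝ (List.cons (a, b)) (dxMono l)

/-- The derivative `∂_x` on the augmented pre-Pöppe algebra. -/
def dx : AP →ₗ[ℝ] AP := Finsupp.linearCombination ℝ dxMono

/-! ### Operators on `L²((-∞,0]; ℝᵐ)` and their kernels -/

/-- `ℝᵐ`. -/
abbrev Vec (m : ℕ) : Type := EuclideanSpace ℝ (Fin m)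

/-- `ℝ^{m×m}`, realised as the algebra of endomorphisms of `ℝᵐ`. -/
abbrev Mat (m : ℕ) : Type := Vec m →L[ℝ] Vec m

/-- Lebesgue measure on `(-∞,0]`. -/
abbrev halfLine : Measure ℝ := volume.restrict (Iic 0)

/-- `L²((-∞,0]; ℝᵐ)`. -/
abbrev HSpace (m : ℕ) : Type := Lp (Vec m) 2 halfLine

/-- `T` is the Hilbert–Schmidt operator with the continuous square-integrable kernel `k`. Only the
values of `k` on `(-∞,0]²` matter, and there `k` and `T` determine each other. -/
structure IsKernelOf {m : ℕ} (k : ℝ → ℝ → Mat m) (T : HSpace m →L[ℝ] HSpace m) : Prop where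
  continuousOn : ContinuousOn (fun q : ℝ × ℝ => k q.1 q.2) (Iic 0 ×ˢ Iic 0)
  memLp : MemLp (fun q : ℝ × ℝ => k q.1 q.2) 2 (halfLine.prod halfLine)
  apply_eq : ∀ φ : HSpace m, ∀ᵐ z ∂halfLine, T φ z = ∫ ζ, k z ζ (φ ζ) ∂halfLine

open Classical in
/-- The operator with kernel `k` (zero if there is none). -/
def opOf {m : ℕ} (k : ℝ → ℝ → Mat m) : HSpace m →L[ℝ] HSpace m :=
  if h : ∃ T, IsKernelOf k T then h.choose else 0

open Classical in
/-- The kernel bracket `⟦T⟧ = ⟦T⟧(z,ζ)` (zero if `T` has no continuous square-integrable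
kernel). -/
def bracket {m : ℕ} (T : HSpace m →L[ℝ] HSpace m) : ℝ → ℝ → Mat m :=
  if h : ∃ k, IsKernelOf k T then h.choose else 0

/-- The partial derivative `∂_y^a ∂_η^b p`. -/
def pderiv {m : ℕ} (a b : ℕ) (p : ℝ → ℝ → Mat m) (y η : ℝ) : Mat m :=
  iteratedDeriv a (fun y' => iteratedDeriv b (fun η' => p y' η') η) y

/-- `p` is smooth and all its partial derivatives are square-integrable on every quadrant
`(-∞,c]²`. -/
structure IsScatteringKernel {m : ℕ} (p : ℝ → ℝ → Mat m) : Prop where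
  smooth : ContDiff ℝ ∞ (fun q : ℝ × ℝ => p q.1 q.2)
  sqIntegrable : ∀ (a b : ℕ) (c : ℝ),
    MemLp (fun q : ℝ × ℝ => pderiv a b p q.1 q.2) 2 (volume.restrict (Iic c ×ˢ Iic c))

/-- The operator `P_{a,b} = ∂_l^a ∂_r^b P` at the parameter `x`, where `P` is the semi-additive
operator with kernel `p(z+x,ζ+x)`. -/
def opP {m : ℕ} (p : ℝ → ℝ → Mat m) (x : ℝ) (a b : ℕ) : HSpace m →L[ℝ] HSpace m :=
  opOf (fun z ζ => pderiv a b p (z + x) (ζ + x))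

/-- `V = (id - P)⁻¹`. -/
def opV {m : ℕ} (p : ℝ → ℝ → Mat m) (x : ℝ) : HSpace m →L[ℝ] HSpace m :=
  Ring.inverse (1 - opP p x 0 0)

/-- The operator `V P_{a₁,b₁} V ⋯ P_{a_r,b_r} V`. -/
def opMono {m : ℕ} (p : ℝ → ℝ → Mat m) (x : ℝ) : List (ℕ × ℕ) → (HSpace m →L[ℝ] HSpace m)
  | [] => opV p x
  | (a, b) :: l => opV p x * opP p x a b * opMono p x l

/-- The value at `z = ζ = 0` of an element of the augmented pre-Pöppe algebra, obtained by reading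
each formal monomial as the kernel of the corresponding operator. This is meaningful on elements
with no `⟦V⟧`-component, `V` itself not being a Hilbert–Schmidt operator. -/
def realise {m : ℕ} (p : ℝ → ℝ → Mat m) (x : ℝ) (X : AP) : Mat m :=
  X.sum fun l c => c • bracket (opMono p x l) 0 0

/-- The solution `G = P V` of `P = G (id - P)`. -/
def opG {m : ℕ} (p : ℝ → ℝ → Mat m) (x : ℝ) : HSpace m →L[ℝ] HSpace m :=
  opP p x 0 0 * opV p x

/-- The ansatz `w_j(x) = (-1)^j ∂_r^{j-1} ⟦G⟧(0,0;x)`, for `j ≥ 1`. -/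
def gaugeCoeff {m : ℕ} (p : ℝ → ℝ → Mat m) (j : ℕ) (x : ℝ) : Mat m :=
  (-1 : ℝ) ^ j • iteratedDerivWithin (j - 1) (fun ζ => bracket (opG p x) 0 ζ) (Iic 0) 0

/-! ### The Sato coefficients -/

/-- The operator
`𝓛_k = ∑_{ℓ=0}^{k-2} C(n-k+ℓ, ℓ) b_{n-k+ℓ} ∂_x^ℓ + C(n,k) ∂_x^k`, where `b i` stands for the
coefficient `b_{n-i}` (so that `i = k - ℓ` runs from `2` to `k`). -/
def satoL {A : Type*} [NormedRing A] [NormedAlgebra ℝ A] (n : ℕ) (b : ℕ → ℝ → A) (k : ℕ)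
    (f : ℝ → A) (x : ℝ) : A :=
  (∑ i ∈ Finset.Icc 2 k, ((n - i).choose (k - i) : ℝ) • (b i x * iteratedDeriv (k - i) f x))
    + (n.choose k : ℝ) • iteratedDeriv k f x

/-- The Sato coefficient `b_{n-k} = ∑_{j=1}^{k-1} 𝓛_{k-j} w_j` as a function of `x`; see
`satoCoeff_eq`. The index `k = n+1` gives the right-hand side `b_{-1} = ∑_{j=1}^{n} 𝓛_{n-j+1} w_j`
of the hierarchy equation for `∂_{t_n} w_1`. -/
def satoCoeff {A : Type*} [NormedRing A] [NormedAlgebra ℝ A] (n : ℕ) (w : ℕ → ℝ → A) (k : ℕ) :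
    ℝ → A :=
  fun x => ∑ j ∈ Finset.Icc 1 (k - 1),
    satoL n (fun i => if _h : i < k then satoCoeff n w i else 0) (k - j) (w j) x
termination_by k

theorem satoCoeff_eq {A : Type*} [NormedRing A] [NormedAlgebra ℝ A] (n : ℕ) (w : ℕ → ℝ → A)
    (k : ℕ) (x : ℝ) :
    satoCoeff n w k x = ∑ j ∈ Finset.Icc 1 (k - 1), satoL n (satoCoeff n w) (k - j) (w j) x := by
  rw [satoCoeff]
  refine Finset.sum_congr rfl fun j hj => ?_
  have hj' := Finset.mem_Icc.1 hj
  unfold satoL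
  congr 1
  refine Finset.sum_congr rfl fun i hi => ?_
  have hi' := Finset.mem_Icc.1 hi
  simp only [show i < k by omega, dite_true]

/-! ### Dependence on the time `t_n` -/

/-- A family `p s`, `s = t_n` in the open set `T`, of scattering kernels that is smooth in all
variables, with the `L²((-∞,c]²)`-norms of all partial derivatives locally bounded in `s`, and
solves the base equation `∂_{t_n} p = ∂_y^n p - (-1)^n ∂_η^n p`. The other times are fixed. -/
structure SolvesBase {m : ℕ} (n : ℕ) (T : Set ℝ) (p : ℝ → ℝ → ℝ → Mat m) : Prop where
  isOpen : IsOpen T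
  smooth : ContDiffOn ℝ ∞ (fun q : ℝ × ℝ × ℝ => p q.1 q.2.1 q.2.2) (T ×ˢ univ)
  kernel : ∀ s ∈ T, IsScatteringKernel (p s)
  bounded : ∀ (a b : ℕ) (c : ℝ), ∀ s ∈ T, ∃ C : ℝ≥0, ∀ᶠ s' in 𝓝 s,
    eLpNorm (fun q : ℝ × ℝ => pderiv a b (p s') q.1 q.2) 2
      (volume.restrict (Iic c ×ˢ Iic c)) ≤ C
  base : ∀ s ∈ T, ∀ y η : ℝ,
    HasDerivAt (fun s' => p s' y η)
      (pderiv n 0 (p s) y η - (-1 : ℝ) ^ n • pderiv 0 n (p s) y η) s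

end

end KP

/-! Everything is read at the end point z = ζ = 0. Each P_{a,b} is bordered by its column, its row
and its kernel value there, which gives an operator on L² × ℝᵐ. Let E project to the border and Q to
L². Integration by parts on the half line becomes P_{a,b+1} Q P_{c,d} + P_{a,b} Q P_{c+1,d} =
P_{a,b} E P_{c,d}, and V = id + PV = id + VP becomes Q + QPV = V = Q + VPQ. From these relations
alone (`BorderedRelations.product`) the augmented product of elements without ⟦V⟧-component reads as
the product of their values at the end point, while ∂_x reads as d/dx. As V is not Hilbert–Schmidt,
⟦V⟧ is read as V − id = PV = G. Multiplication by ⟦V⟧ on the right then produces, besides the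
product of values, one more ζ-derivative of the left factor
(`BorderedRelations.kerLin_augMul_vKer`).

This defect explains the formula for b_{n-k}. In its recursion only the last term has the bare right
factor ⟦V⟧, so each b is minus some 𝓛 applied to G, minus one ζ-derivative of the preceding b.
Unrolling gives ∑ (-1)^i 𝓛_{k-i} ∂_ζ^{i-1}⟦G⟧, which is the Sato recursion for the ansatz
(`IsSatoSequence.reading_eq`).

For the evolution equation put γ_{k,j} = (-1)^j (P_{k,j} + P_{k,0} V P_{0,j}) at the end point, so
that w_j = -γ_{0,j-1}. The product identity yields the Riccati system γ_{k,j}' = γ_{k+1,j} + γ_{k,0}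
γ_{0,j} - γ_{k,j+1}. Equivalently, the pseudo-differential operators R_k = ∂^k + ∑ γ_{k,j} ∂^{-1-j}
satisfy ∂ R_k = R_{k+1} + γ_{k,0} R_0. Hence R_n + ∑ γ_{0,j-1} R_{n-j} = L R_0 with L a monic
differential operator of order n. The coefficients of nonnegative order in this identity are the
Sato recursion, so L has the coefficients b_{n-k}; the coefficient of ∂^{-1} gives b_{-1} as a
quadratic expression in γ (`sato_recursion_riccati`). That expression telescopes by parts
(`BorderedRelations.alternating_sum`) to minus the end-point value of (1 + PV)(P_{n,0} - (-1)^n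
P_{0,n})(1 + VP). Differentiating w_1 = -(P + PVP)(0,0) with the base equation gives the same.

The analytic part shows that continuous kernels are unique, that the monomials have them, and that
the operators are differentiable in norm in x and t_n. The border inherits this, because f(ζ) =
∫_{ζ-1}^{ζ} (f + (ξ-ζ+1) f') dξ expresses values at a point through L² operators
(`integral_weight_eq`). -/

namespace KP

/-! ### Formal pseudo-differential operators and the Riccati system -/

section SatoAlgebra

variable {A : Type*} [Ring A]

/-- The derivation `D` acting coefficientwise on bi-infinite sequences. -/
def coeffDeriv (D : A →+ A) : AddMonoid.End (ℤ → A) where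
  toFun f l := D (f l)
  map_zero' := by ext; simp
  map_add' f g := by ext; simp

/-- The shift of a bi-infinite sequence: multiplication by the formal symbol `∂`. -/
def seqShift : AddMonoid.End (ℤ → A) where
  toFun f l := f (l - 1)
  map_zero' := by ext; simp
  map_add' f g := by ext; simp

/-- Left composition with `∂` on formal pseudo-differential operators. -/
def leftDeriv (D : A →+ A) : AddMonoid.End (ℤ → A) := coeffDeriv D + seqShift

theorem addMonoidEnd_mul_apply {M : Type*} [AddCommMonoid M] (f g : AddMonoid.End M) (x : M) :
    (f * g) x = f (g x) := rfl

theorem addMonoidEnd_sum_apply {M ι : Type*} [AddCommMonoid M] (s : Finset ι)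
    (f : ι → AddMonoid.End M) (x : M) : (∑ i ∈ s, f i) x = ∑ i ∈ s, f i x := by
  classical
  induction s using Finset.induction_on with
  | empty => rfl
  | insert a s ha ih => rw [Finset.sum_insert ha, Finset.sum_insert ha, ← ih]; rfl

theorem coeffDeriv_pow_apply (D : A →+ A) (c : ℕ) (f : ℤ → A) (l : ℤ) :
    ((coeffDeriv D) ^ c) f l = D^[c] (f l) := by
  induction c generalizing f with
  | zero => rfl
  | succ c ih =>
    rw [pow_succ, addMonoidEnd_mul_apply, ih, Function.iterate_succ_apply]
    rfl

theorem seqShift_pow_apply (c : ℕ) (f : ℤ → A) (l : ℤ) :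
    ((seqShift (A := A)) ^ c) f l = f (l - c) := by
  induction c generalizing f with
  | zero => simp
  | succ c ih =>
    rw [pow_succ, addMonoidEnd_mul_apply, ih]
    change f (l - c - 1) = _
    congr 1
    push_cast
    ring

theorem leftDeriv_apply (D : A →+ A) (f : ℤ → A) (l : ℤ) :
    leftDeriv D f l = D (f l) + f (l - 1) := rfl

/-- Composition with ∂ is the sum of two commuting maps, the coefficientwise derivation and the
shift, so the binomial theorem applies. The bound `B` is free because the surplus binomial
coefficients vanish; this allows a common range for several powers. -/
theorem leftDeriv_pow_apply (D : A →+ A) (m B : ℕ) (hB : m ≤ B) (f : ℤ → A) (l : ℤ) :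
    ((leftDeriv D) ^ m) f l
      = ∑ c ∈ Finset.range (B + 1), m.choose c • D^[c] (f (l - m + c)) := by
  have hc : Commute (coeffDeriv D) (seqShift (A := A)) := by
    ext f l
    rfl
  have h1 : ((leftDeriv D) ^ m) f l
      = ∑ c ∈ Finset.range (m + 1), m.choose c • D^[c] (f (l - m + c)) := by
    rw [leftDeriv, hc.add_pow, addMonoidEnd_sum_apply, Finset.sum_apply]
    refine Finset.sum_congr rfl fun c hcm => ?_
    have hcm' : c ≤ m := Nat.lt_succ_iff.1 (Finset.mem_range.1 hcm)
    rw [← Nat.cast_comm, addMonoidEnd_mul_apply, addMonoidEnd_mul_apply,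
      AddMonoid.End.natCast_apply, Pi.smul_apply, coeffDeriv_pow_apply, seqShift_pow_apply]
    congr 3
    push_cast [hcm']
    ring
  rw [h1]
  refine Finset.sum_subset (Finset.range_mono (by omega)) fun c _ hc => ?_
  rw [Nat.choose_eq_zero_of_lt (by simpa using hc), zero_smul]

/-- The formal pseudo-differential operator `∂^k + ∑_{j ≥ 0} γ_{k,j} ∂^{-1-j}`. -/
def jetRow (γ : ℕ → ℕ → A) (k : ℕ) : ℤ → A := fun l =>
  if l = k then 1 else if l < 0 then γ k (-1 - l).toNat else 0

theorem jetRow_neg (γ : ℕ → ℕ → A) (k j : ℕ) : jetRow γ k (-1 - j) = γ k j := by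
  unfold jetRow
  rw [if_neg (by omega), if_pos (by omega)]
  congr 1
  omega

theorem jetRow_self (γ : ℕ → ℕ → A) (k : ℕ) : jetRow γ k k = 1 := by simp [jetRow]

theorem jetRow_nonneg (γ : ℕ → ℕ → A) (k : ℕ) (l : ℤ) (hl : 0 ≤ l) (h : l ≠ k) :
    jetRow γ k l = 0 := by
  unfold jetRow
  rw [if_neg h, if_neg (by omega)]

theorem derivation_one (D : A →+ A) (hD : ∀ a b, D (a * b) = D a * b + a * D b) : D 1 = 0 := by
  have := hD 1 1
  simpa using this

theorem leftDeriv_smul (D : A →+ A) (hD : ∀ a b, D (a * b) = D a * b + a * D b) (a : A)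
    (f : ℤ → A) : leftDeriv D (a • f) = D a • f + a • leftDeriv D f := by
  ext l
  simp only [leftDeriv_apply, Pi.smul_apply, Pi.add_apply, smul_eq_mul, hD, mul_add]
  abel

/-- The Riccati system in operator form. After composition with ∂ the coefficient of ∂^0 gains
γ_{k,0}, and this multiple of row 0 is exactly what separates the result from row k + 1. -/
theorem leftDeriv_jetRow (D : A →+ A) (hD : ∀ a b, D (a * b) = D a * b + a * D b)
    (γ : ℕ → ℕ → A)
    (hγ : ∀ k j, D (γ k j) = γ (k + 1) j + γ k 0 * γ 0 j - γ k (j + 1)) (k : ℕ) :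
    leftDeriv D (jetRow γ k) = jetRow γ (k + 1) + γ k 0 • jetRow γ 0 := by
  ext l
  simp only [leftDeriv_apply, Pi.add_apply, Pi.smul_apply, smul_eq_mul]
  rcases lt_trichotomy l 0 with hl | rfl | hl
  · obtain ⟨j, rfl⟩ : ∃ j : ℕ, l = -1 - j := ⟨(-1 - l).toNat, by omega⟩
    have h2 : (-1 - (j : ℤ) - 1) = -1 - ((j + 1 : ℕ) : ℤ) := by push_cast; ring
    rw [h2, jetRow_neg, jetRow_neg, jetRow_neg, jetRow_neg, hγ]
    abel
  · have h1 : D (jetRow γ k 0) = 0 := by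
      rcases Nat.eq_zero_or_pos k with rfl | hk
      · have := jetRow_self γ 0
        rw [Nat.cast_zero] at this
        rw [this, derivation_one D hD]
      · rw [jetRow_nonneg γ k 0 le_rfl (by omega), map_zero]
    have h2 : jetRow γ k (0 - 1) = γ k 0 := by
      have := jetRow_neg γ k 0
      simpa using this
    have h3 : jetRow γ 0 0 = 1 := by simpa using jetRow_self γ 0
    rw [h1, h2, h3, jetRow_nonneg γ (k + 1) 0 le_rfl (by push_cast; omega)]
    simp
  · rw [jetRow_nonneg γ 0 l hl.le (by push_cast; omega), mul_zero, add_zero]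
    by_cases h : l = k + 1
    · subst h
      have e : ((k : ℤ) + 1 - 1) = k := by ring
      have := jetRow_self γ (k + 1)
      push_cast at this
      rw [this, e, jetRow_self, jetRow_nonneg γ k _ hl.le (by omega), map_zero, zero_add]
    · rw [jetRow_nonneg γ (k + 1) l hl.le (by push_cast; omega),
        jetRow_nonneg γ k (l - 1) (by omega) (by omega), add_zero]
      by_cases h' : l = k
      · subst h'
        rw [jetRow_self, derivation_one D hD]
      · rw [jetRow_nonneg γ k l hl.le h', map_zero]

/-- The left span of the sequences `∂^i ∘ jetRow γ 0` with `i < k`. -/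
def lowerSpan (D : A →+ A) (γ : ℕ → ℕ → A) (k : ℕ) : Submodule A (ℤ → A) :=
  Submodule.span A ((fun i => ((leftDeriv D) ^ i) (jetRow γ 0)) '' Iio k)

theorem lowerSpan_mono (D : A →+ A) (γ : ℕ → ℕ → A) {k l : ℕ} (h : k ≤ l) :
    lowerSpan D γ k ≤ lowerSpan D γ l :=
  Submodule.span_mono (image_mono (Iio_subset_Iio h))

theorem leftDeriv_mem_lowerSpan (D : A →+ A) (hD : ∀ a b, D (a * b) = D a * b + a * D b)
    (γ : ℕ → ℕ → A) (k : ℕ) (f : ℤ → A) (hf : f ∈ lowerSpan D γ k) :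
    leftDeriv D f ∈ lowerSpan D γ (k + 1) := by
  induction hf using Submodule.span_induction with
  | mem x hx =>
    obtain ⟨i, hi, rfl⟩ := hx
    refine Submodule.subset_span ⟨i + 1, by simpa using hi, ?_⟩
    simp only [pow_succ', addMonoidEnd_mul_apply]
  | zero => simp
  | add x y _ _ hx hy => rw [map_add]; exact add_mem hx hy
  | smul a x hx hx' =>
    rw [leftDeriv_smul D hD]
    exact add_mem (Submodule.smul_mem _ _ (lowerSpan_mono D γ (Nat.le_succ k) hx))
      (Submodule.smul_mem _ _ hx')

/-- Composition with ∂ raises the span by one order, and the correction γ_{k,0} R_0 of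
`leftDeriv_jetRow` already lies in it. -/
theorem jetRow_sub_mem_lowerSpan (D : A →+ A) (hD : ∀ a b, D (a * b) = D a * b + a * D b)
    (γ : ℕ → ℕ → A)
    (hγ : ∀ k j, D (γ k j) = γ (k + 1) j + γ k 0 * γ 0 j - γ k (j + 1)) (k : ℕ) :
    jetRow γ k - ((leftDeriv D) ^ k) (jetRow γ 0) ∈ lowerSpan D γ k := by
  induction k with
  | zero => simp
  | succ k ih =>
    have h := leftDeriv_mem_lowerSpan D hD γ k _ ih
    rw [map_sub, leftDeriv_jetRow D hD γ hγ] at h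
    have h0 : jetRow γ 0 ∈ lowerSpan D γ (k + 1) :=
      Submodule.subset_span ⟨0, by simp, by simp⟩
    have := sub_mem h (Submodule.smul_mem _ (γ k 0) h0)
    convert this using 1
    rw [pow_succ', addMonoidEnd_mul_apply]
    abel

/-- All rows are left combinations of ∂^i R_0, and only the row of index n involves ∂^n R_0, with
coefficient 1. The multipliers γ_{0,j-1} make the part of nonnegative order agree with that of R_0
∂^n. -/
theorem exists_monic_dressing (D : A →+ A) (hD : ∀ a b, D (a * b) = D a * b + a * D b)
    (γ : ℕ → ℕ → A)
    (hγ : ∀ k j, D (γ k j) = γ (k + 1) j + γ k 0 * γ 0 j - γ k (j + 1)) (n : ℕ) :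
    ∃ β : ℕ → A, β 0 = 1 ∧
      jetRow γ n + ∑ j ∈ Finset.Icc 1 n, γ 0 (j - 1) • jetRow γ (n - j)
        = ∑ i ∈ Finset.range (n + 1), β i • ((leftDeriv D) ^ (n - i)) (jetRow γ 0) := by
  have hmem : jetRow γ n - ((leftDeriv D) ^ n) (jetRow γ 0)
      + ∑ j ∈ Finset.Icc 1 n, γ 0 (j - 1) • jetRow γ (n - j) ∈ lowerSpan D γ n := by
    refine add_mem (jetRow_sub_mem_lowerSpan D hD γ hγ n) (Submodule.sum_mem _ fun j hj => ?_)
    have hj' := Finset.mem_Icc.1 hj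
    refine Submodule.smul_mem _ _ ?_
    have h1 := lowerSpan_mono D γ (show n - j ≤ n by omega)
      (jetRow_sub_mem_lowerSpan D hD γ hγ (n - j))
    have h2 : ((leftDeriv D) ^ (n - j)) (jetRow γ 0) ∈ lowerSpan D γ n :=
      Submodule.subset_span ⟨n - j, by simp; omega, rfl⟩
    simpa using add_mem h1 h2
  have hset : Iio n = ((Finset.range n : Finset ℕ) : Set ℕ) := by ext; simp
  rw [lowerSpan, hset, Submodule.mem_span_image_finset_iff_exists_fun] at hmem
  obtain ⟨c', hc'⟩ := hmem
  obtain ⟨c, hcc⟩ : ∃ c : ℕ → A, ∀ i : Finset.range n, c' i = c i :=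
    ⟨fun i => if h : i ∈ Finset.range n then c' ⟨i, h⟩ else 0, fun i => by simp [i.2]⟩
  have hc : ∑ i ∈ Finset.range n, c i • ((leftDeriv D) ^ i) (jetRow γ 0)
      = jetRow γ n - ((leftDeriv D) ^ n) (jetRow γ 0)
        + ∑ j ∈ Finset.Icc 1 n, γ 0 (j - 1) • jetRow γ (n - j) := by
    rw [← Finset.sum_coe_sort]
    simpa only [hcc] using hc'
  -- The index of β counts the drop in order below n, so the span coefficients appear reversed.
  refine ⟨fun i => if i = 0 then 1 else c (n - i), by simp, ?_⟩
  rw [← Finset.sum_range_reflect, Finset.sum_range_succ]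
  have e : ∀ i ∈ Finset.range n,
      (if n + 1 - 1 - i = 0 then (1 : A) else c (n - (n + 1 - 1 - i)))
        • ((leftDeriv D) ^ (n - (n + 1 - 1 - i))) (jetRow γ 0)
      = c i • ((leftDeriv D) ^ i) (jetRow γ 0) := by
    intro i hi
    have hi' := Finset.mem_range.1 hi
    rw [if_neg (by omega), show n - (n + 1 - 1 - i) = i by omega]
  rw [Finset.sum_congr rfl e, hc, Nat.add_sub_cancel, Nat.sub_self, Nat.sub_zero]
  change _ = _ + (1 : A) • ((leftDeriv D) ^ n) (jetRow γ 0)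
  rw [one_smul]
  abel

theorem iterate_derivation_one (D : A →+ A) (hD : ∀ a b, D (a * b) = D a * b + a * D b) (c : ℕ) :
    D^[c] 1 = if c = 0 then 1 else 0 := by
  cases c with
  | zero => simp
  | succ c =>
    rw [Function.iterate_succ_apply, derivation_one D hD, if_neg (by omega)]
    exact iterate_map_zero D c

/-- The term 1 of R_0 contributes only to order n - i. By the Leibniz rule the term γ_{0,j-1} ∂^{-j}
reaches order n - k after exactly k - j - i derivatives. -/
theorem leftDeriv_pow_jetRow_coeff (D : A →+ A) (hD : ∀ a b, D (a * b) = D a * b + a * D b)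
    (γ : ℕ → ℕ → A) (n k i : ℕ) (hi : i ≤ n) :
    ((leftDeriv D) ^ (n - i)) (jetRow γ 0) ((n : ℤ) - k)
      = (if i = k then 1 else 0) + ∑ j ∈ Finset.Icc 1 k,
          if i ≤ k - j then (n - i).choose (k - j - i) • D^[k - j - i] (γ 0 (j - 1)) else 0 := by
  rw [leftDeriv_pow_apply D (n - i) (n + k) (by omega)]
  -- With more than k - i derivatives the required coefficient of R_0 has positive order, hence is
  -- zero.
  have hz : ∀ c : ℕ, k < c + i →
      (n - i).choose c • D^[c] (jetRow γ 0 ((n : ℤ) - k - (n - i : ℕ) + c)) = 0 := by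
    intro c hc
    rw [jetRow_nonneg γ 0 _ (by push_cast [hi]; omega) (by push_cast [hi]; omega),
      iterate_map_zero, smul_zero]
  by_cases hik : i ≤ k
  · obtain ⟨K, rfl⟩ := Nat.exists_eq_add_of_le hik
    rw [← Finset.sum_subset (s₁ := Finset.range (K + 1)) (Finset.range_mono (by omega))
      (fun c _ hc => hz c (by simp at hc; omega)), Finset.sum_range_succ, add_comm]
    congr 1
    · rw [show ((n : ℤ) - (i + K : ℕ) - (n - i : ℕ) + K) = ((0 : ℕ) : ℤ) by push_cast [hi]; ring,
        jetRow_self, iterate_derivation_one D hD]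
      by_cases hK : K = 0 <;> simp [hK]
    · rw [← Finset.sum_subset (s₁ := Finset.Icc 1 K) (Finset.Icc_subset_Icc le_rfl (by omega))
        (fun j hj hj' => if_neg (by
          simp only [Finset.mem_Icc] at hj hj'; omega)),
        ← Finset.sum_range_reflect]
      rw [Finset.range_eq_Ico, Finset.sum_Ico_eq_sum_range]
      rw [show Finset.Icc 1 K = Finset.Ico 1 (K + 1) by ext; simp, Finset.sum_Ico_eq_sum_range]
      refine Finset.sum_congr (by simp) fun j hj => ?_
      have hj' := Finset.mem_range.1 hj
      rw [if_pos (by omega), show i + K - (1 + j) - i = K - 1 - (0 + j) by omega,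
        show 1 + j - 1 = j by omega, ← jetRow_neg γ 0 j]
      congr 3
      omega
  · rw [Finset.sum_eq_zero fun c _ => hz c (by omega), if_neg (by omega), zero_add,
      Finset.sum_eq_zero fun j _ => if_neg (by omega)]

/-- If `γ` satisfies the Riccati system of the Sato Grassmannian, the Sato recursion with
`w_j = -γ_{0,j-1}` ends with minus the `∂^{-1}`-coefficient of the dressed operator. -/
theorem sato_recursion_riccati (D : A →+ A) (hD : ∀ a b, D (a * b) = D a * b + a * D b)
    (γ : ℕ → ℕ → A)
    (hγ : ∀ k j, D (γ k j) = γ (k + 1) j + γ k 0 * γ 0 j - γ k (j + 1)) (n : ℕ) (hn : 1 ≤ n)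
    (b : ℕ → A)
    (hb : ∀ k, 2 ≤ k → k ≤ n + 1 → b k = ∑ j ∈ Finset.Icc 1 (k - 1),
      ((∑ i ∈ Finset.Icc 2 (k - j), (n - i).choose (k - j - i) •
        (b i * D^[k - j - i] (-γ 0 (j - 1)))) + n.choose (k - j) • D^[k - j] (-γ 0 (j - 1)))) :
    b (n + 1) = -(γ n 0 - γ 0 n + ∑ j ∈ Finset.Icc 1 n, γ 0 (j - 1) * γ (n - j) 0) := by
  obtain ⟨β, hβ0, hβ⟩ := exists_monic_dressing D hD γ hγ n
  -- The coefficient of ∂^{n-k} in L R_0. The summand j = k is split off: there only i = 0 is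
  -- possible, and it equals γ_{0,k-1}. For k = n + 1 the operator L has no coefficient of its own.
  have key : ∀ k, 1 ≤ k → k ≤ n + 1 →
      (jetRow γ n + ∑ j ∈ Finset.Icc 1 n, γ 0 (j - 1) • jetRow γ (n - j)) ((n : ℤ) - k)
        = (if k ≤ n then β k else 0) + γ 0 (k - 1) + ∑ j ∈ Finset.Icc 1 (k - 1),
            ∑ i ∈ Finset.range (k - j + 1), (n - i).choose (k - j - i) •
              (β i * D^[k - j - i] (γ 0 (j - 1))) := by
    intro k hk hkn
    rw [hβ, Finset.sum_apply]
    have e : ∀ i ∈ Finset.range (n + 1),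
        (β i • ((leftDeriv D) ^ (n - i)) (jetRow γ 0)) ((n : ℤ) - k)
          = (if i = k then β i else 0) + ∑ j ∈ Finset.Icc 1 k, if i ≤ k - j then
            (n - i).choose (k - j - i) • (β i * D^[k - j - i] (γ 0 (j - 1))) else 0 := by
      intro i hi
      rw [Pi.smul_apply, leftDeriv_pow_jetRow_coeff D hD γ n k i
        (Nat.lt_succ_iff.1 (Finset.mem_range.1 hi)), smul_eq_mul, mul_add, Finset.mul_sum]
      congr 1
      · split_ifs <;> simp
      · refine Finset.sum_congr rfl fun j _ => ?_
        split_ifs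
        · rw [mul_smul_comm]
        · simp
    rw [Finset.sum_congr rfl e, Finset.sum_add_distrib, Finset.sum_comm, add_assoc]
    congr 1
    · rw [Finset.sum_ite_eq']
      simp
    · have e2 : ∀ j ∈ Finset.Icc 1 k, (∑ i ∈ Finset.range (n + 1), if i ≤ k - j then
            (n - i).choose (k - j - i) • (β i * D^[k - j - i] (γ 0 (j - 1))) else 0)
          = ∑ i ∈ Finset.range (k - j + 1),
            (n - i).choose (k - j - i) • (β i * D^[k - j - i] (γ 0 (j - 1))) := by
        intro j hj
        have hj' := Finset.mem_Icc.1 hj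
        rw [← Finset.sum_filter]
        refine Finset.sum_congr ?_ fun _ _ => rfl
        ext i
        simp only [Finset.mem_filter, Finset.mem_range]
        omega
      rw [Finset.sum_congr rfl e2]
      obtain ⟨k', rfl⟩ := Nat.exists_eq_add_of_le' hk
      rw [Finset.sum_Icc_succ_top (by omega), add_comm]
      simp [hβ0]
  -- On the other side, a given nonnegative order below n meets only the leading 1 of a single row.
  have low : ∀ k, 1 ≤ k → k ≤ n →
      (jetRow γ n + ∑ j ∈ Finset.Icc 1 n, γ 0 (j - 1) • jetRow γ (n - j)) ((n : ℤ) - k)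
        = γ 0 (k - 1) := by
    intro k hk hkn
    rw [Pi.add_apply, Finset.sum_apply, jetRow_nonneg γ n _ (by omega) (by omega), zero_add,
      Finset.sum_eq_single_of_mem k (by simp; omega)]
    · rw [Pi.smul_apply, ← Nat.cast_sub hkn, jetRow_self]
      simp
    · intro j hj hjk
      have hj' := Finset.mem_Icc.1 hj
      rw [Pi.smul_apply, jetRow_nonneg γ _ _ (by omega) (by omega), smul_zero]
  -- L has no ∂^{n-1} term, which is why the sum in 𝓛 starts at i = 2.
  have hβ1 : β 1 = 0 := by
    have h1 := key 1 le_rfl (by omega)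
    rw [low 1 le_rfl hn, if_pos hn] at h1
    simpa using h1
  have hL : ∀ k (f : A), ∑ i ∈ Finset.range (k + 1), (n - i).choose (k - i) • (β i * D^[k - i] f)
      = (∑ i ∈ Finset.Icc 2 k, (n - i).choose (k - i) • (β i * D^[k - i] f))
        + n.choose k • D^[k] f := by
    intro k f
    rw [Finset.sum_range_succ']
    simp only [Nat.sub_zero, hβ0, one_mul]
    congr 1
    rcases Nat.eq_zero_or_pos k with rfl | hk
    · simp
    · obtain ⟨k', rfl⟩ := Nat.exists_eq_add_of_le' hk
      rw [Finset.sum_range_succ']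
      simp only [zero_add, hβ1, zero_mul, smul_zero, add_zero]
      rw [show Finset.Icc 2 (k' + 1) = Finset.Ico 2 (k' + 2) by ext; simp; omega,
        Finset.sum_Ico_eq_sum_range]
      refine Finset.sum_congr (by simp) fun i _ => ?_
      rw [show 2 + i = i + 1 + 1 by ring]
  have itneg : ∀ (c : ℕ) (f : A), D^[c] (-f) = -D^[c] f := fun c f => iterate_map_neg D c f
  have hbβ : ∀ k, 2 ≤ k → k ≤ n → b k = β k := by
    intro k
    induction k using Nat.strong_induction_on with
    | _ k ih =>
    intro hk hkn
    have h1 := key k (by omega) (by omega)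
    rw [low k (by omega) hkn, if_pos hkn, add_right_comm, right_eq_add] at h1
    rw [hb k hk (by omega), eq_neg_of_add_eq_zero_left h1, ← Finset.sum_neg_distrib]
    refine Finset.sum_congr rfl fun j hj => ?_
    have hj' := Finset.mem_Icc.1 hj
    rw [hL, neg_add, ← Finset.sum_neg_distrib]
    simp only [itneg, mul_neg, smul_neg]
    congr 1
    refine Finset.sum_congr rfl fun i hi => ?_
    have hi' := Finset.mem_Icc.1 hi
    rw [ih i (by omega) (by omega) (by omega)]
  -- The coefficient of ∂^{-1}: it determines no further β, but evaluates the last Sato sum through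
  -- γ.
  have h1 := key (n + 1) (by omega) le_rfl
  rw [if_neg (by omega), zero_add, Pi.add_apply, Finset.sum_apply,
    show ((n : ℤ) - (n + 1 : ℕ)) = -1 - ((0 : ℕ) : ℤ) by push_cast; ring, jetRow_neg] at h1
  simp only [Pi.smul_apply, jetRow_neg, smul_eq_mul] at h1
  have h2 : b (n + 1) = -∑ j ∈ Finset.Icc 1 (n + 1 - 1),
            ∑ i ∈ Finset.range (n + 1 - j + 1), (n - i).choose (n + 1 - j - i) •
              (β i * D^[n + 1 - j - i] (γ 0 (j - 1))) := by
    rw [hb (n + 1) (by omega) le_rfl, ← Finset.sum_neg_distrib]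
    refine Finset.sum_congr rfl fun j hj => ?_
    have hj' := Finset.mem_Icc.1 hj
    rw [hL, neg_add, ← Finset.sum_neg_distrib]
    simp only [itneg, mul_neg, smul_neg]
    congr 1
    refine Finset.sum_congr rfl fun i hi => ?_
    have hi' := Finset.mem_Icc.1 hi
    rw [hbβ i (by omega) (by omega)]
  rw [h2, neg_inj, eq_comm, sub_add_eq_add_sub, h1]
  simp

end SatoAlgebra

/-! ### Derivations of free algebras and their evaluation at functions -/

section FreeDerivation

variable {ι : Type*} (d : ι → FreeAlgebra ℝ ι)

/-- The algebra morphism `a ↦ a + ε D a` into the dual numbers over the free algebra, with `D`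
prescribed on the generators. -/
def freeDualLift : FreeAlgebra ℝ ι →ₐ[ℝ] TrivSqZeroExt (FreeAlgebra ℝ ι) (FreeAlgebra ℝ ι) :=
  FreeAlgebra.lift ℝ fun i => TrivSqZeroExt.inl (FreeAlgebra.ι ℝ i) + TrivSqZeroExt.inr (d i)

theorem fst_freeDualLift (a : FreeAlgebra ℝ ι) : (freeDualLift d a).fst = a := by
  have h : (TrivSqZeroExt.fstHom ℝ (FreeAlgebra ℝ ι) (FreeAlgebra ℝ ι)).comp (freeDualLift d)
      = AlgHom.id ℝ _ := by
    ext i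
    simp [freeDualLift]
  exact DFunLike.congr_fun h a

/-- The derivation of a free algebra with prescribed values on the generators. -/
def freeDeriv : FreeAlgebra ℝ ι →+ FreeAlgebra ℝ ι where
  toFun a := (freeDualLift d a).snd
  map_zero' := by simp
  map_add' a b := by simp

theorem freeDeriv_mul (a b : FreeAlgebra ℝ ι) :
    freeDeriv d (a * b) = freeDeriv d a * b + a * freeDeriv d b := by
  change (freeDualLift d (a * b)).snd = _
  rw [map_mul, TrivSqZeroExt.snd_mul, fst_freeDualLift, fst_freeDualLift, add_comm]
  rfl

theorem freeDeriv_ι (i : ι) : freeDeriv d (FreeAlgebra.ι ℝ i) = d i := by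
  change (freeDualLift d _).snd = _
  simp [freeDualLift]

theorem freeDeriv_algebraMap (r : ℝ) : freeDeriv d (algebraMap ℝ _ r) = 0 := by
  change (freeDualLift d _).snd = _
  rw [AlgHom.commutes]
  rfl

/-- If the generators are evaluated at functions of `x` obeying the differential equations that
define the derivation, evaluation intertwines the derivation with `d/dx`. -/
theorem hasDerivAt_freeEval {B : Type*} [NormedRing B] [NormedAlgebra ℝ B] (g : ι → ℝ → B) (x : ℝ)
    (hg : ∀ i, HasDerivAt (g i) (FreeAlgebra.lift ℝ (fun i => g i x) (d i)) x)
    (a : FreeAlgebra ℝ ι) :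
    HasDerivAt (fun y => FreeAlgebra.lift ℝ (fun i => g i y) a)
      (FreeAlgebra.lift ℝ (fun i => g i x) (freeDeriv d a)) x := by
  induction a using FreeAlgebra.induction with
  | grade0 r =>
    simp only [AlgHom.commutes, freeDeriv_algebraMap, map_zero]
    exact hasDerivAt_const _ _
  | grade1 i =>
    simp only [FreeAlgebra.lift_ι_apply, freeDeriv_ι]
    exact hg i
  | mul a b ha hb =>
    simp only [freeDeriv_mul, map_mul, map_add]
    exact ha.mul hb
  | add a b ha hb =>
    simp only [map_add]
    exact ha.add hb

end FreeDerivation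

/-! ### The Sato recursion for functions obeying the Riccati system -/

section SatoFunctions

variable {B : Type*} [NormedRing B] [NormedAlgebra ℝ B]

theorem iteratedDeriv_eqOn_of_hasDerivAt {E : Type*} [NormedAddCommGroup E] [NormedSpace ℝ E]
    {Ω : Set ℝ} (hΩ : IsOpen Ω) (F : ℕ → ℝ → E)
    (hF : ∀ c, ∀ x ∈ Ω, HasDerivAt (F c) (F (c + 1) x) x) (f : ℝ → E) (hf : EqOn f (F 0) Ω)
    (c : ℕ) : EqOn (iteratedDeriv c f) (F c) Ω := by
  induction c with
  | zero => simpa using hf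
  | succ c ih =>
    intro x hx
    rw [iteratedDeriv_succ]
    have h : iteratedDeriv c f =ᶠ[𝓝 x] F c := ih.eventuallyEq_of_mem (hΩ.mem_nhds hx)
    rw [h.deriv_eq, (hF c x hx).deriv]

theorem satoL_congr (n : ℕ) {b b' : ℕ → ℝ → B} (k : ℕ) {f : ℝ → B} {x : ℝ}
    (h : ∀ i ∈ Finset.Icc 2 k, b i x = b' i x) : satoL n b k f x = satoL n b' k f x := by
  unfold satoL
  rw [Finset.sum_congr rfl fun i hi => by rw [h i hi]]

/-- If functions `γ_{k,j}` of `x` satisfy the Riccati system of the Sato Grassmannian, the last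
Sato coefficient for `w_j = -γ_{0,j-1}` is a quadratic expression in `γ`. -/
theorem satoCoeff_of_riccati {Ω : Set ℝ} (hΩ : IsOpen Ω) (g : ℕ → ℕ → ℝ → B)
    (hg : ∀ k j, ∀ x ∈ Ω,
      HasDerivAt (g k j) (g (k + 1) j x + g k 0 x * g 0 j x - g k (j + 1) x) x)
    (w : ℕ → ℝ → B) (hw : ∀ j, 1 ≤ j → EqOn (w j) (-g 0 (j - 1)) Ω) (n : ℕ) (hn : 1 ≤ n) (x : ℝ)
    (hx : x ∈ Ω) :
    satoCoeff n w (n + 1) x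
      = -(g n 0 x - g 0 n x + ∑ j ∈ Finset.Icc 1 n, g 0 (j - 1) x * g (n - j) 0 x) := by
  -- The given functions satisfy the system only on Ω and do not form a differential ring. The
  -- algebra is therefore done with free symbols γ_{k,j} whose derivation is prescribed by the
  -- Riccati system; evaluation on Ω turns this derivation into d/dx.
  let γ : ℕ → ℕ → FreeAlgebra ℝ (ℕ × ℕ) := fun k j => FreeAlgebra.ι ℝ (k, j)
  let d : ℕ × ℕ → FreeAlgebra ℝ (ℕ × ℕ) := fun q =>
    γ (q.1 + 1) q.2 + γ q.1 0 * γ 0 q.2 - γ q.1 (q.2 + 1)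
  let D := freeDeriv d
  let ev : ℝ → FreeAlgebra ℝ (ℕ × ℕ) →ₐ[ℝ] B := fun y =>
    FreeAlgebra.lift ℝ (fun q : ℕ × ℕ => g q.1 q.2 y)
  have evγ : ∀ k j y, ev y (γ k j) = g k j y := fun k j y => FreeAlgebra.lift_ι_apply _ _
  have hev : ∀ a, ∀ y ∈ Ω, HasDerivAt (fun y => ev y a) (ev y (D a)) y := by
    intro a y hy
    refine hasDerivAt_freeEval d (fun q : ℕ × ℕ => g q.1 q.2) y (fun q => ?_) a
    have : HasDerivAt (g q.1 q.2) (ev y (d q)) y := by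
      simp only [d, map_sub, map_add, map_mul, evγ]
      exact hg q.1 q.2 y hy
    exact this
  have hit : ∀ (a : FreeAlgebra ℝ (ℕ × ℕ)) (f : ℝ → B), EqOn f (fun y => ev y a) Ω → ∀ c,
      EqOn (iteratedDeriv c f) (fun y => ev y (D^[c] a)) Ω := by
    intro a f hf c
    refine iteratedDeriv_eqOn_of_hasDerivAt hΩ (fun c y => ev y (D^[c] a)) (fun c y hy => ?_) f
      hf c
    rw [Function.iterate_succ_apply']
    exact hev _ y hy
  let bA : ℕ → FreeAlgebra ℝ (ℕ × ℕ) := Nat.strongRec fun k b =>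
    ∑ j ∈ Finset.Icc 1 (k - 1),
      ((∑ i ∈ Finset.Icc 2 (k - j), (n - i).choose (k - j - i) •
        ((if h : i < k then b i h else 0) * D^[k - j - i] (-γ 0 (j - 1))))
          + n.choose (k - j) • D^[k - j] (-γ 0 (j - 1)))
  have hbA : ∀ k, bA k = ∑ j ∈ Finset.Icc 1 (k - 1),
      ((∑ i ∈ Finset.Icc 2 (k - j), (n - i).choose (k - j - i) •
        (bA i * D^[k - j - i] (-γ 0 (j - 1)))) + n.choose (k - j) • D^[k - j] (-γ 0 (j - 1))) := by
    intro k
    conv_lhs => simp only [bA]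
    rw [Nat.strongRec_eq]
    refine Finset.sum_congr rfl fun j hj => ?_
    congr 1
    refine Finset.sum_congr rfl fun i hi => ?_
    have hj' := Finset.mem_Icc.1 hj
    have hi' := Finset.mem_Icc.1 hi
    rw [dif_pos (by omega)]
  have hsato : ∀ k, satoCoeff n w k x = ev x (bA k) := by
    intro k
    induction k using Nat.strong_induction_on with
    | _ k ih =>
    rw [satoCoeff_eq, hbA, map_sum]
    refine Finset.sum_congr rfl fun j hj => ?_
    have hj' := Finset.mem_Icc.1 hj
    have hwj : EqOn (w j) (fun y => ev y (-γ 0 (j - 1))) Ω := by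
      intro y hy
      rw [hw j hj'.1 hy]
      simp only [map_neg, evγ, Pi.neg_apply]
    unfold satoL
    rw [map_add, map_sum, map_nsmul, hit _ _ hwj _ hx, Nat.cast_smul_eq_nsmul]
    congr 1
    refine Finset.sum_congr rfl fun i hi => ?_
    have hi' := Finset.mem_Icc.1 hi
    rw [map_nsmul, map_mul, hit _ _ hwj _ hx, Nat.cast_smul_eq_nsmul, ih i (by omega)]
  rw [hsato, sato_recursion_riccati D (freeDeriv_mul d) γ (fun k j => freeDeriv_ι d (k, j)) n hn bA
    (fun k _ _ => hbA k)]
  simp only [map_neg, map_add, map_sub, map_sum, map_mul, evγ]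

end SatoFunctions

/-! ### Reading the augmented algebra in bordered operators -/

section PoeppeAlgebra

theorem mono_apply_nil {l : List (ℕ × ℕ)} (hl : l ≠ []) : mono l [] = 0 := by
  simp [mono, hl]

theorem optMono_apply_nil {o : Option (List (ℕ × ℕ))} (h : ∀ l, o = some l → l ≠ []) :
    optMono o [] = 0 := by
  cases o with
  | none => rfl
  | some l => exact mono_apply_nil (h l rfl)

theorem consMap_apply_nil (c : ℕ × ℕ) (X : AP) :
    Finsupp.lmapDomain ℝ ℝ (List.cons c) X [] = 0 := by
  rw [Finsupp.lmapDomain_apply]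
  exact Finsupp.mapDomain_of_notMem_range _ _ (by simp)

theorem dxMono_apply_nil (l : List (ℕ × ℕ)) : dxMono l [] = 0 := by
  cases l with
  | nil => simp [dxMono, mono]
  | cons c l =>
    obtain ⟨a, b⟩ := c
    rw [dxMono, Finsupp.add_apply, consMap_apply_nil]
    simp [mono]

theorem incFirst_ne_nil {v l : List (ℕ × ℕ)} (h : incFirst v = some l) : l ≠ [] := by
  cases v with
  | nil => simp [incFirst] at h
  | cons c v => rw [← Option.some.inj h]; simp

theorem incLast_ne_nil {v l : List (ℕ × ℕ)} (h : incLast v = some l) : l ≠ [] := by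
  match v with
  | [] => simp [incLast] at h
  | [(a, b)] => rw [← Option.some.inj h]; simp
  | c :: d :: v =>
    rw [incLast, Option.map_eq_some_iff] at h
    obtain ⟨_, _, rfl⟩ := h
    simp

theorem monoMul_apply_nil (u v : List (ℕ × ℕ)) : monoMul u v [] = 0 := by
  rw [monoMul, Finsupp.add_apply, Finsupp.add_apply, Finsupp.add_apply, optMono_apply_nil,
    optMono_apply_nil, mono_apply_nil (by simp), mono_apply_nil (by simp)]
  · simp
  · intro l h
    obtain ⟨v', hv, rfl⟩ := Option.map_eq_some_iff.1 h
    simp [incFirst_ne_nil hv]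
  · intro l h
    obtain ⟨v', hv, rfl⟩ := Option.map_eq_some_iff.1 h
    simp [incLast_ne_nil hv]

theorem dx_apply_nil (X : AP) : dx X [] = 0 := by
  rw [dx, Finsupp.linearCombination_apply, Finsupp.sum_apply]
  exact Finset.sum_eq_zero fun l _ => by simp [dxMono_apply_nil]

theorem augMul_apply_nil (X Y : AP) : augMul X Y [] = 0 := by
  rw [augMul, Finsupp.linearCombination_apply, Finsupp.sum, LinearMap.sum_apply,
    Finsupp.finsetSum_apply]
  refine Finset.sum_eq_zero fun u _ => ?_
  rw [LinearMap.smul_apply, Finsupp.linearCombination_apply, Finsupp.smul_apply, Finsupp.sum_apply]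
  rw [Finsupp.sum, Finset.sum_eq_zero fun v _ => by simp [monoMul_apply_nil], smul_zero]

theorem dx_mono (l : List (ℕ × ℕ)) : dx (mono l) = dxMono l := by
  simp [dx, mono]

theorem augMul_mono (u v : List (ℕ × ℕ)) : augMul (mono u) (mono v) = monoMul u v := by
  simp [augMul, mono]

theorem consMap_mono (c : ℕ × ℕ) (l : List (ℕ × ℕ)) :
    Finsupp.lmapDomain ℝ ℝ (List.cons c) (mono l) = mono (c :: l) := by
  simp [mono, Finsupp.lmapDomain_apply]

/-- The product changes a nonempty left monomial at its last factor only, so earlier letters pass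
through. This drives the induction in `BorderedRelations.tailLin_monoMul`. -/
theorem monoMul_cons (c : ℕ × ℕ) {u : List (ℕ × ℕ)} (hu : u ≠ []) (v : List (ℕ × ℕ)) :
    monoMul (c :: u) v = Finsupp.lmapDomain ℝ ℝ (List.cons c) (monoMul u v) := by
  have h : ∀ o : Option (List (ℕ × ℕ)),
      Finsupp.lmapDomain ℝ ℝ (List.cons c) (optMono o) = optMono (o.map (List.cons c)) := by
    intro o
    cases o with
    | none => simp [optMono]
    | some l => exact consMap_mono c l
  obtain ⟨d, u, rfl⟩ := List.exists_cons_of_ne_nil hu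
  simp only [monoMul, map_add, consMap_mono, h, incLast, Option.map_map]
  rfl

/-- Two linear maps on `AP` that agree on the monomials `≠ ⟦V⟧` agree on elements without
`⟦V⟧`-component. -/
theorem linearMap_eq_of_mono {M : Type*} [AddCommGroup M] [Module ℝ M] (f g : AP →ₗ[ℝ] M)
    (h : ∀ l, l ≠ [] → f (mono l) = g (mono l)) {X : AP} (hX : X [] = 0) : f X = g X := by
  conv_lhs => rw [← Finsupp.sum_single X]
  conv_rhs => rw [← Finsupp.sum_single X]
  rw [Finsupp.sum, map_sum, map_sum]
  refine Finset.sum_congr rfl fun l hl => ?_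
  have hl' : l ≠ [] := by
    rintro rfl
    exact (Finsupp.mem_support_iff.1 hl) hX
  have e : Finsupp.single l (X l) = X l • mono l := by simp [mono]
  rw [e, map_smul, map_smul, h l hl']

variable {R : Type*} [Ring R]

/-- The relations between the (bordered) operators `P_{a,b}` and `V`: `E` is evaluation at the
end point, `Q` the complementary projection, and `parts` is integration by parts. -/
structure BorderedRelations (P : ℕ → ℕ → R) (W Q E : R) : Prop where
  parts : ∀ a b c d, P a (b + 1) * Q * P c d + P a b * Q * P (c + 1) d = P a b * E * P c d
  left : Q + Q * P 0 0 * W = W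
  right : Q + W * P 0 0 * Q = W

/-- The Pöppe product rule for single letters. Each of the four products through E in the expansion
is integrated by parts, and the resulting Q's are assembled to W by the resolvent identities. -/
theorem BorderedRelations.product {P : ℕ → ℕ → R} {W Q E : R}
    (h : BorderedRelations P W Q E) (a b c d : ℕ) :
    (P a b + P a b * W * P 0 0) * E * (P c d + P 0 0 * W * P c d)
      = P a (b + 1) * W * P c d + P a b * W * P (c + 1) d + P a b * W * P 0 1 * W * P c d
        + P a b * W * P 1 0 * W * P c d := by
  have e1 : (P a b + P a b * W * P 0 0) * E * (P c d + P 0 0 * W * P c d)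
      = P a b * E * P c d + P a b * W * (P 0 0 * E * P c d)
        + (P a b * E * P 0 0) * W * P c d + P a b * W * (P 0 0 * E * P 0 0) * W * P c d := by
    noncomm_ring
  rw [e1, ← h.parts a b c d, ← h.parts 0 0 c d, ← h.parts a b 0 0, ← h.parts 0 0 0 0]
  -- W is split as Q + QPW next to a right-differentiated factor and as Q + WPQ before a
  -- left-differentiated one; the pieces then match those of the integrations by parts.
  have hl : ∀ X Y, X * W * Y = X * Q * Y + X * Q * P 0 0 * W * Y := by
    intro X Y
    conv_lhs => rw [← h.left]
    noncomm_ring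
  have hr : ∀ X Y, X * W * Y = X * Q * Y + X * W * P 0 0 * Q * Y := by
    intro X Y
    conv_lhs => rw [← h.right]
    noncomm_ring
  have e2 := hl (P a (b + 1)) (P c d)
  have e3 := hr (P a b) (P (c + 1) d)
  have e4 := hl (P a b * W * P 0 1) (P c d)
  have e5 := hr (P a b) (P 1 0 * W * P c d)
  rw [show P a b * W * (P 1 0 * W * P c d) = P a b * W * P 1 0 * W * P c d by noncomm_ring] at e5
  rw [e2, e3, e4, e5]
  simp only [zero_add]
  noncomm_ring

variable [Algebra ℝ R]

/-- The inner part of the reading of a monomial in a ring with elements `P a b` and `W` that stand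
for `P_{a,b}` and `V`; the kernel is differentiated `j` times in its right variable. -/
def tailEv (P : ℕ → ℕ → R) (W : R) (j : ℕ) : List (ℕ × ℕ) → R
  | [] => P 0 j
  | (a, b) :: l => P a b * W * tailEv P W j l + if l = [] then P a (b + j) else 0

/-- The linear extension of `tailEv`. -/
noncomputable def tailLin (P : ℕ → ℕ → R) (W : R) (j : ℕ) : AP →ₗ[ℝ] R :=
  Finsupp.linearCombination ℝ (tailEv P W j)

/-- The reading of an element of the algebra, differentiated `j` times on the right, where
`⟦V⟧` is read as `V - id`. -/
noncomputable def kerLin (P : ℕ → ℕ → R) (W : R) (j : ℕ) : AP →ₗ[ℝ] R :=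
  (LinearMap.mulLeft ℝ (1 + P 0 0 * W)).comp (tailLin P W j)

variable (P : ℕ → ℕ → R) (W : R) (j : ℕ)

theorem kerLin_apply (X : AP) : kerLin P W j X = (1 + P 0 0 * W) * tailLin P W j X := rfl

theorem tailLin_mono (l : List (ℕ × ℕ)) : tailLin P W j (mono l) = tailEv P W j l := by
  simp [tailLin, mono]

theorem tailLin_consMap (a b : ℕ) {X : AP} (hX : X [] = 0) :
    tailLin P W j (Finsupp.lmapDomain ℝ ℝ (List.cons (a, b)) X) = P a b * W * tailLin P W j X := by
  refine linearMap_eq_of_mono ((tailLin P W j).comp (Finsupp.lmapDomain ℝ ℝ (List.cons (a, b))))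
    ((LinearMap.mulLeft ℝ (P a b * W)).comp (tailLin P W j)) (fun l hl => ?_) hX
  simp only [LinearMap.comp_apply, consMap_mono, tailLin_mono, LinearMap.mulLeft_apply]
  simp [tailEv, hl]

variable {P W} {Q E : R}

/-- Only the last factor of `u` and the first of `v` meet at the junction, so the claim reduces to a
one-letter `u`, where `BorderedRelations.product` applies. If `v` is empty, the terms left over are
those of `u` with one more right derivative. -/
theorem BorderedRelations.tailLin_monoMul (h : BorderedRelations P W Q E) (j : ℕ)
    (u v : List (ℕ × ℕ)) (hu : u ≠ []) :
    tailLin P W j (monoMul u v) = tailEv P W 0 u * E * ((1 + P 0 0 * W) * tailEv P W j v)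
      + if v = [] then tailEv P W (j + 1) u else 0 := by
  induction u with
  | nil => exact absurd rfl hu
  | cons c u ih =>
    obtain ⟨a, b⟩ := c
    by_cases hu' : u = []
    · subst hu'
      have hp := h.product a b
      cases v with
      | nil =>
        simp only [monoMul, incLast, incFirst, Option.map, optMono, map_add, tailLin_mono, List.append_nil, List.nil_append, List.cons_append, tailEv, if_true, add_zero,
          List.cons_ne_nil, if_false, zero_add]
        have := hp 0 j
        rw [show P a b * W * P 0 0 + P a b = P a b + P a b * W * P 0 0 from add_comm _ _,
          show (1 + P 0 0 * W) * P 0 j = P 0 j + P 0 0 * W * P 0 j by noncomm_ring, this,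
          show b + 1 + j = b + (j + 1) by ring, show 1 + j = j + 1 by ring]
        simp only [zero_add]
        noncomm_ring
      | cons c' l =>
        obtain ⟨c, d⟩ := c'
        simp only [monoMul, incLast, incFirst, Option.map, optMono, map_add, tailLin_mono,
          List.nil_append, List.cons_append, tailEv, if_true, add_zero,
          List.cons_ne_nil, if_false]
        rw [show P a b * W * P 0 0 + P a b = P a b + P a b * W * P 0 0 from add_comm _ _]
        have e : ∀ T : R, (P a b + P a b * W * P 0 0) * E
              * ((1 + P 0 0 * W) * (P c d * W * T + if l = [] then P c (d + j) else 0))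
            = ((P a b + P a b * W * P 0 0) * E * (P c d + P 0 0 * W * P c d)) * (W * T)
              + if l = [] then (P a b + P a b * W * P 0 0) * E
                * (P c (d + j) + P 0 0 * W * P c (d + j)) else 0 := by
          intro T
          split_ifs <;> noncomm_ring
        rw [e, hp, hp]
        split_ifs <;> noncomm_ring
    · rw [monoMul_cons _ hu', tailLin_consMap P W j a b (monoMul_apply_nil u v), ih hu']
      simp only [tailEv, hu', if_false, add_zero]
      split_ifs <;> noncomm_ring

theorem BorderedRelations.kerLin_augMul (h : BorderedRelations P W Q E) (j : ℕ) {X Y : AP}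
    (hX : X [] = 0) (hY : Y [] = 0) :
    kerLin P W j (augMul X Y) = kerLin P W 0 X * E * kerLin P W j Y := by
  have key : ∀ u, u ≠ [] → kerLin P W j (augMul (mono u) Y)
      = kerLin P W 0 (mono u) * E * kerLin P W j Y := by
    intro u hu
    refine linearMap_eq_of_mono ((kerLin P W j).comp (augMul (mono u)))
      ((LinearMap.mulLeft ℝ (kerLin P W 0 (mono u) * E)).comp (kerLin P W j)) (fun v hv => ?_) hY
    simp only [LinearMap.comp_apply, LinearMap.mulLeft_apply, kerLin_apply, augMul_mono,
      h.tailLin_monoMul j u v hu, hv, if_false, tailLin_mono]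
    noncomm_ring
  exact linearMap_eq_of_mono ((kerLin P W j).comp (augMul.flip Y))
    ((LinearMap.mulRight ℝ (E * kerLin P W j Y)).comp (kerLin P W 0))
    (fun u hu => by simpa [mul_assoc] using key u hu) hX |>.trans (by simp [mul_assoc])

/-- Reading ⟦V⟧ as V - id breaks multiplicativity: the missing identity leaves a right derivative of
`X`. In the recursion for the b's this defect creates the higher coefficients w_j. -/
theorem BorderedRelations.kerLin_augMul_vKer (h : BorderedRelations P W Q E) (j : ℕ) {X : AP}
    (hX : X [] = 0) :
    kerLin P W j (augMul X vKer)
      = kerLin P W 0 X * E * kerLin P W j vKer + kerLin P W (j + 1) X := by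
  refine (linearMap_eq_of_mono ((kerLin P W j).comp (augMul.flip vKer))
    ((LinearMap.mulRight ℝ (E * kerLin P W j vKer)).comp (kerLin P W 0) + kerLin P W (j + 1))
    (fun u hu => ?_) hX).trans (by simp [mul_assoc])
  simp only [LinearMap.comp_apply, LinearMap.flip_apply, LinearMap.add_apply,
    LinearMap.mulRight_apply, vKer, kerLin_apply, augMul_mono, h.tailLin_monoMul j u [] hu, if_true,
    tailLin_mono]
  noncomm_ring

/-- By parts, ∑ (-1)^i P_{0,i} E P_{n-1-i,0} telescopes to boundary products through Q, and the
outer factors 1 + PW and 1 + WP absorb Q into W. Read at the end point, this equates the quadratic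
expression of the Riccati computation with the variation of P + PWP. -/
theorem BorderedRelations.alternating_sum (h : BorderedRelations P W Q E) (n : ℕ) :
    (1 + P 0 0 * W) * (P n 0 - (-1 : ℝ) ^ n • P 0 n) * (1 + W * P 0 0)
      = (P n 0 + P n 0 * W * P 0 0) - (-1 : ℝ) ^ n • (P 0 n + P 0 0 * W * P 0 n)
        + ∑ i ∈ Finset.range n, (-1 : ℝ) ^ i • ((P 0 i + P 0 0 * W * P 0 i) * E
            * (P (n - 1 - i) 0 + P (n - 1 - i) 0 * W * P 0 0)) := by
  have hl : ∀ Z, (1 + P 0 0 * W) * (P 0 0 * Q * Z) = P 0 0 * W * Z := by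
    intro Z
    conv_rhs => rw [← h.right]
    noncomm_ring
  have hr : ∀ Z, Z * Q * P 0 0 * (1 + W * P 0 0) = Z * W * P 0 0 := by
    intro Z
    conv_rhs => rw [← h.left]
    noncomm_ring
  -- Each E-product is a sum of two neighbouring Q-products, and the alternating signs cancel the
  -- interior ones.
  have hsum : ∀ m, m ≤ n → ∑ i ∈ Finset.range m, (-1 : ℝ) ^ i • ((P 0 i) * E * (P (n - 1 - i) 0))
      = P 0 0 * Q * P n 0 - (-1 : ℝ) ^ m • (P 0 m * Q * P (n - m) 0) := by
    intro m hm
    induction m with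
    | zero => simp
    | succ m ih =>
      rw [Finset.sum_range_succ, ih (by omega), ← h.parts,
        show n - 1 - m + 1 = n - m by omega, show n - (m + 1) = n - 1 - m by omega, pow_succ]
      simp only [smul_add, mul_neg, mul_one, neg_smul]
      abel
  have e : ∑ i ∈ Finset.range n, (-1 : ℝ) ^ i • ((P 0 i + P 0 0 * W * P 0 i) * E
            * (P (n - 1 - i) 0 + P (n - 1 - i) 0 * W * P 0 0))
      = (1 + P 0 0 * W) * (∑ i ∈ Finset.range n, (-1 : ℝ) ^ i • ((P 0 i) * E * (P (n - 1 - i) 0)))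
        * (1 + W * P 0 0) := by
    rw [Finset.mul_sum, Finset.sum_mul]
    refine Finset.sum_congr rfl fun i _ => ?_
    rw [mul_smul_comm, smul_mul_assoc]
    congr 1
    noncomm_ring
  rw [e, hsum n le_rfl, Nat.sub_self]
  have e1 : (1 + P 0 0 * W) * (P 0 0 * Q * P n 0 - (-1 : ℝ) ^ n • (P 0 n * Q * P 0 0))
      * (1 + W * P 0 0) = P 0 0 * W * P n 0 * (1 + W * P 0 0)
        - (-1 : ℝ) ^ n • ((1 + P 0 0 * W) * (P 0 n * W * P 0 0)) := by
    rw [mul_sub, hl, sub_mul, mul_smul_comm, smul_mul_assoc, mul_assoc (1 + P 0 0 * W) _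
      (1 + W * P 0 0), hr]
  rw [e1, mul_sub, sub_mul, mul_smul_comm, smul_mul_assoc,
    show (1 + P 0 0 * W) * P n 0 * (1 + W * P 0 0)
      = P n 0 + P n 0 * W * P 0 0 + P 0 0 * W * P n 0 * (1 + W * P 0 0) by noncomm_ring,
    show (1 + P 0 0 * W) * P 0 n * (1 + W * P 0 0)
      = P 0 n + P 0 0 * W * P 0 n + (1 + P 0 0 * W) * (P 0 n * W * P 0 0) by noncomm_ring, smul_add]
  abel

end PoeppeAlgebra

/-! ### The derivative ∂_x under the reading -/

section PoeppeDerivative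

variable {R : Type*} [NormedRing R] [NormedAlgebra ℝ R] {P : ℕ → ℕ → ℝ → R} {W : ℝ → R} {x : ℝ}

/-- `dxMono` also differentiates the leading V, which `tailEv` omits; hence the subtracted term. It
is restored by the derivative (1 + PW)(P_{1,0} + P_{0,1})W of the prefactor 1 + PW. -/
theorem hasDerivAt_tailEv (hP : ∀ a b, HasDerivAt (P a b) (P (a + 1) b x + P a (b + 1) x) x)
    (hW : HasDerivAt W (W x * (P 1 0 x + P 0 1 x) * W x) x) (j : ℕ) (l : List (ℕ × ℕ)) :
    HasDerivAt (fun y => tailEv (fun a b => P a b y) (W y) j l)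
      (tailLin (fun a b => P a b x) (W x) j (dxMono l)
        - (P 1 0 x + P 0 1 x) * W x * tailEv (fun a b => P a b x) (W x) j l) x := by
  induction l with
  | nil =>
    simp only [tailEv, dxMono, map_add, tailLin_mono, if_true]
    refine (hP 0 j).congr_deriv ?_
    simp only [zero_add, show 1 + j = j + 1 from add_comm _ _]
    noncomm_ring
  | cons c l ih =>
    obtain ⟨a, b⟩ := c
    have h1 := (((hP a b).mul hW).mul ih).add (f := fun y => P a b y * W y * _)
      (g := fun y => if l = [] then P a (b + j) y else 0)
      (g' := if l = [] then P (a + 1) (b + j) x + P a (b + 1 + j) x else 0) (by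
        split_ifs
        · rw [show b + 1 + j = b + j + 1 by ring]
          exact hP a (b + j)
        · exact hasDerivAt_const _ _)
    refine h1.congr_deriv ?_
    simp only [dxMono, map_add, tailLin_mono, tailLin_consMap _ _ _ _ _ (dxMono_apply_nil l),
      tailEv, List.cons_ne_nil, if_false, Pi.mul_apply]
    split_ifs <;> noncomm_ring

theorem hasDerivAt_kerLin (hP : ∀ a b, HasDerivAt (P a b) (P (a + 1) b x + P a (b + 1) x) x)
    (hW : HasDerivAt W (W x * (P 1 0 x + P 0 1 x) * W x) x) (j : ℕ) (X : AP) :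
    HasDerivAt (fun y => kerLin (fun a b => P a b y) (W y) j X)
      (kerLin (fun a b => P a b x) (W x) j (dx X)) x := by
  have h : ∀ l, HasDerivAt (fun y => kerLin (fun a b => P a b y) (W y) j (mono l))
      (kerLin (fun a b => P a b x) (W x) j (dx (mono l))) x := by
    intro l
    simp only [kerLin_apply, tailLin_mono, dx_mono]
    refine ((((hP 0 0).mul hW).const_add 1).mul (hasDerivAt_tailEv hP hW j l)).congr_deriv ?_
    simp only [Pi.mul_apply, zero_add]
    noncomm_ring
  induction X using Finsupp.induction_linear with
  | zero => simpa using hasDerivAt_const x (0 : R)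
  | add X Y hX hY =>
    simp only [map_add]
    exact hX.add hY
  | single l c =>
    have e : Finsupp.single l c = c • mono l := by simp [mono]
    simp only [e, map_smul]
    exact (h l).const_smul c

end PoeppeDerivative

/-! ### Hilbert–Schmidt operators and uniqueness of continuous kernels -/

section KernelOperators

open ContinuousLinearMap (adjoint)

variable {m : ℕ}

theorem eLpNorm_two_sq {α E : Type*} [MeasurableSpace α] [NormedAddCommGroup E] (f : α → E)
    (μ : Measure α) : (eLpNorm f 2 μ) ^ 2 = ∫⁻ x, ‖f x‖ₑ ^ 2 ∂μ := by
  have := eLpNorm_nnreal_pow_eq_lintegral (f := f) (μ := μ) (p := 2) two_ne_zero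
  simpa only [NNReal.coe_ofNat, ENNReal.rpow_ofNat, ENNReal.coe_ofNat] using this

theorem eLpNorm_two_le_of_lintegral {α E : Type*} [MeasurableSpace α] [NormedAddCommGroup E]
    {f : α → E} {μ : Measure α} {C : ℝ≥0∞} (h : ∫⁻ x, ‖f x‖ₑ ^ 2 ∂μ ≤ C ^ 2) :
    eLpNorm f 2 μ ≤ C := by
  rw [← eLpNorm_two_sq] at h
  exact (ENNReal.pow_right_strictMono two_ne_zero).le_iff_le.1 h

theorem integrable_clm_apply {α E F : Type*} [MeasurableSpace α] [NormedAddCommGroup E]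
    [NormedSpace ℝ E] [NormedAddCommGroup F] [NormedSpace ℝ F] {μ : Measure α}
    {κ : α → E →L[ℝ] F} {f : α → E} (hκ : MemLp κ 2 μ) (hf : MemLp f 2 μ) :
    Integrable (fun x => κ x (f x)) μ :=
  memLp_one_iff_integrable.1
    (ContinuousLinearMap.memLp_of_bilin 1 (ContinuousLinearMap.id ℝ (E →L[ℝ] F)) hκ hf)

theorem enorm_integral_clm_apply_le {α E F : Type*} [MeasurableSpace α] [NormedAddCommGroup E]
    [NormedSpace ℝ E] [NormedAddCommGroup F] [NormedSpace ℝ F] {μ : Measure α}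
    {κ : α → E →L[ℝ] F} {f : α → E} (hκ : AEStronglyMeasurable κ μ)
    (hf : AEStronglyMeasurable f μ) :
    ‖∫ x, κ x (f x) ∂μ‖ₑ ≤ eLpNorm κ 2 μ * eLpNorm f 2 μ := by
  refine (enorm_integral_le_lintegral_enorm _).trans ?_
  rw [← eLpNorm_one_eq_lintegral_enorm]
  have := eLpNorm_le_eLpNorm_mul_eLpNorm_of_nnnorm (p := 2) (q := 2) (r := 1) hκ hf
    (fun A v => A v) 1 (.of_forall fun x => by
      rw [one_mul]
      exact ContinuousLinearMap.le_opNNNorm _ _)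
  simpa using this

theorem ae_memLp_section {α β E : Type*} [MeasurableSpace α] [MeasurableSpace β]
    [NormedAddCommGroup E] {μ : Measure α} {ν : Measure β} [SFinite μ] [SFinite ν]
    {k : α → β → E} (hk : MemLp (fun q : α × β => k q.1 q.2) 2 (μ.prod ν)) :
    ∀ᵐ z ∂μ, MemLp (k z) 2 ν := by
  have h1 := ((memLp_two_iff_integrable_sq_norm hk.1).1 hk).prod_right_ae
  filter_upwards [h1, hk.1.prodMk_left] with z hz hz'
  exact (memLp_two_iff_integrable_sq_norm hz').2 hz

variable {k k' : ℝ → ℝ → Mat m} {T T' : HSpace m →L[ℝ] HSpace m}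

theorem aestronglyMeasurable_kernel_apply
    (hk : MemLp (fun q : ℝ × ℝ => k q.1 q.2) 2 (halfLine.prod halfLine)) {f : ℝ → Vec m}
    (hf : AEStronglyMeasurable f halfLine) :
    AEStronglyMeasurable (fun q : ℝ × ℝ => k q.1 q.2 (f q.2)) (halfLine.prod halfLine) :=
  (ContinuousLinearMap.id ℝ (Mat m)).aestronglyMeasurable_comp₂ hk.1 hf.comp_snd

theorem eLpNorm_kernel_apply_le
    (hk : MemLp (fun q : ℝ × ℝ => k q.1 q.2) 2 (halfLine.prod halfLine)) {f : ℝ → Vec m}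
    (hf : MemLp f 2 halfLine) :
    eLpNorm (fun z => ∫ ζ, k z ζ (f ζ) ∂halfLine) 2 halfLine
      ≤ eLpNorm (fun q : ℝ × ℝ => k q.1 q.2) 2 (halfLine.prod halfLine)
        * eLpNorm f 2 halfLine := by
  refine eLpNorm_two_le_of_lintegral ?_
  rw [mul_pow, eLpNorm_two_sq (fun q : ℝ × ℝ => k q.1 q.2), lintegral_prod _ (hk.1.enorm.pow_const 2)]
  refine le_trans (lintegral_mono_ae ?_) (lintegral_mul_const' _ _ (ENNReal.pow_ne_top hf.2.ne)).le
  filter_upwards [hk.1.prodMk_left] with z hz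
  calc ‖∫ ζ, k z ζ (f ζ) ∂halfLine‖ₑ ^ 2
      ≤ (eLpNorm (k z) 2 halfLine * eLpNorm f 2 halfLine) ^ 2 := by
        gcongr
        exact enorm_integral_clm_apply_le hz hf.1
    _ = _ := by rw [mul_pow, eLpNorm_two_sq (k z)]

theorem memLp_kernel_apply
    (hk : MemLp (fun q : ℝ × ℝ => k q.1 q.2) 2 (halfLine.prod halfLine)) {f : ℝ → Vec m}
    (hf : MemLp f 2 halfLine) : MemLp (fun z => ∫ ζ, k z ζ (f ζ) ∂halfLine) 2 halfLine :=
  ⟨(aestronglyMeasurable_kernel_apply hk hf.1).integral_prod_right',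
    (eLpNorm_kernel_apply_le hk hf).trans_lt (ENNReal.mul_lt_top hk.2 hf.2)⟩

theorem ae_kernel_integrable
    (hk : MemLp (fun q : ℝ × ℝ => k q.1 q.2) 2 (halfLine.prod halfLine)) {f : ℝ → Vec m}
    (hf : MemLp f 2 halfLine) : ∀ᵐ z ∂halfLine, Integrable (fun ζ => k z ζ (f ζ)) halfLine := by
  filter_upwards [ae_memLp_section hk] with z hz using integrable_clm_apply hz hf

theorem norm_kernel_toLp_le
    (hk : MemLp (fun q : ℝ × ℝ => k q.1 q.2) 2 (halfLine.prod halfLine)) (φ : HSpace m) :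
    ‖(memLp_kernel_apply hk (Lp.memLp φ)).toLp‖
      ≤ (eLpNorm (fun q : ℝ × ℝ => k q.1 q.2) 2 (halfLine.prod halfLine)).toReal * ‖φ‖ := by
  rw [Lp.norm_toLp, Lp.norm_def, ← ENNReal.toReal_mul]
  exact ENNReal.toReal_mono (ENNReal.mul_lt_top hk.2 (Lp.memLp φ).2).ne
    (eLpNorm_kernel_apply_le hk (Lp.memLp φ))

/-- The Hilbert–Schmidt operator with a square-integrable kernel. -/
noncomputable def kernelOp
    (hk : MemLp (fun q : ℝ × ℝ => k q.1 q.2) 2 (halfLine.prod halfLine)) :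
    HSpace m →L[ℝ] HSpace m :=
  LinearMap.mkContinuous
    { toFun := fun φ => (memLp_kernel_apply hk (Lp.memLp φ)).toLp
      map_add' := fun φ ψ => by
        refine Lp.ext ?_
        filter_upwards [MemLp.coeFn_toLp (memLp_kernel_apply hk (Lp.memLp (φ + ψ))),
          MemLp.coeFn_toLp (memLp_kernel_apply hk (Lp.memLp φ)),
          MemLp.coeFn_toLp (memLp_kernel_apply hk (Lp.memLp ψ)),
          Lp.coeFn_add (memLp_kernel_apply hk (Lp.memLp φ)).toLp
            (memLp_kernel_apply hk (Lp.memLp ψ)).toLp,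
          ae_kernel_integrable hk (Lp.memLp φ), ae_kernel_integrable hk (Lp.memLp ψ)]
          with z h1 h2 h3 h4 h5 h6
        rw [h1, h4, Pi.add_apply, h2, h3, ← integral_add h5 h6]
        refine integral_congr_ae ?_
        filter_upwards [Lp.coeFn_add φ ψ] with ζ hζ
        rw [hζ, Pi.add_apply, map_add]
      map_smul' := fun c φ => by
        refine Lp.ext ?_
        filter_upwards [MemLp.coeFn_toLp (memLp_kernel_apply hk (Lp.memLp (c • φ))),
          MemLp.coeFn_toLp (memLp_kernel_apply hk (Lp.memLp φ)),
          Lp.coeFn_smul c (memLp_kernel_apply hk (Lp.memLp φ)).toLp] with z h1 h2 h3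
        rw [h1, RingHom.id_apply, h3, Pi.smul_apply, h2, ← integral_smul]
        refine integral_congr_ae ?_
        filter_upwards [Lp.coeFn_smul c φ] with ζ hζ
        rw [hζ, Pi.smul_apply, map_smul] }
    _ (norm_kernel_toLp_le hk)

theorem kernelOp_apply
    (hk : MemLp (fun q : ℝ × ℝ => k q.1 q.2) 2 (halfLine.prod halfLine)) (φ : HSpace m) :
    ∀ᵐ z ∂halfLine, kernelOp hk φ z = ∫ ζ, k z ζ (φ ζ) ∂halfLine :=
  MemLp.coeFn_toLp (memLp_kernel_apply hk (Lp.memLp φ))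

theorem isKernelOf_kernelOp (hc : ContinuousOn (fun q : ℝ × ℝ => k q.1 q.2) (Iic 0 ×ˢ Iic 0))
    (hk : MemLp (fun q : ℝ × ℝ => k q.1 q.2) 2 (halfLine.prod halfLine)) :
    IsKernelOf k (kernelOp hk) :=
  ⟨hc, hk, kernelOp_apply hk⟩

theorem IsKernelOf.congr (h : IsKernelOf k T) (hkk : k = k') (hT : T = T') : IsKernelOf k' T' := by
  rw [← hkk, ← hT]
  exact h

theorem IsKernelOf.op_unique (h : IsKernelOf k T) (h' : IsKernelOf k T') : T = T' := by
  ext1 φ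
  refine Lp.ext ?_
  filter_upwards [h.apply_eq φ, h'.apply_eq φ] with z h1 h2
  rw [h1, h2]

theorem IsKernelOf.opOf_eq (h : IsKernelOf k T) : opOf k = T := by
  have hex : ∃ T, IsKernelOf k T := ⟨T, h⟩
  rw [opOf, dif_pos hex]
  exact hex.choose_spec.op_unique h

theorem isKernelOf_opOf (hc : ContinuousOn (fun q : ℝ × ℝ => k q.1 q.2) (Iic 0 ×ˢ Iic 0))
    (hk : MemLp (fun q : ℝ × ℝ => k q.1 q.2) 2 (halfLine.prod halfLine)) :
    IsKernelOf k (opOf k) := by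
  rw [(isKernelOf_kernelOp hc hk).opOf_eq]
  exact isKernelOf_kernelOp hc hk

theorem IsKernelOf.norm_le (h : IsKernelOf k T) :
    ‖T‖ ≤ (eLpNorm (fun q : ℝ × ℝ => k q.1 q.2) 2 (halfLine.prod halfLine)).toReal := by
  rw [h.op_unique (isKernelOf_kernelOp h.continuousOn h.memLp)]
  exact LinearMap.mkContinuous_norm_le _ ENNReal.toReal_nonneg _

theorem IsKernelOf.add (h : IsKernelOf k T) (h' : IsKernelOf k' T') :
    IsKernelOf (fun z ζ => k z ζ + k' z ζ) (T + T') where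
  continuousOn := h.continuousOn.add h'.continuousOn
  memLp := MemLp.add (f := fun q : ℝ × ℝ => k q.1 q.2) (g := fun q : ℝ × ℝ => k' q.1 q.2)
    h.memLp h'.memLp
  apply_eq φ := by
    filter_upwards [h.apply_eq φ, h'.apply_eq φ, Lp.coeFn_add (T φ) (T' φ),
      ae_kernel_integrable h.memLp (Lp.memLp φ), ae_kernel_integrable h'.memLp (Lp.memLp φ)]
      with z h1 h2 h3 h4 h5
    rw [add_apply, h3, Pi.add_apply, h1, h2, ← integral_add h4 h5]
    rfl

theorem IsKernelOf.const_smul (h : IsKernelOf k T) (c : ℝ) :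
    IsKernelOf (fun z ζ => c • k z ζ) (c • T) where
  continuousOn := h.continuousOn.const_smul c
  memLp := h.memLp.const_smul c
  apply_eq φ := by
    filter_upwards [h.apply_eq φ, Lp.coeFn_smul c (T φ)] with z h1 h2
    rw [smul_apply, h2, Pi.smul_apply, h1, ← integral_smul]
    rfl

theorem IsKernelOf.sub (h : IsKernelOf k T) (h' : IsKernelOf k' T') :
    IsKernelOf (fun z ζ => k z ζ - k' z ζ) (T - T') := by
  refine (h.add (h'.const_smul (-1))).congr ?_ ?_
  · ext1 z
    ext1 ζ
    module
  · module

theorem ae_le_zero : ∀ᵐ z ∂halfLine, z ≤ 0 := ae_restrict_mem measurableSet_Iic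

/-- Testing on indicators of intervals times vectors shows that all integrals of the kernel over
intervals vanish; differentiating in the upper limit recovers the kernel. -/
theorem IsKernelOf.eq_zero (h : IsKernelOf k (0 : HSpace m →L[ℝ] HSpace m)) {z ζ : ℝ} (hz : z ≤ 0)
    (hζ : ζ ≤ 0) : k z ζ = 0 := by
  -- Clamping to the quadrant gives a globally continuous kernel with the same values there.
  let D : ℝ → ℝ → Mat m := fun z ζ => k (min z 0) (min ζ 0)
  have hD : Continuous (fun q : ℝ × ℝ => D q.1 q.2) := by
    have h1 : Continuous (fun q : ℝ × ℝ => ((min q.1 0, min q.2 0) : ℝ × ℝ)) := by fun_prop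
    exact h.continuousOn.comp_continuous h1 fun q =>
      ⟨min_le_right q.1 0, min_le_right q.2 0⟩
  have hDk : ∀ z ζ, z ≤ 0 → ζ ≤ 0 → D z ζ = k z ζ := fun z ζ hz hζ => by
    simp only [D, min_eq_left hz, min_eq_left hζ]
  rw [← hDk z ζ hz hζ]
  ext1 v
  rw [zero_apply]
  have hDv : Continuous (fun q : ℝ × ℝ => D q.1 q.2 v) := hD.clm_apply continuous_const
  have hint : ∀ α β, α ≤ β → β ≤ 0 → ∀ z ≤ 0, ∫ ζ in α..β, D z ζ v = 0 := by
    intro α β hαβ hβ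
    have hcont : Continuous fun z => ∫ ζ in α..β, D z ζ v :=
      intervalIntegral.continuous_parametric_intervalIntegral_of_continuous' (f := fun z ζ => D z ζ v) hDv α β
    have hae : (fun z => ∫ ζ in α..β, D z ζ v) =ᵐ[volume.restrict (Iic 0)] fun _ => 0 := by
      have hfin : halfLine (Ioc α β) ≠ ⊤ :=
        ((Measure.restrict_apply_le _ _).trans_lt (by simp)).ne
      have h1 := h.apply_eq (indicatorConstLp 2 measurableSet_Ioc hfin v)
      filter_upwards [h1, ae_le_zero,
        Lp.coeFn_zero (Vec m) 2 (halfLine)] with z hz hz0 hzz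
      rw [zero_apply, hzz, Pi.zero_apply] at hz
      rw [intervalIntegral.integral_of_le hαβ, hz, ← integral_indicator measurableSet_Ioc]
      rw [← integral_indicator measurableSet_Iic]
      refine integral_congr_ae ?_
      have h2 := (ae_restrict_iff' measurableSet_Iic).1
        (indicatorConstLp_coeFn (μ := halfLine) (p := 2) (hs := measurableSet_Ioc) (hμs := hfin)
          (c := v))
      filter_upwards [h2] with ζ hζ
      by_cases hm : ζ ∈ Ioc α β
      · have h0 : ζ ≤ 0 := hm.2.trans hβ
        rw [indicator_of_mem hm, indicator_of_mem (show ζ ∈ Iic 0 from h0), hζ h0,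
          indicator_of_mem hm, hDk z ζ hz0 h0]
      · rw [indicator_of_notMem hm]
        by_cases h0 : ζ ∈ Iic (0 : ℝ)
        · rw [indicator_of_mem h0, hζ h0, indicator_of_notMem hm, map_zero]
        · rw [indicator_of_notMem h0]
    have := Measure.eqOn_of_ae_eq hae hcont.continuousOn continuousOn_const (by
      rw [interior_Iic, closure_Iio])
    exact fun z hz => this hz
  have hcz : Continuous fun ζ => D z ζ v := hDv.comp (g := fun q : ℝ × ℝ => D q.1 q.2 v) (f := fun ζ => (z, ζ)) (by fun_prop)
  -- The two-sided derivative requires ζ < 0; the boundary ζ = 0 follows by continuity.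
  have hneg : EqOn (fun ζ => D z ζ v) (fun _ => 0) (Iio 0) := by
    intro ζ hζ
    have h1 : HasDerivAt (fun β => ∫ s in (ζ - 1)..β, D z s v) (D z ζ v) ζ :=
      intervalIntegral.integral_hasDerivAt_right (hcz.intervalIntegrable _ _)
        (hcz.stronglyMeasurableAtFilter _ _) hcz.continuousAt
    have h2 : (fun β => ∫ s in (ζ - 1)..β, D z s v) =ᶠ[𝓝 ζ] fun _ => 0 := by
      filter_upwards [Ioo_mem_nhds (show ζ - 1 < ζ by linarith) hζ] with β hβ
      exact hint _ _ hβ.1.le hβ.2.le z hz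
    exact h1.unique ((hasDerivAt_const ζ (0 : Vec m)).congr_of_eventuallyEq h2)
  have := hneg.of_subset_closure (t := Iic 0) hcz.continuousOn continuousOn_const Iio_subset_Iic_self
    (by rw [closure_Iio])
  exact this hζ

theorem IsKernelOf.kernel_unique (h : IsKernelOf k T) (h' : IsKernelOf k' T) {z ζ : ℝ} (hz : z ≤ 0)
    (hζ : ζ ≤ 0) : k z ζ = k' z ζ := by
  have h0 := h.sub h'
  rw [sub_self] at h0
  exact sub_eq_zero.1 (h0.eq_zero hz hζ)

theorem IsKernelOf.bracket_eq (h : IsKernelOf k T) {z ζ : ℝ} (hz : z ≤ 0) (hζ : ζ ≤ 0) :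
    bracket T z ζ = k z ζ := by
  have hex : ∃ k, IsKernelOf k T := ⟨k, h⟩
  rw [bracket, dif_pos hex]
  exact hex.choose_spec.kernel_unique h hz hζ

theorem memLp_norm_mul_prod {f g : ℝ → ℝ} (hf : MemLp f 2 halfLine) (hg : MemLp g 2 halfLine) :
    MemLp (fun q : ℝ × ℝ => f q.1 * g q.2) 2 (halfLine.prod halfLine) := by
  have hm : AEStronglyMeasurable (fun q : ℝ × ℝ => f q.1 * g q.2) (halfLine.prod halfLine) :=
    hf.1.comp_fst.mul hg.1.comp_snd
  rw [memLp_two_iff_integrable_sq hm]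
  have h1 := ((memLp_two_iff_integrable_sq hf.1).1 hf).mul_prod
    ((memLp_two_iff_integrable_sq hg.1).1 hg)
  simpa only [mul_pow] using h1

/-- Fubini for ⟨ψ(z), k(z,ζ) φ(ζ)⟩, which is integrable because ‖ψ(z)‖ ‖φ(ζ)‖ is square-integrable
on the quadrant. -/
theorem IsKernelOf.adjoint (h : IsKernelOf k T) :
    IsKernelOf (fun z ζ => ContinuousLinearMap.adjoint (k ζ z)) (ContinuousLinearMap.adjoint T) := by
  have hc : ContinuousOn (fun q : ℝ × ℝ => ContinuousLinearMap.adjoint (k q.2 q.1)) (Iic 0 ×ˢ Iic 0) := by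
    refine (ContinuousLinearMap.adjoint (𝕜 := ℝ) (E := Vec m) (F := Vec m)).continuous.comp_continuousOn
      (h.continuousOn.comp continuous_swap.continuousOn fun q hq => ⟨hq.2, hq.1⟩)
  have hl : MemLp (fun q : ℝ × ℝ => ContinuousLinearMap.adjoint (k q.2 q.1)) 2 (halfLine.prod halfLine) := by
    have h1 : MemLp (fun q : ℝ × ℝ => k q.2 q.1) 2 (halfLine.prod halfLine) :=
      h.memLp.comp_measurePreserving Measure.measurePreserving_swap
    refine h1.of_le ((ContinuousLinearMap.adjoint (𝕜 := ℝ) (E := Vec m)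
      (F := Vec m)).continuous.comp_aestronglyMeasurable h1.1) (.of_forall fun q => ?_)
    rw [LinearIsometryEquiv.norm_map]
  have hk := isKernelOf_kernelOp (k := fun z ζ => ContinuousLinearMap.adjoint (k ζ z)) hc hl
  refine hk.congr rfl ?_
  rw [ContinuousLinearMap.eq_adjoint_iff]
  intro ψ φ
  rw [L2.inner_def, L2.inner_def]
  have hint : Integrable (fun q : ℝ × ℝ => inner ℝ (ψ q.1) (k q.1 q.2 (φ q.2)))
      (halfLine.prod halfLine) := by
    have h1 := (h.memLp.norm.integrable_mul
      (memLp_norm_mul_prod (Lp.memLp ψ).norm (Lp.memLp φ).norm))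
    refine h1.mono' ((Lp.memLp ψ).1.comp_fst.inner
      (aestronglyMeasurable_kernel_apply h.memLp (Lp.memLp φ).1)) (.of_forall fun q => ?_)
    calc ‖inner ℝ (ψ q.1) (k q.1 q.2 (φ q.2))‖ ≤ ‖ψ q.1‖ * ‖k q.1 q.2 (φ q.2)‖ :=
          norm_inner_le_norm _ _
      _ ≤ ‖ψ q.1‖ * (‖k q.1 q.2‖ * ‖φ q.2‖) := by
          gcongr
          exact ContinuousLinearMap.le_opNorm _ _
      _ = ‖k q.1 q.2‖ * (‖ψ q.1‖ * ‖φ q.2‖) := by ring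
  have e1 : ∫ z, inner ℝ (kernelOp (k := fun z ζ => ContinuousLinearMap.adjoint (k ζ z)) hl ψ z) (φ z) ∂halfLine
      = ∫ z, ∫ ζ, inner ℝ (ψ ζ) (k ζ z (φ z)) ∂halfLine ∂halfLine := by
    refine integral_congr_ae ?_
    filter_upwards [kernelOp_apply (k := fun z ζ => ContinuousLinearMap.adjoint (k ζ z)) hl ψ, ae_kernel_integrable (k := fun z ζ => ContinuousLinearMap.adjoint (k ζ z)) hl (Lp.memLp ψ)] with z hz hi
    rw [hz, real_inner_comm, ← integral_inner hi]
    refine integral_congr_ae (.of_forall fun ζ => ?_)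
    simp only [ContinuousLinearMap.adjoint_inner_right]
    rw [real_inner_comm]
  have e2 : ∫ z, inner ℝ (ψ z) (T φ z) ∂halfLine
      = ∫ z, ∫ ζ, inner ℝ (ψ z) (k z ζ (φ ζ)) ∂halfLine ∂halfLine := by
    refine integral_congr_ae ?_
    filter_upwards [h.apply_eq φ, ae_kernel_integrable h.memLp (Lp.memLp φ)] with z hz hi
    rw [hz, ← integral_inner hi]
  rw [e1, e2]
  exact (integral_integral_swap hint).symm

/-- `A` is given by the continuous square-integrable family of functionals `r z`. -/
structure HasRows (A : HSpace m →L[ℝ] HSpace m) (r : ℝ → HSpace m →L[ℝ] Vec m) : Prop where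
  cont : ContinuousOn r (Iic 0)
  memLp : MemLp r 2 halfLine
  apply_eq : ∀ ψ : HSpace m, ∀ᵐ z ∂halfLine, A ψ z = r z ψ

/-- `B` is given by the continuous square-integrable family of columns `c ζ`. -/
structure HasCols (B : HSpace m →L[ℝ] HSpace m) (c : ℝ → Vec m →L[ℝ] HSpace m) : Prop where
  cont : ContinuousOn c (Iic 0)
  memLp : MemLp c 2 halfLine
  apply_eq : ∀ φ : HSpace m, B φ = ∫ ζ, c ζ (φ ζ) ∂halfLine

/-- Only the outer factors need rows and columns. Bounded operators between them, such as V, can be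
absorbed by `HasCols.comp_left` although they have no kernel. -/
theorem HasRows.isKernelOf_mul {A B : HSpace m →L[ℝ] HSpace m} {r : ℝ → HSpace m →L[ℝ] Vec m}
    {c : ℝ → Vec m →L[ℝ] HSpace m} (hA : HasRows A r) (hB : HasCols B c) :
    IsKernelOf (fun z ζ => (r z).comp (c ζ)) (A * B) := by
  have hc : ContinuousOn (fun q : ℝ × ℝ => (r q.1).comp (c q.2)) (Iic 0 ×ˢ Iic 0) :=
    (hA.cont.comp continuous_fst.continuousOn fun q hq => hq.1).clm_comp
      (hB.cont.comp continuous_snd.continuousOn fun q hq => hq.2)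
  refine ⟨hc, ?_, fun φ => ?_⟩
  · refine (memLp_norm_mul_prod hA.memLp.norm hB.memLp.norm).of_le ?_ (.of_forall fun q => ?_)
    · rw [Measure.prod_restrict]
      exact hc.aestronglyMeasurable (measurableSet_Iic.prod measurableSet_Iic)
    · rw [norm_mul, norm_norm, norm_norm]
      exact ContinuousLinearMap.opNorm_comp_le _ _
  · filter_upwards [hA.apply_eq (B φ)] with z hz
    rw [mul_apply_eq_comp, hz, hB.apply_eq,
      ← ContinuousLinearMap.integral_comp_comm _ (integrable_clm_apply hB.memLp (Lp.memLp φ))]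
    rfl

theorem HasCols.comp_left {B : HSpace m →L[ℝ] HSpace m} {c : ℝ → Vec m →L[ℝ] HSpace m}
    (hB : HasCols B c) (T : HSpace m →L[ℝ] HSpace m) :
    HasCols (T * B) (fun ζ => T.comp (c ζ)) where
  cont := continuousOn_const.clm_comp hB.cont
  memLp := hB.memLp.of_le_mul (c := ‖T‖)
    ((ContinuousLinearMap.compL ℝ (Vec m) (HSpace m) (HSpace m) T).continuous.comp_aestronglyMeasurable
      hB.memLp.1) (.of_forall fun ζ => ContinuousLinearMap.opNorm_comp_le _ _)
  apply_eq φ := by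
    rw [mul_apply_eq_comp, hB.apply_eq,
      ← ContinuousLinearMap.integral_comp_comm _ (integrable_clm_apply hB.memLp (Lp.memLp φ))]
    rfl

theorem HasCols.add {B B' : HSpace m →L[ℝ] HSpace m} {c c' : ℝ → Vec m →L[ℝ] HSpace m}
    (hB : HasCols B c) (hB' : HasCols B' c') : HasCols (B + B') (fun ζ => c ζ + c' ζ) where
  cont := hB.cont.add hB'.cont
  memLp := MemLp.add (f := c) (g := c') hB.memLp hB'.memLp
  apply_eq φ := by
    rw [add_apply, hB.apply_eq, hB'.apply_eq,
      ← integral_add (integrable_clm_apply hB.memLp (Lp.memLp φ))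
        (integrable_clm_apply hB'.memLp (Lp.memLp φ))]
    rfl

theorem HasRows.hasCols_adjoint {B : HSpace m →L[ℝ] HSpace m} {r : ℝ → HSpace m →L[ℝ] Vec m}
    (h : HasRows (adjoint B) r) : HasCols B (fun ζ => adjoint (r ζ)) := by
  have hm : MemLp (fun ζ => ContinuousLinearMap.adjoint (r ζ)) 2 halfLine :=
    h.memLp.of_le ((ContinuousLinearMap.adjoint (𝕜 := ℝ) (E := HSpace m)
      (F := Vec m)).continuous.comp_aestronglyMeasurable h.memLp.1) (.of_forall fun ζ => by
        rw [LinearIsometryEquiv.norm_map])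
  refine ⟨(ContinuousLinearMap.adjoint (𝕜 := ℝ) (E := HSpace m)
    (F := Vec m)).continuous.comp_continuousOn h.cont, hm, fun φ => ?_⟩
  refine ext_inner_left ℝ fun ψ => ?_
  rw [← integral_inner (integrable_clm_apply hm (Lp.memLp φ)),
    ← ContinuousLinearMap.adjoint_inner_left, L2.inner_def]
  refine integral_congr_ae ?_
  filter_upwards [h.apply_eq ψ] with ζ hζ
  rw [hζ, ContinuousLinearMap.adjoint_inner_right]

end KernelOperators

/-! ### A second-order Taylor estimate in L² -/

section TaylorEstimate

/-- Taylor's formula with integral remainder for each `q`, then Cauchy–Schwarz in the parameter and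
Tonelli. Thus L²-bounds on the second derivative suffice, without a dominating function. Before the
root, two powers of |v - u| come from the factor v - s, one from Cauchy–Schwarz and one from the
outer integral. -/
theorem eLpNorm_taylor_le {X E : Type*} [MeasurableSpace X] {μ : Measure X} [SFinite μ]
    [NormedAddCommGroup E] [NormedSpace ℝ E] [CompleteSpace E] {F F' F'' : ℝ → X → E} {u v : ℝ}
    {C : ℝ≥0∞} (hF : ∀ q, ∀ s ∈ uIcc u v, HasDerivAt (fun s => F s q) (F' s q) s)
    (hF' : ∀ q, ∀ s ∈ uIcc u v, HasDerivAt (fun s => F' s q) (F'' s q) s)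
    (hc : ∀ q, ContinuousOn (fun s => F'' s q) (uIcc u v))
    (hm : AEStronglyMeasurable (fun r : ℝ × X => F'' r.1 r.2) ((volume.restrict (uIcc u v)).prod μ))
    (hb : ∀ s ∈ uIcc u v, eLpNorm (F'' s) 2 μ ≤ C) :
    eLpNorm (fun q => F v q - F u q - (v - u) • F' u q) 2 μ ≤ ‖v - u‖ₑ ^ 2 * C := by
  have hvol : (volume.restrict (uIcc u v)) univ = ‖v - u‖ₑ := by
    rw [Measure.restrict_apply_univ, uIcc, Real.volume_Icc, max_sub_min_eq_abs,
      Real.enorm_eq_ofReal_abs]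
  have hpt : ∀ q, ‖F v q - F u q - (v - u) • F' u q‖ₑ ^ 2
      ≤ ‖v - u‖ₑ ^ 3 * ∫⁻ s in uIcc u v, ‖F'' s q‖ₑ ^ 2 := by
    intro q
    have hcm : AEStronglyMeasurable (fun s => F'' s q) (volume.restrict (uIcc u v)) :=
      (hc q).aestronglyMeasurable measurableSet_uIcc
    have hftc : ∫ s in u..v, (v - s) • F'' s q = F v q - F u q - (v - u) • F' u q := by
      have hd : ∀ s ∈ uIcc u v, HasDerivAt (fun s => F s q + (v - s) • F' s q)
          ((v - s) • F'' s q) s := by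
        intro s hs
        have h1 := (hF q s hs).add (((hasDerivAt_id s).const_sub v).smul (hF' q s hs))
        refine h1.congr_deriv ?_
        simp
      rw [intervalIntegral.integral_eq_sub_of_hasDerivAt hd]
      · simp
        abel
      · exact ((continuousOn_const.sub continuousOn_id).smul (hc q)).intervalIntegrable
    rw [← hftc]
    have h1 : ‖∫ s in u..v, (v - s) • F'' s q‖ₑ
        ≤ ‖v - u‖ₑ * ∫⁻ s in uIcc u v, ‖F'' s q‖ₑ := by
      rw [← ofReal_norm, intervalIntegral.norm_intervalIntegral_eq, ofReal_norm,
        ← lintegral_const_mul' _ _ (by simp)]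
      refine (enorm_integral_le_lintegral_enorm _).trans ?_
      refine (lintegral_mono_set uIoc_subset_uIcc).trans ?_
      refine setLIntegral_mono' measurableSet_uIcc fun s hs => ?_
      rw [enorm_smul]
      gcongr
      rw [Real.enorm_eq_ofReal_abs, Real.enorm_eq_ofReal_abs]
      refine ENNReal.ofReal_le_ofReal ?_
      exact abs_sub_right_of_mem_uIcc hs
    have h2 : (∫⁻ s in uIcc u v, ‖F'' s q‖ₑ) ^ 2
        ≤ ‖v - u‖ₑ * ∫⁻ s in uIcc u v, ‖F'' s q‖ₑ ^ 2 := by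
      have h3 := eLpNorm_le_eLpNorm_mul_eLpNorm_of_nnnorm (p := 2) (q := 2) (r := 1)
        (aestronglyMeasurable_const (b := (1 : ℝ))) hcm (fun c w => c • w) 1
        (.of_forall fun s => by simp)
      rw [← eLpNorm_one_eq_lintegral_enorm, ← eLpNorm_two_sq (fun s => F'' s q)]
      calc _ ≤ (eLpNorm (fun _ : ℝ => (1 : ℝ)) 2 (volume.restrict (uIcc u v))
            * eLpNorm (fun s => F'' s q) 2 (volume.restrict (uIcc u v))) ^ 2 := by
              gcongr
              simpa using h3
        _ = _ := by
              rw [mul_pow, eLpNorm_two_sq (fun _ : ℝ => (1 : ℝ))]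
              simp only [enorm_one, one_pow, lintegral_one, hvol]
    calc _ ≤ (‖v - u‖ₑ * ∫⁻ s in uIcc u v, ‖F'' s q‖ₑ) ^ 2 := by gcongr
      _ ≤ ‖v - u‖ₑ ^ 2 * (‖v - u‖ₑ * ∫⁻ s in uIcc u v, ‖F'' s q‖ₑ ^ 2) := by
          rw [mul_pow]
          gcongr
      _ = _ := by ring
  refine eLpNorm_two_le_of_lintegral ?_
  calc _ ≤ ∫⁻ q, (‖v - u‖ₑ ^ 3 * ∫⁻ s in uIcc u v, ‖F'' s q‖ₑ ^ 2) ∂μ := lintegral_mono hpt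
    _ = ‖v - u‖ₑ ^ 3 * ∫⁻ s in uIcc u v, (∫⁻ q, ‖F'' s q‖ₑ ^ 2 ∂μ) := by
        rw [lintegral_const_mul' _ _ (by simp), lintegral_lintegral_swap]
        exact (hm.enorm.pow_const 2).prod_swap
    _ ≤ ‖v - u‖ₑ ^ 3 * ∫⁻ s in uIcc u v, C ^ 2 := by
        refine mul_le_mul' le_rfl ?_
        refine setLIntegral_mono' measurableSet_uIcc fun s hs => ?_
        rw [← eLpNorm_two_sq]
        gcongr
        exact hb s hs
    _ = (‖v - u‖ₑ ^ 2 * C) ^ 2 := by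
        rw [lintegral_const, hvol]
        ring

theorem hasDerivWithinAt_of_quadratic {E : Type*} [NormedAddCommGroup E] [NormedSpace ℝ E]
    {f : ℝ → E} {f' : E} {s : Set ℝ} {u C : ℝ}
    (h : ∀ᶠ v in 𝓝[s] u, ‖f v - f u - (v - u) • f'‖ ≤ C * |v - u| ^ 2) :
    HasDerivWithinAt f f' s u := by
  rw [hasDerivWithinAt_iff_isLittleO]
  have h1 : (fun v => f v - f u - (v - u) • f') =O[𝓝[s] u] fun v => ‖v - u‖ ^ 2 :=
    Asymptotics.IsBigO.of_bound C (h.mono fun v hv => by simpa using hv)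
  exact h1.trans_isLittleO ((Asymptotics.isLittleO_pow_sub_sub u one_lt_two).mono nhdsWithin_le_nhds)

end TaylorEstimate

/-! ### Rows and columns of smooth kernels -/

section KernelFamilies

open ContinuousLinearMap (adjoint)

variable {m : ℕ}

/-- A kernel on `ℝ²` together with all its partial derivatives `k a b = ∂_z^a ∂_ζ^b (k 0 0)`, all
of them continuous and square-integrable on the quadrant. -/
structure KernelFamily (k : ℕ → ℕ → ℝ → ℝ → Mat m) : Prop where
  cont : ∀ a b, Continuous fun q : ℝ × ℝ => k a b q.1 q.2
  memLp : ∀ a b, MemLp (fun q : ℝ × ℝ => k a b q.1 q.2) 2 (halfLine.prod halfLine)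
  deriv_left : ∀ a b z ζ, HasDerivAt (fun z => k a b z ζ) (k (a + 1) b z ζ) z
  deriv_right : ∀ a b z ζ, HasDerivAt (fun ζ => k a b z ζ) (k a (b + 1) z ζ) ζ

/-- Transposition of matrices as a real linear map. -/
noncomputable def matAdjoint (m : ℕ) : Mat m →L[ℝ] Mat m :=
  LinearMap.mkContinuous
    { toFun := fun A => adjoint A
      map_add' := fun A B => map_add _ A B
      map_smul' := fun c A => by simp } 1 (fun A => by
        rw [one_mul]
        exact (LinearIsometryEquiv.norm_map (ContinuousLinearMap.adjoint (𝕜 := ℝ)) A).le)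

variable {k : ℕ → ℕ → ℝ → ℝ → Mat m}

theorem KernelFamily.isKernelOf (hk : KernelFamily k) (a b : ℕ) :
    IsKernelOf (k a b) (opOf (k a b)) :=
  isKernelOf_opOf (hk.cont a b).continuousOn (hk.memLp a b)

/-- The transposed family. -/
noncomputable def transposeFamily (k : ℕ → ℕ → ℝ → ℝ → Mat m) : ℕ → ℕ → ℝ → ℝ → Mat m :=
  fun a b z ζ => adjoint (k b a ζ z)

theorem KernelFamily.transpose (hk : KernelFamily k) : KernelFamily (transposeFamily k) where
  cont a b := (matAdjoint m).continuous.comp ((hk.cont b a).comp continuous_swap)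
  memLp a b := ((hk.isKernelOf b a).adjoint).memLp
  deriv_left a b z ζ := (matAdjoint m).hasFDerivAt.comp_hasDerivAt z (hk.deriv_right b a ζ z)
  deriv_right a b z ζ := (matAdjoint m).hasFDerivAt.comp_hasDerivAt ζ (hk.deriv_left b a ζ z)

theorem KernelFamily.opOf_transpose (hk : KernelFamily k) (a b : ℕ) :
    opOf (transposeFamily k a b) = adjoint (opOf (k b a)) :=
  (hk.isKernelOf b a).adjoint.opOf_eq

/-- Multiplication of a scalar `L²` function by a constant vector. -/
noncomputable def scalarMul (m : ℕ) (g : Lp ℝ 2 halfLine) : Vec m →L[ℝ] HSpace m :=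
  LinearMap.mkContinuous
    { toFun := fun v => (ContinuousLinearMap.toSpanSingleton ℝ v).compLp g
      map_add' := fun v w => by
        rw [ContinuousLinearMap.toSpanSingleton_add, ContinuousLinearMap.add_compLp]
      map_smul' := fun c v => by
        rw [ContinuousLinearMap.toSpanSingleton_smul, ContinuousLinearMap.smul_compLp]
        rfl } ‖g‖ (fun v => by
          refine (ContinuousLinearMap.norm_compLp_le _ _).trans ?_
          rw [ContinuousLinearMap.norm_toSpanSingleton, mul_comm])

theorem scalarMul_coeFn (g : Lp ℝ 2 halfLine) (v : Vec m) :
    scalarMul m g v =ᵐ[halfLine] fun ξ => g ξ • v :=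
  ContinuousLinearMap.coeFn_compLp _ _

theorem norm_scalarMul_le (g : Lp ℝ 2 halfLine) : ‖scalarMul m g‖ ≤ ‖g‖ :=
  LinearMap.mkContinuous_norm_le _ (norm_nonneg _) _

/-- The weights `1` and `ξ - ζ + 1` on `[ζ - 1, ζ]`. -/
noncomputable def weight (i : ℕ) (ζ : ℝ) : ℝ → ℝ :=
  indicator (Icc (ζ - 1) ζ) fun ξ => (ξ - ζ + 1) ^ i

theorem measurable_weight (i : ℕ) (ζ : ℝ) : Measurable (weight i ζ) :=
  Measurable.indicator (by fun_prop) measurableSet_Icc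

theorem eLpNorm_weight_le (i : ℕ) (ζ : ℝ) : eLpNorm (weight i ζ) 2 halfLine ≤ 1 := by
  refine eLpNorm_two_le_of_lintegral ?_
  calc ∫⁻ ξ, ‖weight i ζ ξ‖ₑ ^ 2 ∂halfLine
      ≤ ∫⁻ ξ, indicator (Icc (ζ - 1) ζ) 1 ξ ∂halfLine := by
        refine lintegral_mono fun ξ => ?_
        by_cases h : ξ ∈ Icc (ζ - 1) ζ
        · rw [weight, indicator_of_mem h, indicator_of_mem h, Pi.one_apply]
          refine pow_le_one₀ (by simp) ?_
          rw [Real.enorm_eq_ofReal_abs, ENNReal.ofReal_le_one, abs_pow]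
          refine pow_le_one₀ (abs_nonneg _) ?_
          rw [abs_le]
          constructor <;> linarith [h.1, h.2]
        · simp [weight, h]
    _ ≤ ∫⁻ ξ, indicator (Icc (ζ - 1) ζ) 1 ξ := lintegral_mono' Measure.restrict_le_self le_rfl
    _ ≤ 1 ^ 2 := by
        rw [lintegral_indicator_one measurableSet_Icc, Real.volume_Icc]
        simp

theorem memLp_weight (i : ℕ) (ζ : ℝ) : MemLp (weight i ζ) 2 halfLine :=
  ⟨(measurable_weight i ζ).aestronglyMeasurable, (eLpNorm_weight_le i ζ).trans_lt (by simp)⟩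

/-- `v ↦ (ξ - ζ + 1)^i 1_{[ζ-1,ζ]}(ξ) v`. -/
noncomputable def weightVec (m i : ℕ) (ζ : ℝ) : Vec m →L[ℝ] HSpace m :=
  scalarMul m (memLp_weight i ζ).toLp

theorem weightVec_coeFn (i : ℕ) (ζ : ℝ) (v : Vec m) :
    weightVec m i ζ v =ᵐ[halfLine] fun ξ => weight i ζ ξ • v := by
  filter_upwards [scalarMul_coeFn (memLp_weight i ζ).toLp v, (memLp_weight i ζ).coeFn_toLp]
    with ξ h1 h2
  rw [weightVec, h1, h2]

theorem norm_weightVec_le (i : ℕ) (ζ : ℝ) : ‖weightVec m i ζ‖ ≤ 1 := by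
  refine (norm_scalarMul_le _).trans ?_
  rw [Lp.norm_toLp]
  exact ENNReal.toReal_le_of_le_ofReal zero_le_one (by simpa using eLpNorm_weight_le i ζ)

/-- The integrand is the derivative of (ξ - ζ + 1) f(ξ), which vanishes at ζ - 1 and equals f(ζ) at
ζ. Point evaluation thereby becomes an L² pairing with f and f', so columns and rows are fixed
linear expressions in operators. -/
theorem integral_weight_eq {F : Type*} [NormedAddCommGroup F] [NormedSpace ℝ F]
    [CompleteSpace F] {f f' : ℝ → F} {ζ : ℝ} (hζ : ζ ≤ 0)
    (hf : ∀ ξ, HasDerivAt f (f' ξ) ξ) (hf' : Continuous f') :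
    ∫ ξ, (weight 0 ζ ξ • f ξ + weight 1 ζ ξ • f' ξ) ∂halfLine = f ζ := by
  have hfc : Continuous f := continuous_iff_continuousAt.2 fun ξ => (hf ξ).continuousAt
  have e : (fun ξ => weight 0 ζ ξ • f ξ + weight 1 ζ ξ • f' ξ)
      = indicator (Icc (ζ - 1) ζ) fun ξ => f ξ + (ξ - ζ + 1) • f' ξ := by
    ext1 ξ
    by_cases h : ξ ∈ Icc (ζ - 1) ζ <;> simp [weight, h]
  rw [e, integral_indicator measurableSet_Icc, Measure.restrict_restrict measurableSet_Icc,
    inter_eq_left.2 (show Icc (ζ - 1) ζ ⊆ Iic 0 from fun ξ hξ => hξ.2.trans hζ),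
    integral_Icc_eq_integral_Ioc, ← intervalIntegral.integral_of_le (by linarith),
    intervalIntegral.integral_eq_sub_of_hasDerivAt (f := fun ξ => (ξ - ζ + 1) • f ξ)]
  · simp
  · intro ξ _
    refine ((((hasDerivAt_id ξ).sub_const ζ).add_const 1).smul (hf ξ)).congr_deriv ?_
    simp [add_comm]
  · exact Continuous.intervalIntegrable (by fun_prop) _ _

/-- The column `v ↦ k_{a,b}(·,ζ) v`. -/
noncomputable def colOp (k : ℕ → ℕ → ℝ → ℝ → Mat m) (a b : ℕ) (ζ : ℝ) : Vec m →L[ℝ] HSpace m :=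
  (opOf (k a b)).comp (weightVec m 0 ζ) + (opOf (k a (b + 1))).comp (weightVec m 1 ζ)

/-- The row `ψ ↦ ∫ k_{a,b}(z,ξ) ψ(ξ) dξ`. -/
noncomputable def rowOp (k : ℕ → ℕ → ℝ → ℝ → Mat m) (a b : ℕ) (z : ℝ) : HSpace m →L[ℝ] Vec m :=
  (adjoint (weightVec m 0 z)).comp (opOf (k a b))
    + (adjoint (weightVec m 1 z)).comp (opOf (k (a + 1) b))

/-- Lets results about rows be deduced from those about columns of the transposed family. -/
theorem KernelFamily.adjoint_colOp_transpose (hk : KernelFamily k) (a b : ℕ) (z : ℝ) :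
    adjoint (colOp (transposeFamily k) b a z) = rowOp k a b z := by
  simp only [colOp, rowOp, map_add, ContinuousLinearMap.adjoint_comp, hk.opOf_transpose,
    ContinuousLinearMap.adjoint_adjoint]

theorem KernelFamily.colOp_coeFn (hk : KernelFamily k) (a b : ℕ) {ζ : ℝ} (hζ : ζ ≤ 0)
    (v : Vec m) : colOp k a b ζ v =ᵐ[halfLine] fun z => k a b z ζ v := by
  filter_upwards [(hk.isKernelOf a b).apply_eq (weightVec m 0 ζ v),
    (hk.isKernelOf a (b + 1)).apply_eq (weightVec m 1 ζ v),
    Lp.coeFn_add (opOf (k a b) (weightVec m 0 ζ v)) (opOf (k a (b + 1)) (weightVec m 1 ζ v)),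
    ae_kernel_integrable (hk.memLp a b) (Lp.memLp (weightVec m 0 ζ v)),
    ae_kernel_integrable (hk.memLp a (b + 1)) (Lp.memLp (weightVec m 1 ζ v))] with z h1 h2 h3 h4 h5
  change (opOf (k a b) (weightVec m 0 ζ v) + opOf (k a (b + 1)) (weightVec m 1 ζ v)) z = _
  rw [h3, Pi.add_apply, h1, h2, ← integral_add h4 h5, ← integral_weight_eq hζ
    (f := fun ξ => k a b z ξ v) (f' := fun ξ => k a (b + 1) z ξ v)
    (fun ξ => (ContinuousLinearMap.apply ℝ (Vec m) v).hasFDerivAt.comp_hasDerivAt ξ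
      (hk.deriv_right a b z ξ))
    (((hk.cont a (b + 1)).comp (Continuous.prodMk_right z)).clm_apply continuous_const)]
  refine integral_congr_ae ?_
  filter_upwards [weightVec_coeFn 0 ζ v, weightVec_coeFn 1 ζ v] with ξ e1 e2
  rw [e1, e2, map_smul, map_smul]

theorem KernelFamily.memLp_col (hk : KernelFamily k) (a b : ℕ) {ζ : ℝ} (hζ : ζ ≤ 0) (v : Vec m) :
    MemLp (fun z => k a b z ζ v) 2 halfLine :=
  (memLp_congr_ae (hk.colOp_coeFn a b hζ v)).1 (Lp.memLp _)

theorem norm_colOp_le (k : ℕ → ℕ → ℝ → ℝ → Mat m) (a b : ℕ) (ζ : ℝ) :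
    ‖colOp k a b ζ‖ ≤ ‖opOf (k a b)‖ + ‖opOf (k a (b + 1))‖ := by
  refine (norm_add_le _ _).trans (add_le_add ?_ ?_)
  · refine (ContinuousLinearMap.opNorm_comp_le _ _).trans ?_
    exact mul_le_of_le_one_right (norm_nonneg _) (norm_weightVec_le _ _)
  · refine (ContinuousLinearMap.opNorm_comp_le _ _).trans ?_
    exact mul_le_of_le_one_right (norm_nonneg _) (norm_weightVec_le _ _)

/-- The second ζ-derivative of a column is again a column. Its norm is bounded uniformly in ζ
because the weights have norm at most 1; this is where the two operators of right order b + 2 and b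
+ 3 come from. -/
theorem KernelFamily.norm_colOp_taylor_le (hk : KernelFamily k) (a b : ℕ) {ζ ζ' : ℝ}
    (hζ : ζ ≤ 0) (hζ' : ζ' ≤ 0) (v : Vec m) :
    ‖colOp k a b ζ' v - colOp k a b ζ v - (ζ' - ζ) • colOp k a (b + 1) ζ v‖
      ≤ (‖opOf (k a (b + 2))‖ + ‖opOf (k a (b + 3))‖) * ‖v‖ * |ζ' - ζ| ^ 2 := by
  set C := (‖opOf (k a (b + 2))‖ + ‖opOf (k a (b + 3))‖) * ‖v‖ with hC
  have hC0 : 0 ≤ C := by positivity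
  have hsub : ∀ s ∈ uIcc ζ ζ', s ≤ 0 := fun s hs => hs.2.trans (max_le hζ hζ')
  have hd : ∀ c q s, HasDerivAt (fun s => k a c q s v) (k a (c + 1) q s v) s := fun c q s =>
    (ContinuousLinearMap.apply ℝ (Vec m) v).hasFDerivAt.comp_hasDerivAt s (hk.deriv_right a c q s)
  have hcont : Continuous fun r : ℝ × ℝ => k a (b + 2) r.2 r.1 v :=
    ((hk.cont a (b + 2)).comp continuous_swap).clm_apply continuous_const
  have key := eLpNorm_taylor_le (μ := halfLine) (F := fun s q => k a b q s v)
    (F' := fun s q => k a (b + 1) q s v) (F'' := fun s q => k a (b + 2) q s v) (u := ζ) (v := ζ')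
    (C := ENNReal.ofReal C) (fun q s _ => hd b q s) (fun q s _ => hd (b + 1) q s)
    (fun q => (hcont.comp (Continuous.prodMk_left q)).continuousOn) hcont.aestronglyMeasurable
    (fun s hs => by
      rw [← eLpNorm_congr_ae (hk.colOp_coeFn a (b + 2) (hsub s hs) v), ← Lp.enorm_def,
        ← ofReal_norm]
      refine ENNReal.ofReal_le_ofReal ((ContinuousLinearMap.le_opNorm _ _).trans ?_)
      rw [hC]
      gcongr
      exact norm_colOp_le k a (b + 2) s)
  have hae : (colOp k a b ζ' v - colOp k a b ζ v - (ζ' - ζ) • colOp k a (b + 1) ζ v : HSpace m)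
      =ᵐ[halfLine] fun q => k a b q ζ' v - k a b q ζ v - (ζ' - ζ) • k a (b + 1) q ζ v := by
    filter_upwards [hk.colOp_coeFn a b hζ' v, hk.colOp_coeFn a b hζ v,
      hk.colOp_coeFn a (b + 1) hζ v, Lp.coeFn_sub (colOp k a b ζ' v - colOp k a b ζ v)
        ((ζ' - ζ) • colOp k a (b + 1) ζ v), Lp.coeFn_sub (colOp k a b ζ' v) (colOp k a b ζ v),
      Lp.coeFn_smul (ζ' - ζ) (colOp k a (b + 1) ζ v)] with q h1 h2 h3 h4 h5 h6
    rw [h4, Pi.sub_apply, h5, Pi.sub_apply, h6, Pi.smul_apply, h1, h2, h3]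
  rw [Lp.norm_def, eLpNorm_congr_ae hae]
  refine (ENNReal.toReal_mono ?_ key).trans_eq ?_
  · exact ENNReal.mul_ne_top (by simp) (by simp)
  · rw [ENNReal.toReal_mul, ENNReal.toReal_ofReal hC0, ENNReal.toReal_pow, toReal_enorm,
      Real.norm_eq_abs, mul_comm]

theorem KernelFamily.hasDerivWithinAt_colOp (hk : KernelFamily k) (a b : ℕ) {ζ : ℝ}
    (hζ : ζ ≤ 0) : HasDerivWithinAt (colOp k a b) (colOp k a (b + 1) ζ) (Iic 0) ζ := by
  refine hasDerivWithinAt_of_quadratic (C := ‖opOf (k a (b + 2))‖ + ‖opOf (k a (b + 3))‖) ?_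
  filter_upwards [self_mem_nhdsWithin] with ζ' hζ'
  refine ContinuousLinearMap.opNorm_le_bound _ (by positivity) fun v => ?_
  exact (hk.norm_colOp_taylor_le a b hζ hζ' v).trans_eq (by ring)

theorem KernelFamily.continuousOn_colOp (hk : KernelFamily k) (a b : ℕ) :
    ContinuousOn (colOp k a b) (Iic 0) :=
  fun _ hζ => (hk.hasDerivWithinAt_colOp a b hζ).continuousWithinAt

/-- The operator norm of a column is at most the L² norm in z of the kernel at that ζ, and Tonelli
sums these up. -/
theorem KernelFamily.memLp_colOp (hk : KernelFamily k) (a b : ℕ) :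
    MemLp (colOp k a b) 2 halfLine := by
  refine ⟨(hk.continuousOn_colOp a b).aestronglyMeasurable measurableSet_Iic,
    lt_of_le_of_lt (eLpNorm_two_le_of_lintegral
      (C := eLpNorm (fun q : ℝ × ℝ => k a b q.1 q.2) 2 (halfLine.prod halfLine)) ?_)
      (hk.memLp a b).2⟩
  rw [eLpNorm_two_sq, lintegral_prod_symm _ ((hk.memLp a b).1.enorm.pow_const 2)]
  refine lintegral_mono_ae ?_
  filter_upwards [ae_le_zero] with ζ hζ
  set N := eLpNorm (fun z => k a b z ζ) 2 halfLine with hN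
  have hle : ∀ v, ‖colOp k a b ζ v‖ₑ ≤ N * ‖v‖ₑ := by
    intro v
    rw [Lp.enorm_def, eLpNorm_congr_ae (hk.colOp_coeFn a b hζ v)]
    refine eLpNorm_two_le_of_lintegral ?_
    rw [mul_pow, hN, eLpNorm_two_sq, ← lintegral_mul_const' _ _ (by simp)]
    refine lintegral_mono fun z => ?_
    rw [← mul_pow]
    gcongr
    exact ContinuousLinearMap.le_opENorm _ _
  have hgoal : ‖colOp k a b ζ‖ₑ ≤ N := by
    -- The section at an individual ζ has not been shown to be square-integrable; where N is
    -- infinite the bound is trivial.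
    by_cases hNt : N = ⊤
    · rw [hNt]; exact le_top
    · rw [← ofReal_norm]
      refine ENNReal.ofReal_le_of_le_toReal (ContinuousLinearMap.opNorm_le_bound _
        ENNReal.toReal_nonneg fun v => ?_)
      have := ENNReal.toReal_mono (ENNReal.mul_ne_top hNt (by simp)) (hle v)
      simpa using this
  calc ‖colOp k a b ζ‖ₑ ^ 2 ≤ N ^ 2 := by gcongr
    _ = _ := by rw [hN, eLpNorm_two_sq]

theorem KernelFamily.inner_colOp (hk : KernelFamily k) (a b : ℕ) {ζ : ℝ} (hζ : ζ ≤ 0)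
    (ψ : HSpace m) (v : Vec m) :
    inner ℝ ψ (colOp k a b ζ v) = ∫ ξ, inner ℝ (ψ ξ) (k a b ξ ζ v) ∂halfLine := by
  rw [L2.inner_def]
  refine integral_congr_ae ?_
  filter_upwards [hk.colOp_coeFn a b hζ v] with ξ h
  rw [h]

theorem KernelFamily.hasRows_adjoint (hk : KernelFamily k) (a b : ℕ) :
    HasRows (adjoint (opOf (k a b))) (fun ζ => adjoint (colOp k a b ζ)) where
  cont := (ContinuousLinearMap.adjoint (𝕜 := ℝ)).continuous.comp_continuousOn
    (hk.continuousOn_colOp a b)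
  memLp := (hk.memLp_colOp a b).of_le ((ContinuousLinearMap.adjoint (𝕜 :=
    ℝ)).continuous.comp_aestronglyMeasurable (hk.memLp_colOp a b).1) (.of_forall fun ζ => by
      rw [LinearIsometryEquiv.norm_map])
  apply_eq ψ := by
    have hK := (hk.isKernelOf a b).adjoint
    filter_upwards [hK.apply_eq ψ, ae_le_zero, 
      ae_kernel_integrable (k := fun z ζ => ContinuousLinearMap.adjoint (k a b ζ z)) hK.memLp
        (Lp.memLp ψ)]
      with ζ h1 h2 h3
    refine ext_inner_left ℝ fun v => ?_
    rw [h1, ← integral_inner h3, ContinuousLinearMap.adjoint_inner_right, real_inner_comm,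
      hk.inner_colOp a b h2]
    refine integral_congr_ae (.of_forall fun ξ => ?_)
    simp only [ContinuousLinearMap.adjoint_inner_right]
    rw [real_inner_comm]

theorem KernelFamily.hasCols (hk : KernelFamily k) (a b : ℕ) :
    HasCols (opOf (k a b)) (colOp k a b) := by
  simpa only [ContinuousLinearMap.adjoint_adjoint] using (hk.hasRows_adjoint a b).hasCols_adjoint

theorem KernelFamily.hasRows (hk : KernelFamily k) (a b : ℕ) :
    HasRows (opOf (k a b)) (rowOp k a b) := by
  have h := hk.transpose.hasRows_adjoint b a
  simp only [hk.adjoint_colOp_transpose, hk.opOf_transpose,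
    ContinuousLinearMap.adjoint_adjoint] at h
  exact h

end KernelFamilies

/-! ### Integration by parts and the bordered operators -/

section Bordered

open ContinuousLinearMap (adjoint)

variable {m : ℕ} {k : ℕ → ℕ → ℝ → ℝ → Mat m}

theorem inner_weightVec (i : ℕ) (z : ℝ) (w : Vec m) (ψ : HSpace m) :
    inner ℝ (weightVec m i z w) ψ = ∫ ξ, weight i z ξ • inner ℝ w (ψ ξ) ∂halfLine := by
  rw [L2.inner_def]
  refine integral_congr_ae ?_
  filter_upwards [weightVec_coeFn i z w] with ξ h
  rw [h, real_inner_smul_left, smul_eq_mul]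

theorem KernelFamily.corner_eq (hk : KernelFamily k) (a b : ℕ) {z ζ : ℝ} (hz : z ≤ 0)
    (hζ : ζ ≤ 0) :
    (adjoint (weightVec m 0 z)).comp (colOp k a b ζ)
      + (adjoint (weightVec m 1 z)).comp (colOp k (a + 1) b ζ) = k a b z ζ := by
  ext1 v
  refine ext_inner_left ℝ fun w => ?_
  have hi : ∀ i (ψ : HSpace m), Integrable (fun ξ => weight i z ξ • inner ℝ w (ψ ξ)) halfLine := by
    intro i ψ
    have := L2.integrable_inner (𝕜 := ℝ) (weightVec m i z w) ψ
    refine this.congr ?_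
    filter_upwards [weightVec_coeFn i z w] with ξ h
    rw [h, real_inner_smul_left, smul_eq_mul]
  rw [add_apply, inner_add_right, ContinuousLinearMap.comp_apply, ContinuousLinearMap.comp_apply,
    ContinuousLinearMap.adjoint_inner_right, ContinuousLinearMap.adjoint_inner_right,
    inner_weightVec, inner_weightVec, ← integral_add (hi _ _) (hi _ _)]
  have hd : ∀ c ξ, HasDerivAt (fun ξ => inner ℝ w (k c b ξ ζ v))
      (inner ℝ w (k (c + 1) b ξ ζ v)) ξ := fun c ξ =>
    ((innerSL ℝ w).comp (ContinuousLinearMap.apply ℝ (Vec m) v)).hasFDerivAt.comp_hasDerivAt ξ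
      (hk.deriv_left c b ξ ζ)
  rw [← integral_weight_eq hz (hd a)
    (continuous_iff_continuousAt.2 fun ξ => (hd (a + 1) ξ).continuousAt)]
  refine integral_congr_ae ?_
  filter_upwards [hk.colOp_coeFn a b hζ v, hk.colOp_coeFn (a + 1) b hζ v] with ξ h1 h2
  rw [h1, h2]

theorem HasCols.memLp_clm_comp {B : HSpace m →L[ℝ] HSpace m} {c : ℝ → Vec m →L[ℝ] HSpace m}
    (hB : HasCols B c) (T : HSpace m →L[ℝ] Vec m) :
    MemLp (fun ζ => T.comp (c ζ)) 2 halfLine :=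
  hB.memLp.of_le_mul (c := ‖T‖)
    ((ContinuousLinearMap.compL ℝ (Vec m) (HSpace m) (Vec m) T).continuous.comp_aestronglyMeasurable
      hB.memLp.1) (.of_forall fun _ζ => ContinuousLinearMap.opNorm_comp_le _ _)

theorem KernelFamily.ae_corner_eq (hk : KernelFamily k) (a b : ℕ) {z : ℝ} (hz : z ≤ 0) :
    (fun ζ => (adjoint (weightVec m 0 z)).comp (colOp k a b ζ)
      + (adjoint (weightVec m 1 z)).comp (colOp k (a + 1) b ζ)) =ᵐ[halfLine] k a b z := by
  filter_upwards [ae_le_zero] with _ hζ using hk.corner_eq a b hz hζ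

theorem KernelFamily.memLp_row (hk : KernelFamily k) (a b : ℕ) {z : ℝ} (hz : z ≤ 0) :
    MemLp (k a b z) 2 halfLine :=
  (memLp_congr_ae (hk.ae_corner_eq a b hz)).1
    (MemLp.add (f := fun ζ => (adjoint (weightVec m 0 z)).comp (colOp k a b ζ))
      (g := fun ζ => (adjoint (weightVec m 1 z)).comp (colOp k (a + 1) b ζ))
      ((hk.hasCols a b).memLp_clm_comp _) ((hk.hasCols (a + 1) b).memLp_clm_comp _))

/-- Valid at every z ≤ 0, whereas the kernel of an operator gives it only almost everywhere; the
border needs z = 0. -/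
theorem KernelFamily.rowOp_apply (hk : KernelFamily k) (a b : ℕ) {z : ℝ} (hz : z ≤ 0)
    (φ : HSpace m) : rowOp k a b z φ = ∫ ζ, k a b z ζ (φ ζ) ∂halfLine := by
  rw [rowOp, add_apply, ContinuousLinearMap.comp_apply, ContinuousLinearMap.comp_apply,
    (hk.hasCols a b).apply_eq, (hk.hasCols (a + 1) b).apply_eq,
    ← ContinuousLinearMap.integral_comp_comm _
      (integrable_clm_apply (hk.hasCols a b).memLp (Lp.memLp φ)),
    ← ContinuousLinearMap.integral_comp_comm _
      (integrable_clm_apply (hk.hasCols (a + 1) b).memLp (Lp.memLp φ)), ← integral_add]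
  · refine integral_congr_ae ?_
    filter_upwards [hk.ae_corner_eq a b hz] with ζ h
    rw [← h]
    rfl
  · exact integrable_clm_apply (κ := fun ζ => (adjoint (weightVec m 0 z)).comp (colOp k a b ζ))
      ((hk.hasCols a b).memLp_clm_comp _) (Lp.memLp φ)
  · exact integrable_clm_apply (κ := fun ζ => (adjoint (weightVec m 1 z)).comp (colOp k (a + 1) b ζ))
      ((hk.hasCols (a + 1) b).memLp_clm_comp _) (Lp.memLp φ)

/-- Integration by parts, for columns. -/
theorem KernelFamily.parts_colOp (hk : KernelFamily k) (a b c d : ℕ) {ζ : ℝ} (hζ : ζ ≤ 0) :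
    (opOf (k a (b + 1))).comp (colOp k c d ζ) + (opOf (k a b)).comp (colOp k (c + 1) d ζ)
      = (colOp k a b 0).comp (k c d 0 ζ) := by
  ext1 v
  refine Lp.ext ?_
  have hcol : ∀ c, colOp k c d ζ v =ᵐ[halfLine] fun ξ => k c d ξ ζ v := fun c =>
    hk.colOp_coeFn c d hζ v
  have hint : ∀ b c, ∀ᵐ z ∂halfLine, Integrable (fun ξ => k a b z ξ (k c d ξ ζ v)) halfLine := by
    intro b c
    exact ae_kernel_integrable (hk.memLp a b) (hk.memLp_col c d hζ v)
  have happ : ∀ b c, ∀ᵐ z ∂halfLine, opOf (k a b) (colOp k c d ζ v) z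
      = ∫ ξ, k a b z ξ (k c d ξ ζ v) ∂halfLine := by
    intro b c
    filter_upwards [(hk.isKernelOf a b).apply_eq (colOp k c d ζ v)] with z h
    rw [h]
    refine integral_congr_ae ?_
    filter_upwards [hcol c] with ξ h
    rw [h]
  filter_upwards [happ (b + 1) c, happ b (c + 1), hint (b + 1) c, hint b (c + 1), hint b c,
    hk.colOp_coeFn a b le_rfl (k c d 0 ζ v),
    Lp.coeFn_add (opOf (k a (b + 1)) (colOp k c d ζ v)) (opOf (k a b) (colOp k (c + 1) d ζ v))]
    with z h1 h2 h3 h4 h5 h6 h7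
  change (opOf (k a (b + 1)) (colOp k c d ζ v) + opOf (k a b) (colOp k (c + 1) d ζ v)) z
    = colOp k a b 0 (k c d 0 ζ v) z
  rw [h7, h6, Pi.add_apply, h1, h2, ← integral_add h3 h4]
  have hd : ∀ ξ, HasDerivAt (fun ξ => k a b z ξ (k c d ξ ζ v))
      (k a (b + 1) z ξ (k c d ξ ζ v) + k a b z ξ (k (c + 1) d ξ ζ v)) ξ := fun ξ =>
    (hk.deriv_right a b z ξ).clm_apply
      ((ContinuousLinearMap.apply ℝ (Vec m) v).hasFDerivAt.comp_hasDerivAt ξ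
        (hk.deriv_left c d ξ ζ))
  -- There is no boundary term at -∞: the function and its derivative are both integrable there.
  have h0 := tendsto_zero_of_hasDerivAt_of_integrableOn_Iic (a := 0) (fun ξ _ => hd ξ)
    (h3.add h4) h5
  rw [integral_Iic_of_hasDerivAt_of_tendsto (hd 0).continuousAt.continuousWithinAt
    (fun ξ _ => hd ξ) (h3.add h4) h0, sub_zero]

/-- Integration by parts, for operators. -/
theorem KernelFamily.parts_opOf (hk : KernelFamily k) (a b c d : ℕ) :
    opOf (k a (b + 1)) * opOf (k c d) + opOf (k a b) * opOf (k (c + 1) d)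
      = (colOp k a b 0).comp (rowOp k c d 0) := by
  ext1 φ
  rw [((((hk.hasCols c d).comp_left (opOf (k a (b + 1)))).add
    ((hk.hasCols (c + 1) d).comp_left (opOf (k a b)))).apply_eq φ),
    ContinuousLinearMap.comp_apply, hk.rowOp_apply c d le_rfl,
    ← ContinuousLinearMap.integral_comp_comm _
      (integrable_clm_apply (hk.memLp_row c d le_rfl) (Lp.memLp φ))]
  refine integral_congr_ae ?_
  filter_upwards [ae_le_zero] with ζ hζ
  rw [hk.parts_colOp a b c d hζ]
  rfl

/-- Operators on `L²((-∞,0]; ℝᵐ) × ℝᵐ`; the second summand carries the values at the end point. -/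
abbrev Bord (m : ℕ) : Type := (HSpace m × Vec m) →L[ℝ] (HSpace m × Vec m)

/-- The operator `P_{a,b}` bordered by its row, its column and its kernel at the end point. -/
noncomputable def bordP (k : ℕ → ℕ → ℝ → ℝ → Mat m) (a b : ℕ) : Bord m :=
  ((opOf (k a b)).coprod (colOp k a b 0)).prod ((rowOp k a b 0).coprod (k a b 0 0))

/-- The operator `V` extended by zero. -/
noncomputable def bordV (V : HSpace m →L[ℝ] HSpace m) : Bord m :=
  (ContinuousLinearMap.inl ℝ (HSpace m) (Vec m)).comp
    (V.comp (ContinuousLinearMap.fst ℝ (HSpace m) (Vec m)))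

/-- The projection to the values at the end point. -/
noncomputable def bordE (m : ℕ) : Bord m :=
  (ContinuousLinearMap.inr ℝ (HSpace m) (Vec m)).comp
    (ContinuousLinearMap.snd ℝ (HSpace m) (Vec m))

theorem bordP_apply (a b : ℕ) (φ : HSpace m) (v : Vec m) :
    bordP k a b (φ, v) = (opOf (k a b) φ + colOp k a b 0 v, rowOp k a b 0 φ + k a b 0 0 v) := rfl

theorem bordV_apply (V : HSpace m →L[ℝ] HSpace m) (φ : HSpace m) (v : Vec m) :
    bordV V (φ, v) = (V φ, 0) := rfl

theorem bordE_apply (φ : HSpace m) (v : Vec m) : bordE m (φ, v) = (0, v) := rfl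

/-- The kernel at the end point. -/
noncomputable def corner (m : ℕ) : Bord m →L[ℝ] Mat m :=
  (ContinuousLinearMap.compL ℝ (Vec m) (HSpace m × Vec m) (Vec m)
      (ContinuousLinearMap.snd ℝ (HSpace m) (Vec m))).comp
    ((ContinuousLinearMap.compL ℝ (Vec m) (HSpace m × Vec m) (HSpace m × Vec m)).flip
      (ContinuousLinearMap.inr ℝ (HSpace m) (Vec m)))

theorem corner_apply (X : Bord m) (v : Vec m) : corner m X v = (X (0, v)).2 := rfl

theorem corner_mul_bordE_mul (X Y : Bord m) :
    corner m (X * bordE m * Y) = corner m X * corner m Y := rfl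

/-- Rows and kernel values at the end point are the same weighted combination of operators and
columns of left orders a and a + 1, so the identity follows from `KernelFamily.parts_opOf` at these
two orders. -/
theorem KernelFamily.parts_rowOp (hk : KernelFamily k) (a b c d : ℕ) (φ : HSpace m) :
    rowOp k a (b + 1) 0 (opOf (k c d) φ) + rowOp k a b 0 (opOf (k (c + 1) d) φ)
      = k a b 0 0 (rowOp k c d 0 φ) := by
  have h : ∀ a, opOf (k a (b + 1)) (opOf (k c d) φ) + opOf (k a b) (opOf (k (c + 1) d) φ)
      = colOp k a b 0 (rowOp k c d 0 φ) := fun a =>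
    DFunLike.congr_fun (hk.parts_opOf a b c d) φ
  rw [← hk.corner_eq a b le_rfl le_rfl]
  simp only [rowOp, add_apply, ContinuousLinearMap.comp_apply] at h ⊢
  rw [← h, ← h, map_add, map_add]
  abel

theorem KernelFamily.parts_corner (hk : KernelFamily k) (a b c d : ℕ) (v : Vec m) :
    rowOp k a (b + 1) 0 (colOp k c d 0 v) + rowOp k a b 0 (colOp k (c + 1) d 0 v)
      = k a b 0 0 (k c d 0 0 v) := by
  have h : ∀ a, opOf (k a (b + 1)) (colOp k c d 0 v) + opOf (k a b) (colOp k (c + 1) d 0 v)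
      = colOp k a b 0 (k c d 0 0 v) := fun a =>
    DFunLike.congr_fun (hk.parts_colOp a b c d le_rfl) v
  rw [← hk.corner_eq a b le_rfl le_rfl]
  simp only [rowOp, add_apply, ContinuousLinearMap.comp_apply] at h ⊢
  rw [← h, ← h, map_add, map_add]
  abel

theorem KernelFamily.borderedRelations (hk : KernelFamily k) {V : HSpace m →L[ℝ] HSpace m}
    (hl : 1 + opOf (k 0 0) * V = V) (hr : 1 + V * opOf (k 0 0) = V) :
    BorderedRelations (bordP k) (bordV V) (bordV 1) (bordE m) where
  parts a b c d := by
    refine ContinuousLinearMap.ext fun ⟨φ, v⟩ => ?_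
    have h1 : opOf (k a (b + 1)) (opOf (k c d) φ) + opOf (k a b) (opOf (k (c + 1) d) φ)
      = colOp k a b 0 (rowOp k c d 0 φ) := DFunLike.congr_fun (hk.parts_opOf a b c d) φ
    have h2 : opOf (k a (b + 1)) (colOp k c d 0 v) + opOf (k a b) (colOp k (c + 1) d 0 v)
      = colOp k a b 0 (k c d 0 0 v) := DFunLike.congr_fun (hk.parts_colOp a b c d le_rfl) v
    have h3 := hk.parts_rowOp a b c d φ
    have h4 := hk.parts_corner a b c d v
    simp only [add_apply, mul_apply_eq_comp, bordP_apply, bordV_apply, bordE_apply,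
      one_apply_eq_self, map_add, map_zero, add_zero, zero_add, Prod.mk_add_mk]
    rw [← h1, ← h2, ← h3, ← h4]
    ext1 <;> dsimp only <;> abel
  left := by
    refine ContinuousLinearMap.ext fun ⟨φ, v⟩ => ?_
    have h : φ + opOf (k 0 0) (V φ) = V φ := DFunLike.congr_fun hl φ
    simp only [add_apply, mul_apply_eq_comp, bordP_apply, bordV_apply,
      one_apply_eq_self, map_zero, add_zero, Prod.mk_add_mk, h]
  right := by
    refine ContinuousLinearMap.ext fun ⟨φ, v⟩ => ?_
    have h : φ + V (opOf (k 0 0) φ) = V φ := DFunLike.congr_fun hr φ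
    simp only [add_apply, mul_apply_eq_comp, bordP_apply, bordV_apply,
      one_apply_eq_self, map_zero, add_zero, Prod.mk_add_mk, h]

/-- The operators `(id, ⟨w₀,·⟩)` and `(0, ⟨w₁,·⟩)` for the weights `w_i` at the end point. -/
noncomputable def bordL (m i : ℕ) : HSpace m →L[ℝ] HSpace m × Vec m :=
  (if i = 0 then ContinuousLinearMap.id ℝ (HSpace m) else 0).prod (adjoint (weightVec m i 0))

/-- The transposes of `bordL`. -/
noncomputable def bordR (m j : ℕ) : HSpace m × Vec m →L[ℝ] HSpace m :=
  (if j = 0 then ContinuousLinearMap.id ℝ (HSpace m) else 0).coprod (weightVec m j 0)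

/-- A fixed linear expression in the operators `P_{a+i,b+j}`, `i, j ≤ 1`. -/
noncomputable def bordComb (f : ℕ → ℕ → HSpace m →L[ℝ] HSpace m) (a b : ℕ) : Bord m :=
  (bordL m 0).comp ((f a b).comp (bordR m 0)) + (bordL m 0).comp ((f a (b + 1)).comp (bordR m 1))
    + ((bordL m 1).comp ((f (a + 1) b).comp (bordR m 0))
      + (bordL m 1).comp ((f (a + 1) (b + 1)).comp (bordR m 1)))

/-- All four blocks are fixed bounded linear expressions in P_{a+i,b+j} with i, j ≤ 1. Norm
differentiability of the operators therefore passes to the bordered ones without a separate study of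
rows, columns and values. -/
theorem KernelFamily.bordP_eq (hk : KernelFamily k) (a b : ℕ) :
    bordP k a b = bordComb (fun a b => opOf (k a b)) a b := by
  refine ContinuousLinearMap.ext fun ⟨φ, v⟩ => ?_
  rw [bordP_apply, ← hk.corner_eq a b le_rfl le_rfl]
  simp only [bordComb, bordL, bordR, if_true, one_ne_zero, if_false,
    add_apply, ContinuousLinearMap.comp_apply, ContinuousLinearMap.coprod_apply,
    ContinuousLinearMap.prod_apply, ContinuousLinearMap.id_apply, zero_apply, Prod.mk_add_mk,
    rowOp, colOp, map_add]
  ext1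
  · simp only [map_zero, add_zero, zero_add]
    abel
  · simp only [map_zero, zero_add]
    abel

theorem hasDerivAt_bordP {f : ℝ → ℕ → ℕ → ℝ → ℝ → Mat m} {x : ℝ}
    (hf : ∀ᶠ y in 𝓝 x, KernelFamily (f y)) {f' : ℕ → ℕ → HSpace m →L[ℝ] HSpace m}
    (h : ∀ a b, HasDerivAt (fun y => opOf (f y a b)) (f' a b) x) (a b : ℕ) :
    HasDerivAt (fun y => bordP (f y) a b) (bordComb f' a b) x := by
  have e : (fun y => bordP (f y) a b) =ᶠ[𝓝 x] fun y => bordComb (fun a b => opOf (f y a b)) a b :=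
    hf.mono fun y hy => hy.bordP_eq a b
  refine HasDerivAt.congr_of_eventuallyEq ?_ e
  have key : ∀ (i j : ℕ) {g : ℝ → HSpace m →L[ℝ] HSpace m} {g' : HSpace m →L[ℝ] HSpace m},
      HasDerivAt g g' x → HasDerivAt (fun y => (bordL m i).comp ((g y).comp (bordR m j)))
        ((bordL m i).comp (g'.comp (bordR m j))) x := by
    intro i j g g' hg
    refine ((hasDerivAt_const x (bordL m i)).clm_comp (hg.clm_comp
      (hasDerivAt_const x (bordR m j)))).congr_deriv ?_
    simp only [ContinuousLinearMap.zero_comp, ContinuousLinearMap.comp_zero, zero_add, add_zero]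
  exact ((key 0 0 (h _ _)).add (key 0 1 (h _ _))).add ((key 1 0 (h _ _)).add (key 1 1 (h _ _)))

theorem hasDerivAt_bordV {V : ℝ → HSpace m →L[ℝ] HSpace m} {V' : HSpace m →L[ℝ] HSpace m} {x : ℝ}
    (h : HasDerivAt V V' x) : HasDerivAt (fun y => bordV (V y)) (bordV V') x := by
  refine ((hasDerivAt_const x (ContinuousLinearMap.inl ℝ (HSpace m) (Vec m))).clm_comp (h.clm_comp
    (hasDerivAt_const x (ContinuousLinearMap.fst ℝ (HSpace m) (Vec m))))).congr_deriv ?_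
  simp [bordV]

end Bordered

/-! ### Commuting directional derivatives -/

section DirectionalDerivatives

variable {X E : Type*} [NormedAddCommGroup X] [NormedSpace ℝ X] [NormedAddCommGroup E]
  [NormedSpace ℝ E] {U : Set X} {f g : X → E}

/-- The derivative in the direction `v`. -/
noncomputable def dirDeriv (v : X) (f : X → E) : X → E := fun q => fderiv ℝ f q v

theorem contDiffOn_dirDeriv (hU : IsOpen U) (hf : ContDiffOn ℝ ∞ f U) (v : X) :
    ContDiffOn ℝ ∞ (dirDeriv v f) U :=
  (hf.fderiv_of_isOpen hU (by simp)).clm_apply contDiffOn_const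

theorem dirDeriv_congr (hU : IsOpen U) (h : EqOn f g U) (v : X) :
    EqOn (dirDeriv v f) (dirDeriv v g) U := fun q hq => by
  rw [dirDeriv, dirDeriv, (h.eventuallyEq_of_mem (hU.mem_nhds hq)).fderiv_eq]

theorem hasFDerivAt_of_contDiffOn (hU : IsOpen U) (hf : ContDiffOn ℝ ∞ f U) {q : X} (hq : q ∈ U) :
    HasFDerivAt f (fderiv ℝ f q) q :=
  ((hf.contDiffAt (hU.mem_nhds hq)).differentiableAt (by simp)).hasFDerivAt

theorem dirDeriv_comm (hU : IsOpen U) (hf : ContDiffOn ℝ ∞ f U) (v w : X) :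
    EqOn (dirDeriv v (dirDeriv w f)) (dirDeriv w (dirDeriv v f)) U := by
  intro q hq
  have h2 : HasFDerivAt (fderiv ℝ f) (fderiv ℝ (fderiv ℝ f) q) q :=
    hasFDerivAt_of_contDiffOn hU (hf.fderiv_of_isOpen hU (by simp)) hq
  have h1 : ∀ v w, dirDeriv v (dirDeriv w f) q = fderiv ℝ (fderiv ℝ f) q v w := by
    intro v w
    have h3 : HasFDerivAt (dirDeriv w f) _ q :=
      (ContinuousLinearMap.apply ℝ E w).hasFDerivAt.comp q h2
    rw [dirDeriv, h3.fderiv]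
    rfl
  have hs : IsSymmSndFDerivAt ℝ f q :=
    (hf.contDiffAt (hU.mem_nhds hq)).isSymmSndFDerivAt
      (by simpa using WithTop.coe_le_coe.2 (le_top : (2 : ℕ∞) ≤ ⊤))
  rw [h1, h1, hs.eq]

theorem contDiffOn_iterate_dirDeriv (hU : IsOpen U) (hf : ContDiffOn ℝ ∞ f U) (v : X) (a : ℕ) :
    ContDiffOn ℝ ∞ ((dirDeriv v)^[a] f) U := by
  induction a with
  | zero => exact hf
  | succ a ih =>
    rw [Function.iterate_succ_apply']
    exact contDiffOn_dirDeriv hU ih v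

theorem iterate_dirDeriv_comm (hU : IsOpen U) (hf : ContDiffOn ℝ ∞ f U) (v w : X) (a : ℕ) :
    EqOn (dirDeriv w ((dirDeriv v)^[a] f)) ((dirDeriv v)^[a] (dirDeriv w f)) U := by
  induction a with
  | zero => exact fun _ _ => rfl
  | succ a ih =>
    intro q hq
    rw [Function.iterate_succ_apply', Function.iterate_succ_apply',
      dirDeriv_comm hU (contDiffOn_iterate_dirDeriv hU hf v a) w v hq, dirDeriv_congr hU ih v hq]

theorem dirDeriv_sub_smul (hU : IsOpen U) (hf : ContDiffOn ℝ ∞ f U) (hg : ContDiffOn ℝ ∞ g U)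
    (c : ℝ) (v : X) :
    EqOn (dirDeriv v (fun q => f q - c • g q)) (fun q => dirDeriv v f q - c • dirDeriv v g q) U := by
  intro q hq
  have h := (hasFDerivAt_of_contDiffOn hU hf hq).sub
    ((hasFDerivAt_of_contDiffOn hU hg hq).const_smul c)
  change fderiv ℝ (f - c • g) q v = _
  rw [h.fderiv]
  rfl

theorem hasDerivAt_comp_of_contDiffOn (hU : IsOpen U) (hf : ContDiffOn ℝ ∞ f U) {γ : ℝ → X}
    {v : X} {s : ℝ} (hγ : HasDerivAt γ v s) (hs : γ s ∈ U) :
    HasDerivAt (fun s => f (γ s)) (dirDeriv v f (γ s)) s :=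
  (hasFDerivAt_of_contDiffOn hU hf hs).comp_hasDerivAt s hγ

end DirectionalDerivatives

/-! ### Mixed partial derivatives of the scattering data -/

section PartialDerivatives

variable {m : ℕ} {T : Set ℝ} {p : ℝ → ℝ → ℝ → Mat m}

/-- `∂_y^a ∂_η^b p` as a function of `(t, y, η)`. -/
noncomputable def jet (p : ℝ → ℝ → ℝ → Mat m) (a b : ℕ) : ℝ × ℝ × ℝ → Mat m :=
  (dirDeriv ((0, 1, 0) : ℝ × ℝ × ℝ))^[a] ((dirDeriv ((0, 0, 1) : ℝ × ℝ × ℝ))^[b]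
    fun q => p q.1 q.2.1 q.2.2)

theorem contDiffOn_jet (hT : IsOpen T)
    (hp : ContDiffOn ℝ ∞ (fun q : ℝ × ℝ × ℝ => p q.1 q.2.1 q.2.2) (T ×ˢ univ)) (a b : ℕ) :
    ContDiffOn ℝ ∞ (jet p a b) (T ×ˢ univ) :=
  contDiffOn_iterate_dirDeriv (hT.prod isOpen_univ)
    (contDiffOn_iterate_dirDeriv (hT.prod isOpen_univ) hp _ _) _ _

theorem dirDeriv_jet_left (a b : ℕ) :
    dirDeriv ((0, 1, 0) : ℝ × ℝ × ℝ) (jet p a b) = jet p (a + 1) b :=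
  (Function.iterate_succ_apply' _ _ _).symm

theorem dirDeriv_jet_right (hT : IsOpen T)
    (hp : ContDiffOn ℝ ∞ (fun q : ℝ × ℝ × ℝ => p q.1 q.2.1 q.2.2) (T ×ˢ univ)) (a b : ℕ) :
    EqOn (dirDeriv ((0, 0, 1) : ℝ × ℝ × ℝ) (jet p a b)) (jet p a (b + 1)) (T ×ˢ univ) := by
  intro q hq
  rw [jet, jet, Function.iterate_succ_apply' _ b]
  exact iterate_dirDeriv_comm (hT.prod isOpen_univ)
    (contDiffOn_iterate_dirDeriv (hT.prod isOpen_univ) hp _ _) _ _ a hq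

theorem hasDerivAt_line (s y η : ℝ) (v : ℝ × ℝ × ℝ) (u : ℝ) :
    HasDerivAt (fun r : ℝ => ((s, y, η) : ℝ × ℝ × ℝ) + r • v) v u := by
  simpa using ((hasDerivAt_id u).smul_const v).const_add ((s, y, η) : ℝ × ℝ × ℝ)

theorem hasDerivAt_jet_left (hT : IsOpen T)
    (hp : ContDiffOn ℝ ∞ (fun q : ℝ × ℝ × ℝ => p q.1 q.2.1 q.2.2) (T ×ˢ univ)) (a b : ℕ) {s : ℝ}
    (hs : s ∈ T) (y η : ℝ) :
    HasDerivAt (fun y => jet p a b (s, y, η)) (jet p (a + 1) b (s, y, η)) y := by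
  have := hasDerivAt_comp_of_contDiffOn (hT.prod isOpen_univ) (contDiffOn_jet hT hp a b)
    (hasDerivAt_line s 0 η (0, 1, 0) y) (by simp [hs])
  simpa [dirDeriv_jet_left] using this

theorem hasDerivAt_jet_right (hT : IsOpen T)
    (hp : ContDiffOn ℝ ∞ (fun q : ℝ × ℝ × ℝ => p q.1 q.2.1 q.2.2) (T ×ˢ univ)) (a b : ℕ) {s : ℝ}
    (hs : s ∈ T) (y η : ℝ) :
    HasDerivAt (fun η => jet p a b (s, y, η)) (jet p a (b + 1) (s, y, η)) η := by
  have := hasDerivAt_comp_of_contDiffOn (hT.prod isOpen_univ) (contDiffOn_jet hT hp a b)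
    (hasDerivAt_line s y 0 (0, 0, 1) η) (by simp [hs])
  rw [← dirDeriv_jet_right hT hp a b ⟨hs, trivial⟩]
  simpa using this

theorem hasDerivAt_jet_diag (hT : IsOpen T)
    (hp : ContDiffOn ℝ ∞ (fun q : ℝ × ℝ × ℝ => p q.1 q.2.1 q.2.2) (T ×ˢ univ)) (a b : ℕ) {s : ℝ}
    (hs : s ∈ T) (y η x : ℝ) :
    HasDerivAt (fun x => jet p a b (s, y + x, η + x))
      (jet p (a + 1) b (s, y + x, η + x) + jet p a (b + 1) (s, y + x, η + x)) x := by
  have := hasDerivAt_comp_of_contDiffOn (hT.prod isOpen_univ) (contDiffOn_jet hT hp a b)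
    (hasDerivAt_line s y η ((0, 1, 0) + (0, 0, 1)) x) (by simp [hs])
  rw [← dirDeriv_jet_right hT hp a b ⟨hs, trivial⟩, ← dirDeriv_jet_left, dirDeriv, dirDeriv,
    ← map_add]
  simpa [dirDeriv] using this

theorem iteratedDeriv_eq_of_hasDerivAt {E : Type*} [NormedAddCommGroup E] [NormedSpace ℝ E]
    (F : ℕ → ℝ → E) (hF : ∀ c x, HasDerivAt (F c) (F (c + 1) x) x) (c : ℕ) :
    iteratedDeriv c (F 0) = F c := by
  ext1 x
  exact iteratedDeriv_eqOn_of_hasDerivAt isOpen_univ F (fun c x _ => hF c x) (F 0)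
    (fun _ _ => rfl) c (mem_univ x)

/-- Replaces nested one-variable derivatives by jointly smooth functions of (t, y, η), whose mixed
derivatives commute. Time-independent data are covered by a constant family. -/
theorem pderiv_eq_jet (hT : IsOpen T)
    (hp : ContDiffOn ℝ ∞ (fun q : ℝ × ℝ × ℝ => p q.1 q.2.1 q.2.2) (T ×ˢ univ)) (a b : ℕ) {s : ℝ}
    (hs : s ∈ T) (y η : ℝ) : pderiv a b (p s) y η = jet p a b (s, y, η) := by
  have h1 : ∀ y', iteratedDeriv b (fun η' => p s y' η') = fun η => jet p 0 b (s, y', η) := fun y' =>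
    iteratedDeriv_eq_of_hasDerivAt (fun b η => jet p 0 b (s, y', η))
      (fun b η => hasDerivAt_jet_right hT hp 0 b hs y' η) b
  have h2 := iteratedDeriv_eq_of_hasDerivAt (fun a y => jet p a b (s, y, η))
      (fun a y => hasDerivAt_jet_left hT hp a b hs y η) a
  rw [pderiv]
  simp only [h1]
  exact congrFun h2 y

theorem hasDerivAt_jet_time {n : ℕ} (h : SolvesBase n T p) (a b : ℕ) {s : ℝ} (hs : s ∈ T)
    (y η : ℝ) : HasDerivAt (fun s => jet p a b (s, y, η))
      (jet p (a + n) b (s, y, η) - (-1 : ℝ) ^ n • jet p a (b + n) (s, y, η)) s := by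
  have hU : IsOpen (T ×ˢ (univ : Set (ℝ × ℝ))) := h.isOpen.prod isOpen_univ
  have hsm := contDiffOn_jet h.isOpen h.smooth
  have hdir : ∀ a b, ∀ q ∈ T ×ˢ (univ : Set (ℝ × ℝ)),
      HasDerivAt (fun s => jet p a b (s, q.2.1, q.2.2))
        (dirDeriv ((1, 0, 0) : ℝ × ℝ × ℝ) (jet p a b) q) q.1 := by
    rintro a b ⟨s, y, η⟩ hq
    have := hasDerivAt_comp_of_contDiffOn hU (hsm a b)
      (hasDerivAt_line 0 y η (1, 0, 0) s) (by simpa using hq)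
    simpa using this
  -- The base equation is differentiated by commuting ∂_t past ∂_η and ∂_y. The η-derivatives are
  -- the inner ones in `jet`, so the case a = 0 is settled first by induction on b.
  have key : ∀ a b, EqOn (dirDeriv ((1, 0, 0) : ℝ × ℝ × ℝ) (jet p a b))
      (fun q => jet p (a + n) b q - (-1 : ℝ) ^ n • jet p a (b + n) q) (T ×ˢ univ) := by
    intro a
    induction a with
    | zero =>
      intro b
      induction b with
      | zero =>
        intro q hq
        have h1 := h.base q.1 hq.1 q.2.1 q.2.2
        rw [pderiv_eq_jet h.isOpen h.smooth _ _ hq.1, pderiv_eq_jet h.isOpen h.smooth _ _ hq.1] at h1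
        simpa using (hdir 0 0 q hq).unique h1
      | succ b ih =>
        intro q hq
        rw [← dirDeriv_congr hU (dirDeriv_jet_right h.isOpen h.smooth 0 b) _ hq,
          dirDeriv_comm hU (hsm 0 b) _ _ hq, dirDeriv_congr hU ih _ hq,
          dirDeriv_sub_smul hU (hsm _ _) (hsm _ _) _ _ hq]
        dsimp only
        rw [dirDeriv_jet_right h.isOpen h.smooth _ _ hq, dirDeriv_jet_right h.isOpen h.smooth _ _ hq,
          show b + 1 + n = b + n + 1 by ring]
    | succ a ih =>
      intro b q hq
      rw [← dirDeriv_jet_left, dirDeriv_comm hU (hsm a b) _ _ hq, dirDeriv_congr hU (ih b) _ hq,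
        dirDeriv_sub_smul hU (hsm _ _) (hsm _ _) _ _ hq]
      dsimp only
      rw [dirDeriv_jet_left, dirDeriv_jet_left, show a + 1 + n = a + n + 1 by ring]
  have h1 := hdir a b (s, y, η) ⟨hs, trivial⟩
  rwa [key a b ⟨hs, trivial⟩] at h1

end PartialDerivatives

/-! ### Differentiability of P_{a,b} in operator norm -/

section OperatorDerivatives

variable {m : ℕ}

/-- Differentiability in operator norm of a family of Hilbert–Schmidt operators whose kernels are
twice differentiable in the parameter with `L²`-bounded second derivative. -/
theorem hasDerivAt_opOf {f f' f'' : ℝ → ℝ → ℝ → Mat m} {x : ℝ} {N : Set ℝ} (hN : IsOpen N)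
    (hNc : OrdConnected N) (hx : x ∈ N) {T' : HSpace m →L[ℝ] HSpace m} {C : ℝ≥0∞} (hC : C ≠ ⊤)
    (hf : ∀ u ∈ N, ∀ z ζ, HasDerivAt (fun u => f u z ζ) (f' u z ζ) u)
    (hf' : ∀ u ∈ N, ∀ z ζ, HasDerivAt (fun u => f' u z ζ) (f'' u z ζ) u)
    (hc : ContinuousOn (fun q : ℝ × ℝ × ℝ => f'' q.1 q.2.1 q.2.2) (N ×ˢ univ))
    (hk : ∀ u ∈ N, IsKernelOf (f u) (opOf (f u))) (hT' : IsKernelOf (f' x) T')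
    (hb : ∀ u ∈ N, eLpNorm (fun q : ℝ × ℝ => f'' u q.1 q.2) 2 (halfLine.prod halfLine) ≤ C) :
    HasDerivAt (fun u => opOf (f u)) T' x := by
  rw [← hasDerivWithinAt_univ]
  refine hasDerivWithinAt_of_quadratic (C := C.toReal) ?_
  rw [nhdsWithin_univ]
  filter_upwards [hN.mem_nhds hx] with v hv
  have hsub : uIcc x v ⊆ N := hNc.uIcc_subset hx hv
  have hker := ((hk v hv).sub (hk x hx)).sub (hT'.const_smul (v - x))
  refine hker.norm_le.trans ?_
  have key := eLpNorm_taylor_le (μ := halfLine.prod halfLine) (F := fun u q => f u q.1 q.2)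
    (F' := fun u q => f' u q.1 q.2) (F'' := fun u q => f'' u q.1 q.2) (u := x) (v := v) (C := C)
    (fun q s hs => hf s (hsub hs) _ _) (fun q s hs => hf' s (hsub hs) _ _)
    (fun q => hc.comp (f := fun s : ℝ => ((s, q) : ℝ × ℝ × ℝ)) (by fun_prop)
      fun s hs => ⟨hsub hs, trivial⟩)
    (by
      rw [← Measure.restrict_univ (μ := halfLine.prod halfLine), Measure.prod_restrict]
      exact (hc.mono (prod_mono hsub subset_rfl)).aestronglyMeasurable
        (measurableSet_uIcc.prod MeasurableSet.univ))
    (fun s hs => hb s (hsub hs))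
  refine (ENNReal.toReal_mono (ENNReal.mul_ne_top (by simp) hC) key).trans_eq ?_
  rw [ENNReal.toReal_mul, ENNReal.toReal_pow, toReal_enorm, Real.norm_eq_abs, mul_comm]

theorem measurePreserving_shift (x : ℝ) :
    MeasurePreserving (fun q : ℝ × ℝ => (q.1 + x, q.2 + x)) (halfLine.prod halfLine)
      (volume.restrict (Iic x ×ˢ Iic x)) := by
  have h := (measurePreserving_add_right (volume : Measure (ℝ × ℝ)) (x, x)).restrict_preimage
    (s := Iic x ×ˢ Iic x) (measurableSet_Iic.prod measurableSet_Iic)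
  have e : (fun q : ℝ × ℝ => q + (x, x)) ⁻¹' Iic x ×ˢ Iic x = Iic 0 ×ˢ Iic 0 := by
    ext q
    simp
    rfl
  rwa [e, Measure.volume_eq_prod, ← Measure.prod_restrict] at h

theorem eLpNorm_shift_le {g : ℝ × ℝ → Mat m} (hg : Continuous g) {x c : ℝ} (hxc : x ≤ c) :
    eLpNorm (fun q : ℝ × ℝ => g (q.1 + x, q.2 + x)) 2 (halfLine.prod halfLine)
      ≤ eLpNorm g 2 (volume.restrict (Iic c ×ˢ Iic c)) := by
  have h := eLpNorm_comp_measurePreserving (p := 2) (f := fun q : ℝ × ℝ => (q.1 + x, q.2 + x))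
    hg.aestronglyMeasurable (measurePreserving_shift x)
  have h' : eLpNorm (fun q : ℝ × ℝ => g (q.1 + x, q.2 + x)) 2 (halfLine.prod halfLine)
    = eLpNorm g 2 (volume.restrict (Iic x ×ˢ Iic x)) := h
  rw [h']
  exact eLpNorm_mono_measure _ (Measure.restrict_mono
    (prod_mono (Iic_subset_Iic.2 hxc) (Iic_subset_Iic.2 hxc)) le_rfl)

/-- The kernels `(∂_y^a ∂_η^b p)(z+x, ζ+x)`. -/
noncomputable def shiftFamily (p : ℝ → ℝ → Mat m) (x : ℝ) (a b : ℕ) : ℝ → ℝ → Mat m :=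
  fun z ζ => pderiv a b p (z + x) (ζ + x)

theorem opP_eq (p : ℝ → ℝ → Mat m) (x : ℝ) (a b : ℕ) : opP p x a b = opOf (shiftFamily p x a b) :=
  rfl

variable {p : ℝ → ℝ → Mat m}

theorem IsScatteringKernel.contDiffOn (hp : IsScatteringKernel p) :
    ContDiffOn ℝ ∞ (fun q : ℝ × ℝ × ℝ => (fun _ : ℝ => p) q.1 q.2.1 q.2.2) (univ ×ˢ univ) :=
  (hp.smooth.comp contDiff_snd).contDiffOn

theorem IsScatteringKernel.pderiv_eq (hp : IsScatteringKernel p) (a b : ℕ) (s y η : ℝ) :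
    pderiv a b p y η = jet (fun _ => p) a b (s, y, η) :=
  pderiv_eq_jet (p := fun _ => p) isOpen_univ hp.contDiffOn a b (mem_univ s) y η

theorem IsScatteringKernel.continuous_pderiv (hp : IsScatteringKernel p) (a b : ℕ) :
    Continuous fun q : ℝ × ℝ => pderiv a b p q.1 q.2 := by
  have h := (contDiffOn_jet (p := fun _ => p) isOpen_univ hp.contDiffOn a b).continuousOn
  rw [univ_prod_univ, continuousOn_univ] at h
  simp only [hp.pderiv_eq a b 0]
  exact h.comp (by fun_prop)

theorem IsScatteringKernel.kernelFamily (hp : IsScatteringKernel p) (x : ℝ) :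
    KernelFamily (shiftFamily p x) where
  cont a b := (hp.continuous_pderiv a b).comp (g := fun q : ℝ × ℝ => pderiv a b p q.1 q.2)
    (f := fun q : ℝ × ℝ => (q.1 + x, q.2 + x)) (by fun_prop)
  memLp a b := (hp.sqIntegrable a b x).comp_measurePreserving (measurePreserving_shift x)
  deriv_left a b z ζ := by
    simp only [shiftFamily, hp.pderiv_eq _ _ 0]
    exact (hasDerivAt_jet_left (p := fun _ => p) isOpen_univ hp.contDiffOn a b (mem_univ 0) (z + x)
      (ζ + x)).comp_add_const z x
  deriv_right a b z ζ := by
    simp only [shiftFamily, hp.pderiv_eq _ _ 0]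
    exact (hasDerivAt_jet_right (p := fun _ => p) isOpen_univ hp.contDiffOn a b (mem_univ 0) (z + x)
      (ζ + x)).comp_add_const ζ x

theorem IsScatteringKernel.hasDerivAt_pderiv_diag (hp : IsScatteringKernel p) (a b : ℕ)
    (z ζ x : ℝ) : HasDerivAt (fun x => pderiv a b p (z + x) (ζ + x))
      (pderiv (a + 1) b p (z + x) (ζ + x) + pderiv a (b + 1) p (z + x) (ζ + x)) x := by
  simp only [hp.pderiv_eq _ _ 0]
  exact hasDerivAt_jet_diag (p := fun _ => p) isOpen_univ hp.contDiffOn a b (mem_univ 0) z ζ x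

theorem IsScatteringKernel.hasDerivAt_opP (hp : IsScatteringKernel p) (a b : ℕ) (x : ℝ) :
    HasDerivAt (fun x => opP p x a b) (opP p x (a + 1) b + opP p x a (b + 1)) x := by
  let g : ℝ × ℝ → Mat m := fun q => (pderiv (a + 1 + 1) b p q.1 q.2
    + pderiv (a + 1) (b + 1) p q.1 q.2) + (pderiv (a + 1) (b + 1) p q.1 q.2
      + pderiv a (b + 1 + 1) p q.1 q.2)
  have hg : Continuous g := ((hp.continuous_pderiv _ _).add (hp.continuous_pderiv _ _)).add
    ((hp.continuous_pderiv _ _).add (hp.continuous_pderiv _ _))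
  have hgl : MemLp g 2 (volume.restrict (Iic (x + 1) ×ˢ Iic (x + 1))) := by
    have e : ∀ a b c d, MemLp (fun q : ℝ × ℝ => pderiv a b p q.1 q.2 + pderiv c d p q.1 q.2) 2
        (volume.restrict (Iic (x + 1) ×ˢ Iic (x + 1))) := fun a b c d =>
      MemLp.add (f := fun q : ℝ × ℝ => pderiv a b p q.1 q.2)
        (g := fun q : ℝ × ℝ => pderiv c d p q.1 q.2) (hp.sqIntegrable a b _) (hp.sqIntegrable c d _)
    exact MemLp.add (f := fun q : ℝ × ℝ => pderiv (a + 1 + 1) b p q.1 q.2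
      + pderiv (a + 1) (b + 1) p q.1 q.2) (g := fun q : ℝ × ℝ => pderiv (a + 1) (b + 1) p q.1 q.2
      + pderiv a (b + 1 + 1) p q.1 q.2) (e _ _ _ _) (e _ _ _ _)
  -- The function g is (∂_y + ∂_η)² ∂_y^a ∂_η^b p. For u < x + 1 the kernels shifted by u live on
  -- the quadrant with corner x + 1, whence one L² bound for all of them.
  refine hasDerivAt_opOf (f := fun x => shiftFamily p x a b)
    (f' := fun x z ζ => shiftFamily p x (a + 1) b z ζ + shiftFamily p x a (b + 1) z ζ)
    (f'' := fun x z ζ => g (z + x, ζ + x)) isOpen_Iio ordConnected_Iio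
    (show x < x + 1 by linarith) hgl.2.ne (fun u _ z ζ => hp.hasDerivAt_pderiv_diag a b z ζ u)
    (fun u _ z ζ => (hp.hasDerivAt_pderiv_diag (a + 1) b z ζ u).add
      (hp.hasDerivAt_pderiv_diag a (b + 1) z ζ u)) ?_
    (fun u _ => (hp.kernelFamily u).isKernelOf a b)
    (((hp.kernelFamily x).isKernelOf (a + 1) b).add ((hp.kernelFamily x).isKernelOf a (b + 1)))
    (fun u hu => eLpNorm_shift_le hg (le_of_lt hu))
  exact (hg.comp (by fun_prop : Continuous fun q : ℝ × ℝ × ℝ =>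
    (q.2.1 + q.1, q.2.2 + q.1))).continuousOn

theorem SolvesBase.hasDerivAt_shiftFamily {n : ℕ} {T : Set ℝ} {p : ℝ → ℝ → ℝ → Mat m}
    (h : SolvesBase n T p) (a b : ℕ) {s : ℝ} (hs : s ∈ T) (x z ζ : ℝ) :
    HasDerivAt (fun u => shiftFamily (p u) x a b z ζ)
      (shiftFamily (p s) x (a + n) b z ζ - (-1 : ℝ) ^ n • shiftFamily (p s) x a (b + n) z ζ) s := by
  have h1 := hasDerivAt_jet_time h a b hs (z + x) (ζ + x)
  rw [← pderiv_eq_jet h.isOpen h.smooth _ _ hs, ← pderiv_eq_jet h.isOpen h.smooth _ _ hs] at h1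
  refine h1.congr_of_eventuallyEq ?_
  filter_upwards [h.isOpen.mem_nhds hs] with u hu
  exact pderiv_eq_jet h.isOpen h.smooth a b hu _ _

theorem SolvesBase.continuousOn_shiftFamily {n : ℕ} {T : Set ℝ} {p : ℝ → ℝ → ℝ → Mat m}
    (h : SolvesBase n T p) (a b : ℕ) (x : ℝ) :
    ContinuousOn (fun q : ℝ × ℝ × ℝ => shiftFamily (p q.1) x a b q.2.1 q.2.2) (T ×ˢ univ) := by
  have h1 := (contDiffOn_jet h.isOpen h.smooth a b).continuousOn.comp
    (f := fun q : ℝ × ℝ × ℝ => (q.1, q.2.1 + x, q.2.2 + x)) (s := T ×ˢ univ)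
    (by fun_prop) fun q hq => ⟨hq.1, trivial⟩
  exact h1.congr fun q hq => pderiv_eq_jet h.isOpen h.smooth a b hq.1 _ _

theorem eLpNorm_sub_smul_le {g₁ g₂ : ℝ × ℝ → Mat m} {C D : ℝ≥0∞} {ε : ℝ} (hε : ‖ε‖ = 1)
    {μ : Measure (ℝ × ℝ)} (c₁ : Continuous g₁) (c₂ : Continuous g₂)
    (h₁ : eLpNorm g₁ 2 μ ≤ C) (h₂ : eLpNorm g₂ 2 μ ≤ D) :
    eLpNorm (fun q => g₁ q - ε • g₂ q) 2 μ ≤ C + D := by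
  have e : eLpNorm (fun q => ε • g₂ q) 2 μ = eLpNorm g₂ 2 μ :=
    eLpNorm_congr_norm_ae (.of_forall fun q => by rw [norm_smul, hε, one_mul])
  have m₁ : AEStronglyMeasurable g₁ μ := c₁.aestronglyMeasurable
  have m₂ : AEStronglyMeasurable (fun q => ε • g₂ q) μ :=
    (c₂.const_smul ε).aestronglyMeasurable
  refine (eLpNorm_sub_le m₁ m₂ one_le_two).trans ?_
  rw [e]
  exact add_le_add h₁ h₂

theorem SolvesBase.hasDerivAt_opP {n : ℕ} {T : Set ℝ} {p : ℝ → ℝ → ℝ → Mat m}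
    (h : SolvesBase n T p) (a b : ℕ) {s : ℝ} (hs : s ∈ T) (x : ℝ) :
    HasDerivAt (fun s => opP (p s) x a b)
      (opP (p s) x (a + n) b - (-1 : ℝ) ^ n • opP (p s) x a (b + n)) s := by
  -- By the base equation, the second t_n-derivative of the kernel involves exactly these three
  -- partial derivatives.
  obtain ⟨C₁, hC₁⟩ := h.bounded (a + n + n) b x s hs
  obtain ⟨C₂, hC₂⟩ := h.bounded (a + n) (b + n) x s hs
  obtain ⟨C₃, hC₃⟩ := h.bounded a (b + n + n) x s hs
  obtain ⟨δ, hδ, hball⟩ := Metric.eventually_nhds_iff_ball.1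
    (((hC₁.and hC₂).and hC₃).and (h.isOpen.mem_nhds hs))
  have hd : ∀ a b, ∀ u ∈ T, ∀ z ζ, HasDerivAt (fun u => shiftFamily (p u) x a b z ζ)
      (shiftFamily (p u) x (a + n) b z ζ - (-1 : ℝ) ^ n • shiftFamily (p u) x a (b + n) z ζ) u :=
    fun a b u hu z ζ => h.hasDerivAt_shiftFamily a b hu x z ζ
  have hε : ‖(-1 : ℝ) ^ n‖ = 1 := by simp
  generalize (-1 : ℝ) ^ n = ε at hd hε ⊢
  have hcont : ∀ a b, ContinuousOn (fun q : ℝ × ℝ × ℝ => shiftFamily (p q.1) x a b q.2.1 q.2.2)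
      (Metric.ball s δ ×ˢ univ) := fun a b =>
    (h.continuousOn_shiftFamily a b x).mono (prod_mono (fun u hu => (hball u hu).2) subset_rfl)
  have hk : ∀ u ∈ T, KernelFamily (shiftFamily (p u) x) := fun u hu =>
    (h.kernel u hu).kernelFamily x
  let f' : ℝ → ℝ → ℝ → Mat m := fun s z ζ => shiftFamily (p s) x (a + n) b z ζ
      - ε • shiftFamily (p s) x a (b + n) z ζ
  let f'' : ℝ → ℝ → ℝ → Mat m := fun s z ζ => (shiftFamily (p s) x (a + n + n) b z ζ
        - ε • shiftFamily (p s) x (a + n) (b + n) z ζ)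
      - ε • (shiftFamily (p s) x (a + n) (b + n) z ζ - ε • shiftFamily (p s) x a (b + n + n) z ζ)
  have hf'' : ∀ u ∈ Metric.ball s δ, ∀ z ζ, HasDerivAt (fun u => f' u z ζ) (f'' u z ζ) u :=
    fun u hu z ζ => (hd (a + n) b u (hball u hu).2 z ζ).sub
      ((hd a (b + n) u (hball u hu).2 z ζ).const_smul ε)
  have hc : ContinuousOn (fun q : ℝ × ℝ × ℝ => f'' q.1 q.2.1 q.2.2) (Metric.ball s δ ×ˢ univ) :=
    ((hcont _ _).sub ((hcont _ _).const_smul ε)).sub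
      (((hcont _ _).sub ((hcont _ _).const_smul ε)).const_smul ε)
  have hT' : IsKernelOf (f' s) (opP (p s) x (a + n) b - ε • opP (p s) x a (b + n)) :=
    ((hk s hs).isKernelOf (a + n) b).sub (((hk s hs).isKernelOf a (b + n)).const_smul ε)
  have hb : ∀ u ∈ Metric.ball s δ, eLpNorm (fun q : ℝ × ℝ => f'' u q.1 q.2) 2
      (halfLine.prod halfLine) ≤ C₁ + C₂ + (C₂ + C₃) := by
    intro u hu
    obtain ⟨⟨⟨hb₁, hb₂⟩, hb₃⟩, huT⟩ := hball u hu
    have hbd : ∀ {a b : ℕ} {C : ℝ≥0}, eLpNorm (fun q : ℝ × ℝ => pderiv a b (p u) q.1 q.2) 2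
        (volume.restrict (Iic x ×ˢ Iic x)) ≤ C →
        eLpNorm (fun q : ℝ × ℝ => shiftFamily (p u) x a b q.1 q.2) 2 (halfLine.prod halfLine) ≤ C :=
      fun hC => (eLpNorm_shift_le ((h.kernel u huT).continuous_pderiv _ _) le_rfl).trans hC
    have hcu := (hk u huT).cont
    exact eLpNorm_sub_smul_le hε ((hcu _ _).sub ((hcu _ _).const_smul ε))
      ((hcu _ _).sub ((hcu _ _).const_smul ε))
      (eLpNorm_sub_smul_le hε (hcu _ _) (hcu _ _) (hbd hb₁) (hbd hb₂))
      (eLpNorm_sub_smul_le hε (hcu _ _) (hcu _ _) (hbd hb₂) (hbd hb₃))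
  exact hasDerivAt_opOf (f := fun s => shiftFamily (p s) x a b) (f' := f') (f'' := f'')
    Metric.isOpen_ball (convex_ball s δ).ordConnected (Metric.mem_ball_self hδ)
    (C := C₁ + C₂ + (C₂ + C₃)) (by simp) (fun u hu => hd a b u (hball u hu).2) hf'' hc
    (fun u hu => (hk u (hball u hu).2).isKernelOf a b) hT' hb

end OperatorDerivatives

/-! ### The resolvent V -/

section Resolvent

theorem hasDerivAt_inverse_one_sub {R : Type*} [NormedRing R] [NormedAlgebra ℝ R]
    [HasSummableGeomSeries R] {A : ℝ → R} {A' : R} {x : ℝ} (hA : HasDerivAt A A' x)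
    (hx : IsUnit (1 - A x)) :
    HasDerivAt (fun y => Ring.inverse (1 - A y))
      (Ring.inverse (1 - A x) * A' * Ring.inverse (1 - A x)) x := by
  obtain ⟨u, hu⟩ := hx
  have h1 := hasFDerivAt_ringInverse (𝕜 := ℝ) u
  rw [hu] at h1
  refine (h1.comp_hasDerivAt x (hA.const_sub 1)).congr_deriv ?_
  rw [← hu, Ring.inverse_unit]
  simp

theorem eventually_isUnit_one_sub {R : Type*} [NormedRing R] [HasSummableGeomSeries R]
    {A : ℝ → R} {x : ℝ} (hA : ContinuousAt A x) (hx : IsUnit (1 - A x)) :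
    ∀ᶠ y in 𝓝 x, IsUnit (1 - A y) :=
  (continuousAt_const.sub hA).eventually (Units.isOpen.mem_nhds hx)

variable {m : ℕ} {p : ℝ → ℝ → Mat m} {x : ℝ}

theorem one_add_opP_mul_opV (hx : IsUnit (1 - opP p x 0 0)) :
    1 + opP p x 0 0 * opV p x = opV p x := by
  have h : (1 - opP p x 0 0) * opV p x = 1 := Ring.mul_inverse_cancel _ hx
  rw [sub_mul, one_mul, sub_eq_iff_eq_add] at h
  exact h.symm

theorem one_add_opV_mul_opP (hx : IsUnit (1 - opP p x 0 0)) :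
    1 + opV p x * opP p x 0 0 = opV p x := by
  have h : opV p x * (1 - opP p x 0 0) = 1 := Ring.inverse_mul_cancel _ hx
  rw [mul_sub, mul_one, sub_eq_iff_eq_add] at h
  exact h.symm

end Resolvent

/-! ### Continuous kernels of the monomials and of G -/

section KernelsOfMonomials

variable {m : ℕ}

/-- The columns of the operator `V P_{a₁,b₁} V ⋯ P_{a_r,b_r} V`, and of `V - id`. -/
noncomputable def colMono (k : ℕ → ℕ → ℝ → ℝ → Mat m) (V : HSpace m →L[ℝ] HSpace m) :
    List (ℕ × ℕ) → ℝ → (Vec m →L[ℝ] HSpace m)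
  | [], ζ => V.comp (colOp k 0 0 ζ)
  | (a, b) :: l, ζ =>
    V.comp ((opOf (k a b)).comp (colMono k V l ζ) + if l = [] then colOp k a b ζ else 0)

theorem bordV_mul_tailEv_apply (k : ℕ → ℕ → ℝ → ℝ → Mat m) (V : HSpace m →L[ℝ] HSpace m)
    (l : List (ℕ × ℕ)) (v : Vec m) :
    bordV V (tailEv (bordP k) (bordV V) 0 l (0, v)) = (colMono k V l 0 v, 0) := by
  induction l with
  | nil =>
    simp only [tailEv, bordP_apply, bordV_apply, map_zero, zero_add]
    rfl
  | cons c l ih =>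
    obtain ⟨a, b⟩ := c
    simp only [tailEv, add_apply, mul_apply_eq_comp, ih]
    by_cases hl : l = []
    · simp only [hl, if_true, bordP_apply, bordV_apply, map_zero, zero_add, add_zero,
        Prod.mk_add_mk, colMono, ContinuousLinearMap.comp_apply, add_apply]
    · simp only [hl, if_false, bordP_apply, bordV_apply, map_zero, add_zero, zero_apply,
        colMono, ContinuousLinearMap.comp_apply]

theorem corner_kerLin_cons (k : ℕ → ℕ → ℝ → ℝ → Mat m) (V : HSpace m →L[ℝ] HSpace m) (a b : ℕ)
    (l : List (ℕ × ℕ)) :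
    corner m (kerLin (bordP k) (bordV V) 0 (mono ((a, b) :: l)))
      = ((rowOp k a b 0).comp (colMono k V l 0) + if l = [] then k a b 0 0 else 0)
        + (rowOp k 0 0 0).comp (colMono k V ((a, b) :: l) 0) := by
  ext1 v
  rw [corner_apply, kerLin_apply, tailLin_mono]
  simp only [add_mul, one_mul, add_apply, mul_apply_eq_comp, bordV_mul_tailEv_apply]
  simp only [tailEv, add_apply, mul_apply_eq_comp, bordV_mul_tailEv_apply]
  by_cases hl : l = []
  · simp only [hl, if_true, bordP_apply, map_zero, add_zero, zero_add, Prod.mk_add_mk,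
      ContinuousLinearMap.comp_apply]
  · simp only [hl, if_false, bordP_apply, map_zero, add_zero, zero_apply, Prod.mk_add_mk,
      ContinuousLinearMap.comp_apply]

theorem corner_kerLin_vKer (k : ℕ → ℕ → ℝ → ℝ → Mat m) (V : HSpace m →L[ℝ] HSpace m) (j : ℕ) :
    corner m (kerLin (bordP k) (bordV V) j vKer)
      = k 0 j 0 0 + ((rowOp k 0 0 0).comp V).comp (colOp k 0 j 0) := by
  ext1 v
  rw [corner_apply, kerLin_apply, vKer, tailLin_mono]
  simp only [tailEv, add_mul, one_mul, add_apply, mul_apply_eq_comp, bordP_apply, bordV_apply,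
    map_zero, zero_add, add_zero, Prod.mk_add_mk, ContinuousLinearMap.comp_apply]

variable {p : ℝ → ℝ → Mat m} {x : ℝ}

theorem hasCols_colMono (hk : KernelFamily (shiftFamily p x)) (hx : IsUnit (1 - opP p x 0 0))
    (l : List (ℕ × ℕ)) :
    HasCols (opMono p x l - if l = [] then 1 else 0) (colMono (shiftFamily p x) (opV p x) l) := by
  induction l with
  | nil =>
    have e : opMono p x [] - (if ([] : List (ℕ × ℕ)) = [] then 1 else 0)
        = opV p x * opOf (shiftFamily p x 0 0) := by
      rw [if_pos rfl, sub_eq_iff_eq_add', opMono]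
      exact (one_add_opV_mul_opP hx).symm
    rw [e]
    exact (hk.hasCols 0 0).comp_left _
  | cons c l ih =>
    obtain ⟨a, b⟩ := c
    rw [if_neg (List.cons_ne_nil _ _), sub_zero, opMono, mul_assoc]
    have h1 := ih.comp_left (opP p x a b)
    by_cases hl : l = []
    · subst hl
      have e : opP p x a b * opMono p x []
          = opP p x a b * (opMono p x [] - if ([] : List (ℕ × ℕ)) = [] then 1 else 0)
            + opP p x a b := by
        rw [if_pos rfl]
        noncomm_ring
      rw [e]
      exact (h1.add (hk.hasCols a b)).comp_left (opV p x)
    · rw [if_neg hl, sub_zero] at h1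
      have h2 := h1.comp_left (opV p x)
      simpa only [colMono, if_neg hl, add_zero, opP_eq] using h2

/-- A leading V has no rows of its own; writing it as id + PV makes each summand begin with some P,
which has rows, while the rest has columns. A last V is treated likewise by `hasCols_colMono`, which
removes the identity. -/
theorem isKernelOf_opMono (hk : KernelFamily (shiftFamily p x)) (hx : IsUnit (1 - opP p x 0 0))
    (a b : ℕ) (l : List (ℕ × ℕ)) :
    IsKernelOf (fun z ζ => ((rowOp (shiftFamily p x) a b z).comp
        (colMono (shiftFamily p x) (opV p x) l ζ) + if l = [] then shiftFamily p x a b z ζ else 0)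
      + (rowOp (shiftFamily p x) 0 0 z).comp
        (colMono (shiftFamily p x) (opV p x) ((a, b) :: l) ζ)) (opMono p x ((a, b) :: l)) := by
  have e : opMono p x ((a, b) :: l)
      = opP p x a b * opMono p x l + opP p x 0 0 * opMono p x ((a, b) :: l) := by
    conv_lhs => rw [opMono, ← one_add_opP_mul_opV hx]
    rw [opMono]
    noncomm_ring
  have h0 := (hk.hasRows 0 0).isKernelOf_mul (hasCols_colMono hk hx ((a, b) :: l))
  rw [if_neg (List.cons_ne_nil _ _), sub_zero] at h0
  have h1 := (hk.hasRows a b).isKernelOf_mul (hasCols_colMono hk hx l)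
  rw [e]
  refine IsKernelOf.add ?_ h0
  by_cases hl : l = []
  · subst hl
    refine (h1.add (hk.isKernelOf a b)).congr rfl ?_
    rw [if_pos rfl, opP_eq]
    noncomm_ring
  · simpa only [if_neg hl, add_zero, sub_zero, opP_eq] using h1

/-- The bracket is an arbitrary choice of continuous kernel, but uniqueness on the closed quadrant
fixes its value at the end point. -/
theorem realise_eq_corner (hk : KernelFamily (shiftFamily p x)) (hx : IsUnit (1 - opP p x 0 0))
    {X : AP} (hX : X [] = 0) :
    realise p x X = corner m (kerLin (bordP (shiftFamily p x)) (bordV (opV p x)) 0 X) := by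
  refine linearMap_eq_of_mono (Finsupp.linearCombination ℝ fun l => bracket (opMono p x l) 0 0)
    ((corner m).toLinearMap.comp (kerLin (bordP (shiftFamily p x)) (bordV (opV p x)) 0))
    (fun l hl => ?_) hX
  obtain ⟨⟨a, b⟩, l, rfl⟩ := List.exists_cons_of_ne_nil hl
  refine Eq.trans ?_ (corner_kerLin_cons _ _ a b l).symm
  rw [mono, Finsupp.linearCombination_single, one_smul,
    (isKernelOf_opMono hk hx a b l).bracket_eq le_rfl le_rfl]

theorem iteratedDerivWithin_eqOn_of_hasDerivWithinAt {E : Type*} [NormedAddCommGroup E]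
    [NormedSpace ℝ E] {s : Set ℝ} (hs : UniqueDiffOn ℝ s) (F : ℕ → ℝ → E)
    (hF : ∀ c, ∀ x ∈ s, HasDerivWithinAt (F c) (F (c + 1) x) s x) {f : ℝ → E}
    (hf : EqOn f (F 0) s) (c : ℕ) : EqOn (iteratedDerivWithin c f s) (F c) s := by
  induction c with
  | zero => simpa [iteratedDerivWithin_zero] using hf
  | succ c ih =>
    intro x hx
    rw [iteratedDerivWithin_succ, derivWithin_congr ih (ih hx)]
    exact (hF c x hx).derivWithin (hs x hx)

/-- G = P + PVP, and ζ enters only through the kernel of P and the last column, so ζ-derivatives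
fall on these. They are taken within (-∞,0], where the bracket is determined. -/
theorem gaugeCoeff_eq_corner (hk : KernelFamily (shiftFamily p x))
    (hx : IsUnit (1 - opP p x 0 0)) (j : ℕ) :
    gaugeCoeff p j x = (-1 : ℝ) ^ j •
      corner m (kerLin (bordP (shiftFamily p x)) (bordV (opV p x)) (j - 1) vKer) := by
  set k := shiftFamily p x with hkdef
  let F : ℕ → ℝ → Mat m := fun b ζ =>
    k 0 b 0 ζ + ((rowOp k 0 0 0).comp (opV p x)).comp (colOp k 0 b ζ)
  have hker : IsKernelOf (fun z ζ => k 0 0 z ζ + (rowOp k 0 0 z).comp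
      ((opV p x).comp (colOp k 0 0 ζ))) (opG p x) := by
    refine ((hk.isKernelOf 0 0).add ((hk.hasRows 0 0).isKernelOf_mul
      ((hk.hasCols 0 0).comp_left (opV p x)))).congr rfl ?_
    rw [opG]
    conv_rhs => rw [← one_add_opV_mul_opP hx, opP_eq, ← hkdef]
    noncomm_ring
  have hF : ∀ c, ∀ ζ ∈ Iic (0 : ℝ), HasDerivWithinAt (F c) (F (c + 1) ζ) (Iic 0) ζ := by
    intro c ζ hζ
    refine (hk.deriv_right 0 c 0 ζ).hasDerivWithinAt.add ?_
    refine ((hasDerivWithinAt_const ζ (Iic 0) ((rowOp k 0 0 0).comp (opV p x))).clm_comp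
      (hk.hasDerivWithinAt_colOp 0 c hζ)).congr_deriv ?_
    rw [ContinuousLinearMap.zero_comp, zero_add]
  have h := iteratedDerivWithin_eqOn_of_hasDerivWithinAt (uniqueDiffOn_Iic 0) F hF
    (f := fun ζ => bracket (opG p x) 0 ζ) (fun ζ hζ => hker.bracket_eq le_rfl hζ) (j - 1)
    (mem_Iic.2 le_rfl)
  rw [gaugeCoeff, h, corner_kerLin_vKer]

end KernelsOfMonomials

/-! ### Differential equations of the bordered operators and of the readings -/

section Evolution

variable {m : ℕ}

theorem bordComb_add_smul (f g : ℕ → ℕ → HSpace m →L[ℝ] HSpace m) (c : ℝ) (a b : ℕ) :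
    bordComb (fun a b => f a b + c • g a b) a b = bordComb f a b + c • bordComb g a b := by
  simp only [bordComb, ContinuousLinearMap.add_comp, ContinuousLinearMap.comp_add,
    ContinuousLinearMap.smul_comp, ContinuousLinearMap.comp_smul]
  module

theorem bordV_mul_add_smul (k : ℕ → ℕ → ℝ → ℝ → Mat m) (V : HSpace m →L[ℝ] HSpace m) (c : ℝ)
    (a b a' b' : ℕ) :
    bordV (V * (opOf (k a b) + c • opOf (k a' b')) * V)
      = bordV V * (bordP k a b + c • bordP k a' b') * bordV V := by
  refine ContinuousLinearMap.ext fun ⟨φ, v⟩ => ?_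
  simp only [mul_apply_eq_comp, bordV_apply, add_apply, smul_apply, bordP_apply, map_zero,
    add_zero, Prod.smul_mk, Prod.mk_add_mk]

/-- If `P_{a,b}' = P_{a+i,b} + c P_{a,b+i}`, the bordered operators obey the same equation. -/
theorem hasDerivAt_bordP_of_shift {f : ℝ → ℕ → ℕ → ℝ → ℝ → Mat m} {x : ℝ}
    (hf : ∀ᶠ y in 𝓝 x, KernelFamily (f y)) {c : ℝ} {i : ℕ}
    (h : ∀ a b, HasDerivAt (fun y => opOf (f y a b))
      (opOf (f x (a + i) b) + c • opOf (f x a (b + i))) x) (a b : ℕ) :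
    HasDerivAt (fun y => bordP (f y) a b)
      (bordP (f x) (a + i) b + c • bordP (f x) a (b + i)) x := by
  refine (hasDerivAt_bordP hf h a b).congr_deriv ?_
  rw [bordComb_add_smul, hf.self_of_nhds.bordP_eq, hf.self_of_nhds.bordP_eq]
  simp only [bordComb, add_right_comm _ 1 i]

theorem hasDerivAt_bordV_of_shift {f : ℝ → ℕ → ℕ → ℝ → ℝ → Mat m} {x : ℝ} {c : ℝ} {i : ℕ}
    (h : HasDerivAt (fun y => opOf (f y 0 0)) (opOf (f x i 0) + c • opOf (f x 0 i)) x)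
    (hx : IsUnit (1 - opOf (f x 0 0))) :
    HasDerivAt (fun y => bordV (Ring.inverse (1 - opOf (f y 0 0))))
      (bordV (Ring.inverse (1 - opOf (f x 0 0))) * (bordP (f x) i 0 + c • bordP (f x) 0 i)
        * bordV (Ring.inverse (1 - opOf (f x 0 0)))) x := by
  rw [← bordV_mul_add_smul]
  exact hasDerivAt_bordV (hasDerivAt_inverse_one_sub h hx)

variable {p : ℝ → ℝ → Mat m} {x : ℝ}

/-- The bordered operator `P_{a,b}` at the parameter `x`. -/
noncomputable abbrev bP (p : ℝ → ℝ → Mat m) (x : ℝ) (a b : ℕ) : Bord m := bordP (shiftFamily p x) a b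

/-- The bordered operator `V` at the parameter `x`. -/
noncomputable abbrev bV (p : ℝ → ℝ → Mat m) (x : ℝ) : Bord m := bordV (opV p x)

/-- The reading at the end point of an element of the algebra, differentiated `j` times in the
right variable. -/
noncomputable def reading (p : ℝ → ℝ → Mat m) (j : ℕ) (X : AP) (x : ℝ) : Mat m :=
  corner m (kerLin (bP p x) (bV p x) j X)

theorem hasDerivAt_bP (hp : IsScatteringKernel p) (a b : ℕ) (x : ℝ) :
    HasDerivAt (fun x => bP p x a b) (bP p x (a + 1) b + bP p x a (b + 1)) x := by
  have h := hasDerivAt_bordP_of_shift (f := shiftFamily p) (x := x) (c := 1) (i := 1)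
    (.of_forall hp.kernelFamily) (fun a b => by
      rw [one_smul]
      exact hp.hasDerivAt_opP a b x) a b
  rwa [one_smul] at h

theorem hasDerivAt_bV (hp : IsScatteringKernel p) (hx : IsUnit (1 - opP p x 0 0)) :
    HasDerivAt (bV p) (bV p x * (bP p x 1 0 + bP p x 0 1) * bV p x) x := by
  have h := hasDerivAt_bordV_of_shift (f := shiftFamily p) (x := x) (c := 1) (i := 1) (by
      rw [one_smul]
      exact hp.hasDerivAt_opP 0 0 x) hx
  rwa [one_smul] at h

theorem isOpen_isUnit_one_sub_opP (hp : IsScatteringKernel p) :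
    IsOpen {x | IsUnit (1 - opP p x 0 0)} :=
  isOpen_iff_mem_nhds.2 fun x hx =>
    eventually_isUnit_one_sub (hp.hasDerivAt_opP 0 0 x).continuousAt hx

theorem borderedRelations_bP (hp : IsScatteringKernel p) (hx : IsUnit (1 - opP p x 0 0)) :
    BorderedRelations (bP p x) (bV p x) (bordV 1) (bordE m) :=
  (hp.kernelFamily x).borderedRelations (one_add_opP_mul_opV hx) (one_add_opV_mul_opP hx)

theorem reading_augMul (hp : IsScatteringKernel p) (hx : IsUnit (1 - opP p x 0 0)) (j : ℕ)
    {X Y : AP} (hX : X [] = 0) (hY : Y [] = 0) :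
    reading p j (augMul X Y) x = reading p 0 X x * reading p j Y x := by
  rw [reading, (borderedRelations_bP hp hx).kerLin_augMul j hX hY, corner_mul_bordE_mul]
  rfl

theorem reading_augMul_vKer (hp : IsScatteringKernel p) (hx : IsUnit (1 - opP p x 0 0)) (j : ℕ)
    {X : AP} (hX : X [] = 0) : reading p j (augMul X vKer) x
      = reading p 0 X x * reading p j vKer x + reading p (j + 1) X x := by
  rw [reading, (borderedRelations_bP hp hx).kerLin_augMul_vKer j hX, map_add, corner_mul_bordE_mul]
  rfl

theorem hasDerivAt_reading (hp : IsScatteringKernel p) (hx : IsUnit (1 - opP p x 0 0)) (j : ℕ)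
    (X : AP) : HasDerivAt (reading p j X) (reading p j (dx X) x) x :=
  (corner m).hasFDerivAt.comp_hasDerivAt x
    (hasDerivAt_kerLin (P := fun a b y => bP p y a b) (W := bV p) (x := x)
      (fun a b => hasDerivAt_bP hp a b x) (hasDerivAt_bV hp hx) j X)

theorem iteratedDeriv_reading (hp : IsScatteringKernel p) (hx : IsUnit (1 - opP p x 0 0))
    (j c : ℕ) (X : AP) : iteratedDeriv c (reading p j X) x = reading p j ((dx ^ c) X) x := by
  refine iteratedDeriv_eqOn_of_hasDerivAt (isOpen_isUnit_one_sub_opP hp)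
    (fun c => reading p j ((dx ^ c) X)) (fun c y hy => ?_) _ (fun y _ => ?_) c hx
  · rw [pow_succ']
    exact hasDerivAt_reading hp hy j _
  · rfl

theorem gaugeCoeff_eq_reading (hp : IsScatteringKernel p) (hx : IsUnit (1 - opP p x 0 0)) (j : ℕ) :
    gaugeCoeff p j x = (-1 : ℝ) ^ j • reading p (j - 1) vKer x :=
  gaugeCoeff_eq_corner (hp.kernelFamily x) hx j

theorem realise_eq_reading (hp : IsScatteringKernel p) (hx : IsUnit (1 - opP p x 0 0)) {X : AP}
    (hX : X [] = 0) : realise p x X = reading p 0 X x :=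
  realise_eq_corner (hp.kernelFamily x) hx hX

end Evolution

/-! ### The Sato coefficients in the augmented algebra -/

section SatoCoefficients

theorem satoL_smul_of_eventuallyEq {A : Type*} [NormedRing A] [NormedAlgebra ℝ A] (n : ℕ)
    (b : ℕ → ℝ → A) (k : ℕ) {f g : ℝ → A} (c : ℝ) {x : ℝ} (h : f =ᶠ[𝓝 x] fun y => c • g y)
    (hg : ∀ i : ℕ, ContDiffAt ℝ i g x) : satoL n b k f x = c • satoL n b k g x := by
  have e : ∀ i, iteratedDeriv i f x = c • iteratedDeriv i g x := fun i => by
    rw [h.iteratedDeriv_eq, iteratedDeriv_fun_const_smul (hg i)]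
  simp only [satoL, e, mul_smul_comm, smul_comm _ c, smul_add, Finset.smul_sum]

/-- The recursion for the Sato coefficients in the augmented pre-Pöppe algebra. -/
def IsSatoSequence (n : ℕ) (b : ℕ → AP) : Prop :=
  ∀ k : ℕ, 2 ≤ k → k ≤ n + 1 →
    b k = -((n.choose (k - 1) : ℝ) • (dx ^ (k - 1)) vKer
        + ∑ l ∈ Finset.Icc 3 k, ((n + 1 - l).choose (k - l) : ℝ) •
            augMul (b (l - 1)) ((dx ^ (k - l)) vKer))
      ∧ b k [] = 0

theorem exists_isSatoSequence (n : ℕ) : ∃ b, IsSatoSequence n b := by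
  -- The guard only makes the recursion well founded; it always holds for l in the range of
  -- summation.
  let F : (k : ℕ) → ((j : ℕ) → j < k → AP) → AP := fun k b =>
    -((n.choose (k - 1) : ℝ) • (dx ^ (k - 1)) vKer
        + ∑ l ∈ Finset.Icc 3 k, ((n + 1 - l).choose (k - l) : ℝ) •
            augMul (if h : l - 1 < k then b (l - 1) h else 0) ((dx ^ (k - l)) vKer))
  let b : ℕ → AP := fun k => Nat.strongRec (motive := fun _ => AP) F k
  have hb : ∀ k, b k = -((n.choose (k - 1) : ℝ) • (dx ^ (k - 1)) vKer
        + ∑ l ∈ Finset.Icc 3 k, ((n + 1 - l).choose (k - l) : ℝ) •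
            augMul (b (l - 1)) ((dx ^ (k - l)) vKer)) := by
    intro k
    change Nat.strongRec (motive := fun _ => AP) F k = _
    rw [Nat.strongRec_eq]
    simp only [F]
    congr 2
    refine Finset.sum_congr rfl fun l hl => ?_
    have hl' := Finset.mem_Icc.1 hl
    rw [dif_pos (by omega)]
  refine ⟨b, fun k hk _ => ⟨hb k, ?_⟩⟩
  -- Since k ≥ 2, the power of ∂_x is positive, and neither ∂_x nor a product has a ⟦V⟧-component.
  obtain ⟨k, rfl⟩ := Nat.exists_eq_add_of_le' hk
  rw [hb, show k + 2 - 1 = k + 1 by omega, pow_succ', Module.End.mul_apply, Finsupp.neg_apply,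
    Finsupp.add_apply, Finsupp.smul_apply, dx_apply_nil, Finsupp.finsetSum_apply,
    Finset.sum_eq_zero fun l _ => by rw [Finsupp.smul_apply, augMul_apply_nil, smul_zero]]
  simp

variable {m : ℕ} {p : ℝ → ℝ → Mat m} {x : ℝ} {n : ℕ} {b : ℕ → AP}

/-- Among the products of the recursion only the one with i = k has the bare right factor ⟦V⟧; it
has weight 1 and contributes the extra right derivative. The other right factors ∂_x^{k-i}⟦V⟧ have
no ⟦V⟧-component, so the reading is multiplicative on them. For k = 1 there are no products. -/
theorem IsSatoSequence.reading_succ (hb : IsSatoSequence n b) (hp : IsScatteringKernel p)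
    (hx : IsUnit (1 - opP p x 0 0)) {k : ℕ} (hk : 1 ≤ k) (hkn : k ≤ n) (j : ℕ) :
    reading p j (b (k + 1)) x = -satoL n (fun i => reading p 0 (b i)) k (reading p j vKer) x
      - if k = 1 then 0 else reading p (j + 1) (b k) x := by
  have lin_add : ∀ X Y, reading p j (X + Y) x = reading p j X x + reading p j Y x := fun X Y => by
    simp only [reading, map_add]
  have lin_smul : ∀ (c : ℝ) X, reading p j (c • X) x = c • reading p j X x := fun c X => by
    simp only [reading, map_smul]
  have lin_neg : ∀ X, reading p j (-X) x = -reading p j X x := fun X => by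
    simp only [reading, map_neg]
  have lin_sum : ∀ (s : Finset ℕ) (X : ℕ → AP),
      reading p j (∑ i ∈ s, X i) x = ∑ i ∈ s, reading p j (X i) x := fun s X => by
    simp only [reading, map_sum]
  have hprod : ∀ i ∈ Finset.Icc 2 k, reading p j (augMul (b i) ((dx ^ (k - i)) vKer)) x
      = reading p 0 (b i) x * iteratedDeriv (k - i) (reading p j vKer) x
        + if i = k then reading p (j + 1) (b k) x else 0 := by
    intro i hi
    have hi' := Finset.mem_Icc.1 hi
    have hbi := (hb i hi'.1 (by omega)).2
    rw [iteratedDeriv_reading hp hx]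
    by_cases hik : i = k
    · subst hik
      rw [Nat.sub_self, if_pos rfl, pow_zero, Module.End.one_apply, reading_augMul_vKer hp hx j hbi]
    · obtain ⟨c, hc⟩ : ∃ c, k - i = c + 1 := ⟨k - i - 1, by omega⟩
      rw [if_neg hik, add_zero, hc, pow_succ', Module.End.mul_apply,
        reading_augMul hp hx j hbi (dx_apply_nil _)]
  have hsum : ∑ l ∈ Finset.Icc 3 (k + 1), ((n + 1 - l).choose (k + 1 - l) : ℝ) •
        augMul (b (l - 1)) ((dx ^ (k + 1 - l)) vKer)
      = ∑ i ∈ Finset.Icc 2 k, ((n - i).choose (k - i) : ℝ) •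
        augMul (b i) ((dx ^ (k - i)) vKer) := by
    refine Finset.sum_nbij' (fun l => l - 1) (fun i => i + 1) ?_ ?_ ?_ ?_ ?_
    · intro l hl
      simp only [Finset.mem_Icc] at hl ⊢
      omega
    · intro i hi
      simp only [Finset.mem_Icc] at hi ⊢
      omega
    · intro l hl
      simp only [Finset.mem_Icc] at hl
      omega
    · intro i _
      omega
    · intro l hl
      simp only [Finset.mem_Icc] at hl
      rw [show n + 1 - l = n - (l - 1) by omega, show k + 1 - l = k - (l - 1) by omega]
  have hlast : ∑ i ∈ Finset.Icc 2 k, ((n - i).choose (k - i) : ℝ) •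
        (if i = k then reading p (j + 1) (b k) x else 0)
      = if k = 1 then 0 else reading p (j + 1) (b k) x := by
    by_cases h1 : k = 1
    · subst h1
      simp
    · rw [if_neg h1, Finset.sum_eq_single k]
      · simp
      · intro i _ hik
        rw [if_neg hik]
        module
      · intro hk'
        exact absurd (Finset.mem_Icc.2 ⟨by omega, le_rfl⟩) hk'
  rw [(hb (k + 1) (by omega) (by omega)).1, Nat.add_sub_cancel, hsum, lin_neg, lin_add, lin_smul,
    lin_sum, ← iteratedDeriv_reading hp hx, satoL,
    Finset.sum_congr rfl fun i hi => by rw [lin_smul, hprod i hi, smul_add],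
    Finset.sum_add_distrib, hlast]
  abel

/-- Each use of `IsSatoSequence.reading_succ` lowers k, adds a right derivative and changes the
sign. For j = 0 the i-th summand therefore carries the sign and the derivatives of w_i. The general
j is needed for the induction. -/
theorem IsSatoSequence.reading_eq (hb : IsSatoSequence n b) (hp : IsScatteringKernel p)
    (hx : IsUnit (1 - opP p x 0 0)) {k : ℕ} (hk : 1 ≤ k) (hkn : k ≤ n) (j : ℕ) :
    reading p j (b (k + 1)) x = ∑ i ∈ Finset.Icc 1 k, (-1 : ℝ) ^ i •
      satoL n (fun i => reading p 0 (b i)) (k + 1 - i) (reading p (j + (i - 1)) vKer) x := by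
  induction k, hk using Nat.le_induction generalizing j with
  | base =>
    rw [hb.reading_succ hp hx le_rfl hkn]
    simp only [if_true, sub_zero, Finset.Icc_self, Finset.sum_singleton, pow_one,
      Nat.add_sub_cancel, Nat.sub_self, add_zero]
    module
  | succ k hk ih =>
    rw [hb.reading_succ hp hx (by omega) hkn, if_neg (by omega), ih (by omega)]
    have e : Finset.Icc 1 (k + 1) = insert 1 (Finset.Icc 2 (k + 1)) := by
      ext i
      simp only [Finset.mem_insert, Finset.mem_Icc]
      omega
    have hneg : ∀ Z : Mat m, (-1 : ℝ) • Z = -Z := fun Z => by module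
    rw [e, Finset.sum_insert (by simp), pow_one, hneg, Nat.add_sub_cancel, Nat.sub_self,
      add_zero, sub_eq_add_neg, ← Finset.sum_neg_distrib]
    congr 1
    refine Finset.sum_nbij' (fun i => i + 1) (fun i => i - 1) ?_ ?_ ?_ ?_ ?_
    · intro i hi
      simp only [Finset.mem_Icc] at hi ⊢
      omega
    · intro i hi
      simp only [Finset.mem_Icc] at hi ⊢
      omega
    · intro i _
      omega
    · intro i hi
      simp only [Finset.mem_Icc] at hi
      omega
    · intro i hi
      simp only [Finset.mem_Icc] at hi
      rw [pow_succ, mul_comm, mul_smul, hneg, show k + 1 + 1 - (i + 1) = k + 1 - i by omega,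
        show j + 1 + (i - 1) = j + (i + 1 - 1) by omega]

/-- The derivative of a reading is again a reading, on the same open set. -/
theorem contDiffAt_reading (hp : IsScatteringKernel p) (hx : IsUnit (1 - opP p x 0 0)) (j : ℕ)
    (X : AP) (i : ℕ) : ContDiffAt ℝ i (reading p j X) x := by
  have hΩ := isOpen_isUnit_one_sub_opP hp
  suffices h : ∀ X, ContDiffOn ℝ i (reading p j X) {x | IsUnit (1 - opP p x 0 0)} from
    (h X).contDiffAt (hΩ.mem_nhds hx)
  induction i with
  | zero =>
    intro X
    exact contDiffOn_zero.2 fun y hy =>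
      (hasDerivAt_reading hp hy j X).continuousAt.continuousWithinAt
  | succ i ih =>
    intro X
    rw [Nat.cast_succ, contDiffOn_succ_iff_deriv_of_isOpen hΩ]
    refine ⟨fun y hy => (hasDerivAt_reading hp hy j X).differentiableAt.differentiableWithinAt,
      by simp, (ih (dx X)).congr fun y hy => (hasDerivAt_reading hp hy j X).deriv⟩

theorem satoL_gaugeCoeff (hp : IsScatteringKernel p) (hx : IsUnit (1 - opP p x 0 0)) (n : ℕ)
    (S : ℕ → ℝ → Mat m) (k j : ℕ) : satoL n S k (gaugeCoeff p j) x
      = (-1 : ℝ) ^ j • satoL n S k (reading p (j - 1) vKer) x :=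
  satoL_smul_of_eventuallyEq n S k _ (mem_of_superset ((isOpen_isUnit_one_sub_opP hp).mem_nhds hx)
    fun _ hy => gaugeCoeff_eq_reading hp hy j) (contDiffAt_reading hp hx (j - 1) vKer)

theorem IsSatoSequence.satoCoeff_eq_reading (hb : IsSatoSequence n b) (hp : IsScatteringKernel p)
    (hx : IsUnit (1 - opP p x 0 0)) (k : ℕ) (hk : 2 ≤ k) (hkn : k ≤ n + 1) :
    satoCoeff n (gaugeCoeff p) k x = reading p 0 (b k) x := by
  induction k using Nat.strong_induction_on with
  | h k ih =>
    obtain ⟨k, rfl⟩ := Nat.exists_eq_add_of_le' (show 1 ≤ k by omega)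
    rw [satoCoeff_eq, hb.reading_eq hp hx (by omega) (by omega), Nat.add_sub_cancel]
    refine Finset.sum_congr rfl fun j hj => ?_
    have hj' := Finset.mem_Icc.1 hj
    rw [satoL_gaugeCoeff hp hx, zero_add]
    congr 1
    refine satoL_congr n _ fun i hi => ?_
    have hi' := Finset.mem_Icc.1 hi
    exact ih i (by omega) (by omega) (by omega)

end SatoCoefficients

/-! ### The Riccati system and the hierarchy equation -/

section HierarchyEquation

variable {m : ℕ} {p : ℝ → ℝ → Mat m} {x : ℝ}

theorem mat_neg_smul (c : ℝ) (A : Mat m) : (-c) • A = -(c • A) := by module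

theorem mat_smul_mul (c : ℝ) (A B : Mat m) : (c • A) * B = c • (A * B) := rfl

theorem mat_mul_smul (c : ℝ) (A B : Mat m) : A * (c • B) = c • (A * B) :=
  ContinuousLinearMap.comp_smul A c B

theorem mat_smul_add (c : ℝ) (A B : Mat m) : c • (A + B) = c • A + c • B := smul_add c A B

/-- The affine coordinates `γ_{k,j}` of the point of the Sato Grassmannian given by `p`. -/
noncomputable def affineCoord (p : ℝ → ℝ → Mat m) (k j : ℕ) (x : ℝ) : Mat m :=
  (-1 : ℝ) ^ j • corner m (bP p x k j + bP p x k 0 * bV p x * bP p x 0 j)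

/-- `BorderedRelations.product` turns γ_{k,0} γ_{0,j} into the terms where V, or an order of P
facing V, is differentiated. The remaining left derivatives form γ_{k+1,j}; the remaining right
derivatives form -γ_{k,j+1}, by the sign (-1)^j. -/
theorem hasDerivAt_affineCoord (hp : IsScatteringKernel p) (hx : IsUnit (1 - opP p x 0 0))
    (k j : ℕ) : HasDerivAt (affineCoord p k j)
      (affineCoord p (k + 1) j x + affineCoord p k 0 x * affineCoord p 0 j x
        - affineCoord p k (j + 1) x) x := by
  have hd := (hasDerivAt_bP hp k j x).add
    (((hasDerivAt_bP hp k 0 x).mul (hasDerivAt_bV hp hx)).mul (hasDerivAt_bP hp 0 j x))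
  have h1 := ((corner m).hasFDerivAt.comp_hasDerivAt x hd).const_smul ((-1 : ℝ) ^ j)
  refine h1.congr_deriv ?_
  have hprod : affineCoord p k 0 x * affineCoord p 0 j x = (-1 : ℝ) ^ j • corner m
      (bP p x k 1 * bV p x * bP p x 0 j + bP p x k 0 * bV p x * bP p x 1 j
        + bP p x k 0 * bV p x * bP p x 0 1 * bV p x * bP p x 0 j
        + bP p x k 0 * bV p x * bP p x 1 0 * bV p x * bP p x 0 j) := by
    rw [← (borderedRelations_bP hp hx).product k 0 0 j, corner_mul_bordE_mul, affineCoord,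
      affineCoord, pow_zero, one_smul, mat_mul_smul]
  rw [hprod, affineCoord, affineCoord, pow_succ, mul_neg_one, mat_neg_smul, sub_neg_eq_add,
    ← mat_smul_add, ← mat_smul_add, ← map_add, ← map_add]
  congr 2
  noncomm_ring

theorem gaugeCoeff_eq_affineCoord (hp : IsScatteringKernel p) (hx : IsUnit (1 - opP p x 0 0))
    {j : ℕ} (hj : 1 ≤ j) : gaugeCoeff p j x = -affineCoord p 0 (j - 1) x := by
  obtain ⟨j, rfl⟩ := Nat.exists_eq_add_of_le' hj
  rw [gaugeCoeff_eq_reading hp hx, Nat.add_sub_cancel, reading, kerLin_apply, vKer, tailLin_mono,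
    tailEv, affineCoord, add_mul, one_mul, pow_succ, mul_neg_one, mat_neg_smul]

/-- The right-hand side `b_{-1}` of the hierarchy equation. -/
theorem satoCoeff_gaugeCoeff_succ (hp : IsScatteringKernel p) (hx : IsUnit (1 - opP p x 0 0))
    {n : ℕ} (hn : 1 ≤ n) : satoCoeff n (gaugeCoeff p) (n + 1) x
      = -corner m ((1 + bP p x 0 0 * bV p x) * (bP p x n 0 - (-1 : ℝ) ^ n • bP p x 0 n)
        * (1 + bV p x * bP p x 0 0)) := by
  rw [satoCoeff_of_riccati (isOpen_isUnit_one_sub_opP hp) (affineCoord p)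
    (fun k j y hy => hasDerivAt_affineCoord hp hy k j) (gaugeCoeff p)
    (fun j hj y hy => gaugeCoeff_eq_affineCoord hp hy hj) n hn x hx,
    (borderedRelations_bP hp hx).alternating_sum n, map_add, map_sub, map_sum, map_smul]
  congr 2
  · simp only [affineCoord, pow_zero, one_smul]
  · refine Finset.sum_nbij' (fun j => j - 1) (fun i => i + 1) ?_ ?_ ?_ ?_ ?_
    · intro j hj
      simp only [Finset.mem_Icc, Finset.mem_range] at hj ⊢
      omega
    · intro i hi
      simp only [Finset.mem_Icc, Finset.mem_range] at hi ⊢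
      omega
    · intro j hj
      simp only [Finset.mem_Icc] at hj
      omega
    · intro i _
      omega
    · intro j hj
      have hj' := Finset.mem_Icc.1 hj
      rw [map_smul, corner_mul_bordE_mul, affineCoord, affineCoord, pow_zero, one_smul,
        mat_smul_mul, show n - 1 - (j - 1) = n - j by omega]

/-- With D the time derivative of P one has V' = VDV, so P + PVP has derivative (1 + PV) D (1 + VP).
-/
theorem SolvesBase.hasDerivAt_gaugeCoeff {n : ℕ} {T : Set ℝ} {p : ℝ → ℝ → ℝ → Mat m}
    (h : SolvesBase n T p) {s : ℝ} (hs : s ∈ T) (hx : IsUnit (1 - opP (p s) x 0 0)) :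
    HasDerivAt (fun s' => gaugeCoeff (p s') 1 x)
      (-corner m ((1 + bP (p s) x 0 0 * bV (p s) x)
        * (bP (p s) x n 0 - (-1 : ℝ) ^ n • bP (p s) x 0 n)
        * (1 + bV (p s) x * bP (p s) x 0 0))) s := by
  have hop : ∀ a b, HasDerivAt (fun s => opOf (shiftFamily (p s) x a b))
      (opOf (shiftFamily (p s) x (a + n) b)
        + (-(-1 : ℝ) ^ n) • opOf (shiftFamily (p s) x a (b + n))) s := fun a b => by
    rw [neg_smul, ← sub_eq_add_neg]
    exact h.hasDerivAt_opP a b hs x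
  have hfam : ∀ᶠ s' in 𝓝 s, KernelFamily (shiftFamily (p s') x) := by
    filter_upwards [h.isOpen.mem_nhds hs] with s' hs' using (h.kernel s' hs').kernelFamily x
  have h00 := hop 0 0
  rw [zero_add] at h00
  have hP := hasDerivAt_bordP_of_shift (f := fun s => shiftFamily (p s) x) hfam hop 0 0
  have hV : HasDerivAt (fun s => bV (p s) x) _ s :=
    hasDerivAt_bordV_of_shift (f := fun s => shiftFamily (p s) x) h00 hx
  rw [zero_add] at hP
  have hd := ((corner m).hasFDerivAt.comp_hasDerivAt s (hP.add ((hP.mul hV).mul hP))).neg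
  have e : (fun s' => gaugeCoeff (p s') 1 x) =ᶠ[𝓝 s]
      fun s' => -corner m (bP (p s') x 0 0 + bP (p s') x 0 0 * bV (p s') x * bP (p s') x 0 0) := by
    filter_upwards [h.isOpen.mem_nhds hs,
      eventually_isUnit_one_sub (h.hasDerivAt_opP 0 0 hs x).continuousAt hx] with s' hs' hx'
    rw [gaugeCoeff_eq_affineCoord (h.kernel s' hs') hx' le_rfl, affineCoord, Nat.sub_self, pow_zero,
      one_smul]
  refine HasDerivAt.congr_of_eventuallyEq (hd.congr_deriv ?_) e
  have hneg : bP (p s) x n 0 + (-(-1 : ℝ) ^ n) • bP (p s) x 0 n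
      = bP (p s) x n 0 - (-1 : ℝ) ^ n • bP (p s) x 0 n := by module
  rw [← hneg]
  generalize bP (p s) x n 0 + (-(-1 : ℝ) ^ n) • bP (p s) x 0 n = D
  change -corner m (D + ((D * bV (p s) x + bP (p s) x 0 0 * (bV (p s) x * D * bV (p s) x))
    * bP (p s) x 0 0 + bP (p s) x 0 0 * bV (p s) x * D)) = _
  congr 2
  noncomm_ring

end HierarchyEquation

end KP

theorem corollary6p5 (n : ℕ) (hn : 1 ≤ n) :
    -- `b k` is the Sato coefficient `b_{n-k}` as an element of the augmented pre-Pöppe algebra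
    ∃ b : ℕ → KP.AP,
      (∀ k : ℕ, 2 ≤ k → k ≤ n + 1 →
        b k = -((n.choose (k - 1) : ℝ) • (KP.dx ^ (k - 1)) KP.vKer
            + ∑ l ∈ Finset.Icc 3 k, ((n + 1 - l).choose (k - l) : ℝ) •
                KP.augMul (b (l - 1)) ((KP.dx ^ (k - l)) KP.vKer))
          ∧ b k [] = 0) ∧
      (∀ (m : ℕ) (p : ℝ → ℝ → KP.Mat m), KP.IsScatteringKernel p →
        ∀ x : ℝ, IsUnit (1 - KP.opP p x 0 0) →
          ∀ k : ℕ, 2 ≤ k → k ≤ n + 1 →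
            KP.satoCoeff n (KP.gaugeCoeff p) k x = KP.realise p x (b k)) ∧
      (∀ (m : ℕ) (T : Set ℝ) (p : ℝ → ℝ → ℝ → KP.Mat m), KP.SolvesBase n T p →
        ∀ s ∈ T, ∀ x : ℝ, IsUnit (1 - KP.opP (p s) x 0 0) →
          HasDerivAt (fun s' => KP.gaugeCoeff (p s') 1 x)
            (KP.satoCoeff n (KP.gaugeCoeff (p s)) (n + 1) x) s) := by
  obtain ⟨b, hb⟩ := KP.exists_isSatoSequence n
  refine ⟨b, hb, fun m p hp x hx k hk hkn => ?_, fun m T p h s hs x hx => ?_⟩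
  · rw [KP.realise_eq_reading hp hx (hb k hk hkn).2, hb.satoCoeff_eq_reading hp hx k hk hkn]
  · rw [KP.satoCoeff_gaugeCoeff_succ (h.kernel s hs) hx hn]
    exact h.hasDerivAt_gaugeCoeff hs hx
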